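/- **Theorem 1.5.** Let $\mathbb H^{n+1}=\big(\mathbb B^{n+1},\bar g=\tfrac{4}{(1-|x|^2)^2}\delta\big)$ be the Poincaré ball model of hyperbolic space, where $\delta$ is the Euclidean metric on the open unit ball, and put $\mathbb B^{n+1}_+=\{x\in\mathbb B^{n+1}:\ x_{n+1}\ge 0\}$, $P=\{x\in\mathbb B^{n+1}:\ x_{n+1}=0\}$, with outward unit normal $\overline N=-\tfrac{1-|x|^2}{2}E_{n+1}$ of $\mathbb B^{n+1}_+$ along $P$. Let $\Sigma$ be a nonempty compact smooth $n$-dimensional manifold with (possibly empty) boundary, $X:\Sigma\to\mathbb B^{n+1}_+$ a smooth immersion and $\nu$ a smooth unit normal field along $X$, such that $(\Sigma,X,\nu)$ is a capillary hypersurface supported on $P$: the interior of $\Sigma$ is mapped into $\{x_{n+1}>0\}$, $\partial\Sigma$ is mapped into $P$, and there is a constant $\theta\in(0,\pi)$ with $\bar g(\overline N,-\nu)=\cos\theta$ along $\partial\Sigma$. Let $h(Y,Z)=\bar g(\overline\nabla_Y\nu,Z)$ be the second fundamental form, where $\overline\nabla$ is the Levi-Civita connection of $\bar g$; let $\lambda_1,\dots,\lambda_n$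 be its eigenvalues with respect to the induced metric $g$ (the principal curvatures), and let $$H_j=\binom nj^{-1}\sum_{1\le i_1<\cdots<i_j\le n}\lambda_{i_1}\cdots\lambda_{i_j},\qquad 1\le j\le n.$$ Let $n\ge k>l\ge 1$. If $H_l>0$ on $\Sigma$ and there is a constant $\alpha\in\mathbb R$ with $H_k/H_l=\alpha$ on $\Sigma$, then $\Sigma$ is totally umbilical (at each point, $h$ is a multiple of $g$) and not totally geodesic ($h$ does not vanish identically). -/

import Mathlib

open scoped Manifold ContDiff RealInnerProductSpace

noncomputable section

namespace Capillary

/-- The Euclidean space `ℝⁿ⁺¹` containing the Poincare ball. -/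
abbrev Amb (n : ℕ) : Type := EuclideanSpace ℝ (Fin (n + 1))

/-! ### The Poincare ball model of hyperbolic space -/

/-- The open unit ball, the underlying set of the Poincare ball model. -/
def poincareBall (n : ℕ) : Set (Amb n) := Metric.ball 0 1

/-- The constant Euclidean unit vector `E_{n+1}`. -/
def lastVec (n : ℕ) : Amb n := EuclideanSpace.single (Fin.last n) (1 : ℝ)

/-- The hyperbolic metric `4 / (1 - |x|²)² δ` at the point `x` of the ball. -/
def hypMetric {n : ℕ} (x Y Z : Amb n) : ℝ := 4 / (1 - ‖x‖ ^ 2) ^ 2 * ⟪Y, Z⟫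

/-- The Christoffel term of the Levi-Civita connection of the hyperbolic metric:
`∇_Y Z = D_Y Z + christoffel x Y Z`, where `D` is the usual derivative in `ℝⁿ⁺¹`. -/
def christoffel {n : ℕ} (x Y Z : Amb n) : Amb n :=
  (2 / (1 - ‖x‖ ^ 2)) • (⟪x, Y⟫ • Z + ⟪x, Z⟫ • Y - ⟪Y, Z⟫ • x)

/-- The connection is torsion free. -/
theorem christoffel_symm {n : ℕ} (x Y Z : Amb n) : christoffel x Y Z = christoffel x Z Y := by
  unfold christoffel
  rw [real_inner_comm Y Z, add_comm (⟪x, Y⟫ • Z)]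

/-- The connection is compatible with the metric. Together with `christoffel_symm` this
characterizes the Levi-Civita connection. -/
theorem hypMetric_compatible {n : ℕ} {x : Amb n} (hx : x ∈ poincareBall n) (Y Z W : Amb n) :
    HasDerivAt (fun t : ℝ => hypMetric (x + t • Y) Z W)
      (hypMetric x (christoffel x Y Z) W + hypMetric x Z (christoffel x Y W)) 0 := by
  have hx1 : ‖x‖ < 1 := by simpa [poincareBall] using hx
  have hpos : (1 - ‖x‖ ^ 2) ≠ 0 := by nlinarith [norm_nonneg x]
  have h1 : HasDerivAt (fun t : ℝ => x + t • Y) Y 0 := by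
    simpa using ((hasDerivAt_id (0 : ℝ)).smul_const Y).const_add x
  have h2 := h1.norm_sq
  have h3 : HasDerivAt (fun t : ℝ => hypMetric (x + t • Y) Z W) _ 0 :=
    (((h2.const_sub 1).fun_pow 2).fun_inv (by simpa using hpos)).const_mul 4 |>.mul_const ⟪Z, W⟫
  refine h3.congr_deriv ?_
  simp only [hypMetric, christoffel, inner_smul_left, inner_smul_right, inner_sub_left,
    inner_sub_right, inner_add_left, inner_add_right, zero_smul, add_zero]
  rw [real_inner_comm x Z, real_inner_comm Y Z]
  simp
  field_simp
  ring

/-! ### Immersed hypersurfaces of the ball -/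

section Hypersurface

variable {n : ℕ} [NeZero n] {M : Type*} [TopologicalSpace M] [ChartedSpace (EuclideanHalfSpace n) M]

/-- The differential of a map from the hypersurface to `ℝⁿ⁺¹`. -/
def diff (F : M → Amb n) (p : M) : TangentSpace (𝓡∂ n) p →L[ℝ] Amb n :=
  mfderiv (𝓡∂ n) 𝓘(ℝ, Amb n) F p

/-- The outward unit normal `-((1 - |x|²) / 2) E_{n+1}` of the half ball along the totally geodesic
hyperplane `P = {x_{n+1} = 0}`. -/
def supportNormal (x : Amb n) : Amb n := -((1 - ‖x‖ ^ 2) / 2) • lastVec n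

/-- `X : M → B⁺` is a smooth immersion of the `n`-manifold with boundary `M` in the closed half
`{x_{n+1} ≥ 0}` of the Poincare ball, with smooth unit normal field `ν`, whose interior is mapped
into `{x_{n+1} > 0}`, whose boundary is mapped into the hyperplane `P = {x_{n+1} = 0}`, and which
meets `P` along the boundary at the constant contact angle `θ ∈ (0, π)`, the angle between the
outward normal of `P` and `-ν`. -/
structure IsCapillary (X ν : M → Amb n) (θ : ℝ) : Prop where
  smooth : ContMDiff (𝓡∂ n) 𝓘(ℝ, Amb n) ∞ X
  immersion : ∀ p, Function.Injective (diff X p)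
  mem_ball : ∀ p, X p ∈ poincareBall n
  interior_pos : ∀ p, (𝓡∂ n).IsInteriorPoint p → 0 < ⟪X p, lastVec n⟫
  boundary_zero : ∀ p, (𝓡∂ n).IsBoundaryPoint p → ⟪X p, lastVec n⟫ = 0
  normal_smooth : ContMDiff (𝓡∂ n) 𝓘(ℝ, Amb n) ∞ ν
  normal_unit : ∀ p, hypMetric (X p) (ν p) (ν p) = 1
  normal_orth : ∀ p v, hypMetric (X p) (ν p) (diff X p v) = 0
  angle_mem : θ ∈ Set.Ioo 0 Real.pi
  contact : ∀ p, (𝓡∂ n).IsBoundaryPoint p →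
    hypMetric (X p) (supportNormal (X p)) (-ν p) = Real.cos θ

/-- The induced metric `g`. -/
def firstForm (X : M → Amb n) (p : M) (v w : TangentSpace (𝓡∂ n) p) : ℝ :=
  hypMetric (X p) (diff X p v) (diff X p w)

/-- The covariant derivative `∇_v ν` of the vector field `ν` along `X`. -/
def covDeriv (X ν : M → Amb n) (p : M) (v : TangentSpace (𝓡∂ n) p) : Amb n :=
  diff ν p v + christoffel (X p) (diff X p v) (ν p)

/-- The second fundamental form `h(v, w) = g(∇_v ν, w)`. -/
def secondForm (X ν : M → Amb n) (p : M) (v w : TangentSpace (𝓡∂ n) p) : ℝ :=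
  hypMetric (X p) (covDeriv X ν p v) (diff X p w)

/-- The coordinate basis of the tangent space. -/
def coordVec (p : M) (i : Fin n) : TangentSpace (𝓡∂ n) p :=
  (EuclideanSpace.single i (1 : ℝ) : EuclideanSpace ℝ (Fin n))

/-- The Gram matrix `(g_{ij})` of the induced metric in the coordinate basis. -/
def firstMatrix (X : M → Amb n) (p : M) : Matrix (Fin n) (Fin n) ℝ :=
  Matrix.of fun i j => firstForm X p (coordVec p i) (coordVec p j)

/-- The matrix `(h_{ij})` of the second fundamental form in the coordinate basis. -/
def secondMatrix (X ν : M → Amb n) (p : M) : Matrix (Fin n) (Fin n) ℝ :=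
  Matrix.of fun i j => secondForm X ν p (coordVec p i) (coordVec p j)

/-- The matrix `g^{-1} h` of the Weingarten map, `g(S v, w) = h(v, w)`. -/
def weingarten (X ν : M → Amb n) (p : M) : Matrix (Fin n) (Fin n) ℝ :=
  (firstMatrix X p)⁻¹ * secondMatrix X ν p

/-- The principal curvatures `λ₁, …, λₙ`: the eigenvalues of the Weingarten map, with
multiplicity. -/
def principalCurvatures (X ν : M → Amb n) (p : M) : Multiset ℝ :=
  (weingarten X ν p).charpoly.roots

/-- The normalized `k`-th mean curvature: the `k`-th elementary symmetric function of the
principal curvatures divided by `n.choose k`. -/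
def meanCurvature (X ν : M → Amb n) (k : ℕ) (p : M) : ℝ :=
  (principalCurvatures X ν p).esymm k / (n.choose k : ℝ)

/-- At each point the second fundamental form is a multiple of the induced metric. -/
def IsTotallyUmbilical (X ν : M → Amb n) : Prop :=
  ∃ c : M → ℝ, ∀ p v w, secondForm X ν p v w = c p * firstForm X p v w

/-- The second fundamental form vanishes identically. -/
def IsTotallyGeodesic (X ν : M → Amb n) : Prop :=
  ∀ p v w, secondForm X ν p v w = 0

end Hypersurface

end Capillary

end

/-!
The proof is the classical one by Minkowski formulae, carried out in the hyperboloid model.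

Stereographic projection turns the Poincare ball into the hyperboloid in Minkowski space; only the
spatial parts are needed: `hypX X`, of the hypersurface, and `hypN X ν`, of its unit normal. They
satisfy `dN = dX ∘ S` with the Weingarten map `S` (`baseDeriv_hypN_eq`). With `E = E_{n+1}`, the
hyperplane `P` is `⟨X, E⟩ = 0`, and the capillary condition says that `⟨N, E⟩ = cos θ` along the
boundary. Let `Y_t` be the vector field on the hypersurface which is dual to the `(n-1)`-form
`det(X, N - cos θ E, dΦ, …, dΦ)`, where `Φ = X + t N`. Then

* at the boundary all vectors in the determinant that gives the normal component of `Y_t` are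
  orthogonal to `E`, so that `Y_t` is tangent to the boundary (`detField_boundary`);
* as second derivatives are symmetric and `dΦ = dX ∘ (1 + t S)`, the divergence of `Y_t` is a
  combination of `∑ (n - j) σ_j t^j` and `∑ j σ_j t^(j-1)` (`divergence_parallel`).

The divergence theorem on the compact hypersurface, proved from the one for boxes with a partition
of unity, and comparison of the coefficients in `t` give `∫ r H_j = ∫ q H_{j+1}` for `0 ≤ j < n`,
also with a locally constant weight (`integral_meanCurvature`). Here `q` and `r` are the normal
components of `X` and of `N - cos θ E`, and `r > 0` since `|cos θ| < 1`. The integrals are taken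
with respect to the measure with density `|det(N, ∂₁X, …, ∂ₙX)|`, which is the area multiplied by the
positive time component of the position. Hence `H_k = α H_l` gives `∫ r (H_{k-1} - α H_{l-1}) = 0`.

It remains to see that the integrand has a sign. At a maximum of the height over a nonempty open
and closed subset, all principal curvatures are nonzero and of one sign, by comparison with a level
set of the height (`exists_elliptic_point`). So `α ≠ 0` and `H_k` has no zeros. The set where
the principal curvatures lie in the Gårding cone of order `k` is then open and closed, as is the
set where their negatives do (`isClopen_gardingSet`), and these two sets cover the hypersurface
(`gardingSet_union`). On each of them the Newton-Maclaurin inequality (`newton_maclaurin`) fixes the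
sign of `H_{k-1} - α H_{l-1}`, and the locally constant weight makes it nonnegative. So equality
holds in the inequality at each point, which forces all principal curvatures to agree.
-/

open scoped Manifold ContDiff RealInnerProductSpace

noncomputable section

namespace Capillary

/-! ### Normalized elementary symmetric functions and Newton's inequalities -/

open Polynomial in
/-- Differentiating `∏ (X + r)` gives a real-rooted polynomial, by Rolle, with the same normalized
elementary symmetric functions. -/
theorem exists_multiset_derivative {n : ℕ} (s : Multiset ℝ) (hs : Multiset.card s = n + 1) :
    ∃ t : Multiset ℝ, Multiset.card t = n ∧
      ∀ j ≤ n, t.esymm j / (n.choose j : ℝ) = s.esymm j / ((n + 1).choose j : ℝ) := by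
  set p : ℝ[X] := (s.map fun r => X + C r).prod with hp
  have hpm : p.Monic := monic_multiset_prod_of_monic _ _ fun r _ => monic_X_add_C r
  have hdeg : p.natDegree = n + 1 := by
    rw [hp, natDegree_multiset_prod_of_monic _ (by simp +contextual [monic_X_add_C])]
    simp [hs, add_comm]
  have hroots : p.roots = s.map fun r => -r := by
    have : p = ((s.map fun r => -r).map fun a => X - C a).prod := by
      rw [hp, Multiset.map_map]; simp
    rw [this, roots_multiset_prod_X_sub_C]
  have hcard : Multiset.card p.roots = n + 1 := by simp [hroots, hs]
  have hdd : p.derivative.natDegree = n := by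
    rw [natDegree_derivative, hdeg]; simp
  have hlead : p.derivative.leadingCoeff = n + 1 := by
    rw [leadingCoeff, hdd, coeff_derivative]
    have := hpm.coeff_natDegree
    rw [hdeg] at this
    rw [this]; simp
  have hcd : Multiset.card p.derivative.roots = p.derivative.natDegree := by
    have h1 := card_roots_le_derivative p
    have h2 := p.derivative.card_roots'
    omega
  refine ⟨p.derivative.roots.map Neg.neg, by simp [hcd, hdd], fun j hj => ?_⟩
  have h3 := coeff_eq_esymm_roots_of_card hcd (k := n - j) (by omega)
  rw [hlead, hdd, coeff_derivative, Nat.sub_sub_self hj, hp,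
    Multiset.prod_X_add_C_coeff _ (by omega), hs, show n + 1 - (n - j + 1) = j by omega] at h3
  rw [Multiset.esymm_neg]
  have h4 : ((n + 1).choose j : ℝ) * ((n - j : ℕ) + 1) = (n + 1) * (n.choose j : ℝ) := by
    have := Nat.choose_mul_succ_eq n j
    rw [show n + 1 - j = n - j + 1 by omega] at this
    have h5 : ((n.choose j * (n + 1) : ℕ) : ℝ) = (((n + 1).choose j * (n - j + 1) : ℕ) : ℝ) := by
      rw [this]
    push_cast at h5 ⊢
    linarith
  have c1 : (0 : ℝ) < n.choose j := by exact_mod_cast Nat.choose_pos hj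
  have c2 : (0 : ℝ) < (n + 1).choose j := by exact_mod_cast Nat.choose_pos (by omega)
  rw [div_eq_div_iff c1.ne' c2.ne']
  have c3 : (0 : ℝ) < n + 1 := by positivity
  apply mul_left_cancel₀ c3.ne'
  linear_combination (-((n + 1).choose j : ℝ)) * h3 + s.esymm j * h4

/-- Repeated differentiation: the normalized elementary symmetric functions of order at most `m`
of a family of real numbers are those of a family of only `m` real numbers. -/
theorem exists_multiset_truncation (s : Multiset ℝ) {m : ℕ} (hm : m ≤ Multiset.card s) :
    ∃ t : Multiset ℝ, Multiset.card t = m ∧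
      ∀ j ≤ m, t.esymm j / (m.choose j : ℝ) = s.esymm j / ((Multiset.card s).choose j : ℝ) := by
  obtain ⟨d, hd⟩ := Nat.exists_eq_add_of_le hm
  induction d generalizing m with
  | zero => exact ⟨s, by omega, fun j hj => by rw [hd]; simp⟩
  | succ d ih =>
    obtain ⟨t, ht, h⟩ := ih (m := m + 1) (by omega) (by omega)
    obtain ⟨u, hu, h'⟩ := exists_multiset_derivative t ht
    exact ⟨u, hu, fun j hj => (h' j hj).trans (h j (by omega))⟩

theorem esymm_pos_of_pos (t : Multiset ℝ) (ht : ∀ r ∈ t, 0 < r) {j : ℕ}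
    (hj : j ≤ Multiset.card t) : 0 < t.esymm j := by
  have hpos : ∀ u ∈ t.powersetCard j, 0 < u.prod := by
    intro u hu
    have hu' := (Multiset.mem_powersetCard.1 hu).1
    exact Multiset.prod_induction (fun x => 0 < x) u (fun _ _ => mul_pos) one_pos
      fun r hr => ht r (Multiset.mem_of_le hu' hr)
  have hne : t.powersetCard j ≠ 0 := by
    intro h
    have := Multiset.card_powersetCard j t
    rw [h, Multiset.card_zero] at this
    exact (Nat.choose_pos hj).ne this
  rw [Multiset.esymm]
  obtain ⟨u, hu⟩ := Multiset.exists_mem_of_ne_zero hne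
  obtain ⟨w, hw⟩ := Multiset.exists_cons_of_mem hu
  rw [hw] at hpos ⊢
  rw [Multiset.map_cons, Multiset.sum_cons]
  refine add_pos_of_pos_of_nonneg (hpos u (Multiset.mem_cons_self _ _)) ?_
  refine Multiset.sum_nonneg fun x hx => ?_
  obtain ⟨v, hv, rfl⟩ := Multiset.mem_map.1 hx
  exact (hpos v (Multiset.mem_cons_of_mem hv)).le

open Polynomial in
/-- A polynomial with nonnegative coefficients and nonzero constant term has no root `-r ≥ 0`. -/
theorem pos_of_esymm_nonneg (t : Multiset ℝ) (h : ∀ j ≤ Multiset.card t, 0 ≤ t.esymm j)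
    (h0 : t.esymm (Multiset.card t) ≠ 0) : ∀ r ∈ t, 0 < r := by
  intro r hr
  by_contra! hr0
  have h1 : (t.map fun r => X + C r).prod.eval (-r) = 0 := by
    rw [eval_multiset_prod]
    refine Multiset.prod_eq_zero ?_
    rw [Multiset.map_map]
    exact Multiset.mem_map.2 ⟨r, hr, by simp⟩
  rw [Multiset.prod_X_add_C_eq_sum_esymm, eval_finsetSum, Finset.sum_range_succ] at h1
  have h2 : 0 ≤ ∑ j ∈ Finset.range (Multiset.card t),
      eval (-r) (C (t.esymm j) * X ^ (Multiset.card t - j)) := by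
    refine Finset.sum_nonneg fun j hj => ?_
    have := h j (Finset.mem_range.1 hj).le
    have hr' : 0 ≤ -r := by linarith
    simp only [eval_mul, eval_C, eval_pow, eval_X]
    positivity
  have h3 := lt_of_le_of_ne (h _ le_rfl) h0.symm
  simp at h1
  simp at h2
  linarith

/-- Nonnegativity of the first symmetric functions improves to positivity as soon as the last of
them does not vanish: the truncated family has positive members. -/
theorem esymm_pos_of_nonneg (s : Multiset ℝ) {k : ℕ} (hk : k ≤ Multiset.card s)
    (h : ∀ j ≤ k, 0 ≤ s.esymm j) (h0 : s.esymm k ≠ 0) : ∀ j ≤ k, 0 < s.esymm j := by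
  obtain ⟨t, ht, hts⟩ := exists_multiset_truncation s hk
  have key : ∀ j ≤ k, t.esymm j =
      s.esymm j / ((Multiset.card s).choose j : ℝ) * (k.choose j : ℝ) := by
    intro j hj
    have c1 : (0 : ℝ) < k.choose j := by exact_mod_cast Nat.choose_pos hj
    rw [← hts j hj, div_mul_cancel₀ _ c1.ne']
  have hpos := pos_of_esymm_nonneg t
    (fun j hj => by
      rw [ht] at hj
      rw [key j hj]
      have := h j hj
      positivity)
    (by
      rw [ht, key k le_rfl]
      have c2 : (0 : ℝ) < (Multiset.card s).choose k := by exact_mod_cast Nat.choose_pos hk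
      simp [h0, c2.ne'])
  intro j hj
  have := esymm_pos_of_pos t hpos (j := j) (by omega)
  rw [key j hj] at this
  exact lt_of_le_of_ne (h j hj) (fun h' => by rw [← h'] at this; simp at this)

open Polynomial in
/-- Passing to reciprocals reverses the order of the elementary symmetric functions. -/
theorem esymm_map_inv (t : Multiset ℝ) (ht : ∀ r ∈ t, r ≠ 0) {j : ℕ}
    (hj : j ≤ Multiset.card t) :
    t.prod * (t.map fun r => r⁻¹).esymm j = t.esymm (Multiset.card t - j) := by
  have hmonic : ∀ t : Multiset ℝ, (t.map fun r => X + C r).prod.natDegree = Multiset.card t := by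
    intro t
    rw [natDegree_multiset_prod_of_monic _ (by simp +contextual [monic_X_add_C])]
    simp
  have key : (t.map fun r => X + C r).prod.reverse
      = C t.prod * ((t.map fun r => r⁻¹).map fun r => X + C r).prod := by
    clear hj
    induction t using Multiset.induction with
    | empty =>
      simp only [Multiset.map_zero, Multiset.prod_zero, map_one, mul_one]
      exact reverse_C 1
    | cons a t ih =>
      have ha : a ≠ 0 := ht a (Multiset.mem_cons_self _ _)
      simp only [Multiset.map_cons, Multiset.prod_cons, reverse_mul_of_domain,
        ih fun r hr => ht r (Multiset.mem_cons_of_mem hr)]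
      have h1 : (X + C a : ℝ[X]).reverse = C a * (X + C a⁻¹) := by
        rw [reverse_add_C, natDegree_X, pow_one,
          show (X : ℝ[X]).reverse = 1 by rw [← one_mul X, reverse_mul_X]; exact reverse_C 1]
        have h2 : (C a : ℝ[X]) * C a⁻¹ = 1 := by rw [← C_mul, mul_inv_cancel₀ ha, C_1]
        rw [mul_add, h2]
        ring
      rw [h1, C_mul]
      ring
  have h2 := congrArg (fun q => q.coeff (Multiset.card t - j)) key
  simp only [coeff_C_mul, coeff_reverse, hmonic] at h2
  rw [revAt_le (by omega), Multiset.prod_X_add_C_coeff _ (by omega),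
    Multiset.prod_X_add_C_coeff _ (by simp), Multiset.card_map,
    Nat.sub_sub_self hj] at h2
  exact h2.symm

theorem esymm_one_eq_sum (t : Multiset ℝ) : t.esymm 1 = t.sum := by
  simp [Multiset.esymm, Multiset.powersetCard_one]

theorem sum_sq_add_two_esymm_two (t : Multiset ℝ) :
    (t.map fun r => r ^ 2).sum + 2 * t.esymm 2 = t.sum ^ 2 := by
  induction t using Multiset.induction with
  | empty => simp [Multiset.esymm, Multiset.powersetCard_zero_right]
  | cons a t ih =>
    have h : (a ::ₘ t).esymm 2 = t.esymm 2 + a * t.sum := by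
      simp [Multiset.esymm, Multiset.powersetCard_cons, Multiset.powersetCard_one]
      simpa using Multiset.sum_map_mul_left (s := t) (f := fun r : ℝ => r) (a := a)
    rw [Multiset.map_cons, Multiset.sum_cons, Multiset.sum_cons, h]
    linear_combination ih

theorem sum_sub_mean_sq (t : Multiset ℝ) (c : ℝ) :
    (t.map fun r => (r - c) ^ 2).sum =
      (t.map fun r => r ^ 2).sum - 2 * c * t.sum + Multiset.card t * c ^ 2 := by
  induction t using Multiset.induction with
  | empty => simp
  | cons a t ih =>
    simp only [Multiset.map_cons, Multiset.sum_cons, ih, Multiset.card_cons]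
    push_cast
    ring

/-- The first of Newton's inequalities is the nonnegativity of the variance. -/
theorem variance_identity (t : Multiset ℝ) (ht : 2 ≤ Multiset.card t) :
    ((t.esymm 1 / (Multiset.card t).choose 1) ^ 2 -
      t.esymm 2 / (Multiset.card t).choose 2) * ((Multiset.card t) * (Multiset.card t - 1)) =
      (t.map fun r => (r - t.sum / Multiset.card t) ^ 2).sum := by
  have h2 := sum_sq_add_two_esymm_two t
  rw [sum_sub_mean_sq, Nat.cast_choose_two, esymm_one_eq_sum, Nat.choose_one_right]
  set m : ℝ := (Multiset.card t : ℝ) with hm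
  have hm2 : (2 : ℝ) ≤ m := by rw [hm]; exact_mod_cast ht
  have h3 : m ≠ 0 := by linarith
  have h4 : m - 1 ≠ 0 := by linarith
  field_simp
  linear_combination (-m) * h2

theorem variance_nonneg (t : Multiset ℝ) (ht : 2 ≤ Multiset.card t) :
    t.esymm 2 / (Multiset.card t).choose 2 ≤ (t.esymm 1 / (Multiset.card t).choose 1) ^ 2 := by
  have h := variance_identity t ht
  have h1 : 0 ≤ (t.map fun r => (r - t.sum / Multiset.card t) ^ 2).sum :=
    Multiset.sum_nonneg fun x hx => by
      obtain ⟨v, -, rfl⟩ := Multiset.mem_map.1 hx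
      positivity
  have hm2 : (2 : ℝ) ≤ (Multiset.card t : ℝ) := by exact_mod_cast ht
  rw [← h] at h1
  have := nonneg_of_mul_nonneg_left h1 (by nlinarith)
  linarith

theorem variance_eq_zero_iff (t : Multiset ℝ) (ht : 2 ≤ Multiset.card t) :
    t.esymm 2 / (Multiset.card t).choose 2 = (t.esymm 1 / (Multiset.card t).choose 1) ^ 2 ↔
      ∃ c, ∀ r ∈ t, r = c := by
  have h := variance_identity t ht
  have hm2 : (2 : ℝ) ≤ (Multiset.card t : ℝ) := by exact_mod_cast ht
  constructor
  · intro h0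
    rw [h0, sub_self, zero_mul] at h
    refine ⟨t.sum / Multiset.card t, fun r hr => ?_⟩
    obtain ⟨w, hw⟩ := Multiset.exists_cons_of_mem hr
    have h2 : 0 ≤ (w.map fun r => (r - t.sum / Multiset.card t) ^ 2).sum :=
      Multiset.sum_nonneg fun x hx => by
        obtain ⟨v, -, rfl⟩ := Multiset.mem_map.1 hx
        positivity
    have h3 : (t.map fun r => (r - t.sum / Multiset.card t) ^ 2).sum =
        (r - t.sum / Multiset.card t) ^ 2 +
          (w.map fun r => (r - t.sum / Multiset.card t) ^ 2).sum := by
      conv_lhs => enter [1, 2]; rw [hw]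
      rw [Multiset.map_cons, Multiset.sum_cons]
    have h1 : (r - t.sum / Multiset.card t) ^ 2 = 0 :=
      le_antisymm (by linarith) (sq_nonneg _)
    have := pow_eq_zero_iff (two_ne_zero) |>.1 h1
    linarith
  · rintro ⟨c, hc⟩
    have ht' : t = Multiset.replicate (Multiset.card t) c := Multiset.eq_replicate_card.2 hc
    have hsum : t.sum / Multiset.card t = c := by
      have : (Multiset.card t : ℝ) ≠ 0 := by linarith
      rw [ht']; simp only [Multiset.sum_replicate, Multiset.card_replicate, nsmul_eq_mul]
      field_simp
    have h0 : (t.map fun r => (r - t.sum / Multiset.card t) ^ 2).sum = 0 := by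
      refine Multiset.sum_eq_zero fun x hx => ?_
      obtain ⟨v, hv, rfl⟩ := Multiset.mem_map.1 hx
      rw [hsum, hc v hv]; simp
    rw [h0] at h
    have := (mul_eq_zero.1 h).resolve_right (by nlinarith)
    linarith

/-- **Newton's inequality** at the index `j`, for a family all of whose symmetric functions up to
order `j + 1` are positive. After truncation to `j + 1` numbers it is the nonnegativity of the
variance of their reciprocals. -/
theorem newton_inequality (s : Multiset ℝ) {j : ℕ} (hj : 1 ≤ j) (hjs : j + 1 ≤ Multiset.card s)
    (h : ∀ i ≤ j + 1, 0 < s.esymm i) :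
    s.esymm (j - 1) / (Multiset.card s).choose (j - 1) *
        (s.esymm (j + 1) / (Multiset.card s).choose (j + 1)) ≤
      (s.esymm j / (Multiset.card s).choose j) ^ 2 ∧
    (s.esymm (j - 1) / (Multiset.card s).choose (j - 1) *
        (s.esymm (j + 1) / (Multiset.card s).choose (j + 1)) =
      (s.esymm j / (Multiset.card s).choose j) ^ 2 → ∃ c, ∀ r ∈ s, r = c) := by
  obtain ⟨t, ht, hts⟩ := exists_multiset_truncation s hjs
  have key : ∀ i ≤ j + 1, 0 < t.esymm i := by
    intro i hi
    have c1 : (0 : ℝ) < (j + 1).choose i := by exact_mod_cast Nat.choose_pos hi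
    have c2 : (0 : ℝ) < (Multiset.card s).choose i := by
      exact_mod_cast Nat.choose_pos (by omega)
    have h1 := hts i hi
    have h2 := div_pos (h i hi) c2
    rw [← h1] at h2
    exact (div_pos_iff_of_pos_right c1).1 h2
  have hpos := pos_of_esymm_nonneg t (fun i hi => (key i (by omega)).le)
    (by rw [ht]; exact (key _ le_rfl).ne')
  have hne : ∀ r ∈ t, r ≠ 0 := fun r hr => (hpos r hr).ne'
  have hprod : t.prod = t.esymm (j + 1) := by
    have := esymm_map_inv t hne (j := 0) (by omega)
    simpa [ht, Multiset.esymm] using this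
  set u := t.map fun r => r⁻¹ with hu
  have hucard : Multiset.card u = j + 1 := by simp [hu, ht]
  have u1 := esymm_map_inv t hne (j := 1) (by omega)
  have u2 := esymm_map_inv t hne (j := 2) (by omega)
  rw [← hu, hprod, ht] at u1 u2
  rw [show j + 1 - 1 = j by omega] at u1
  rw [show j + 1 - 2 = j - 1 by omega] at u2
  rw [← hts _ (by omega : j - 1 ≤ j + 1), ← hts _ le_rfl, ← hts j (by omega)]
  have e1 := key (j + 1) le_rfl
  have hv := variance_nonneg u (by omega)
  have hv0 := variance_eq_zero_iff u (by omega)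
  rw [hucard] at hv hv0
  have v1 : u.esymm 1 = t.esymm j / t.esymm (j + 1) := by rw [← u1]; field_simp
  have v2 : u.esymm 2 = t.esymm (j - 1) / t.esymm (j + 1) := by rw [← u2]; field_simp
  have b1 : (j + 1).choose j = (j + 1).choose 1 := by
    simp
  have b2 : (j + 1).choose (j - 1) = (j + 1).choose 2 := by
    rw [show j - 1 = j + 1 - 2 by omega]; exact Nat.choose_symm (by omega)
  rw [v1, v2] at hv hv0
  rw [b1, b2, Nat.choose_self, Nat.cast_one, div_one]
  have c1 : (0 : ℝ) < (j + 1).choose 1 := by exact_mod_cast Nat.choose_pos (by omega)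
  have c2 : (0 : ℝ) < (j + 1).choose 2 := by exact_mod_cast Nat.choose_pos (by omega)
  have r1 : t.esymm (j - 1) / t.esymm (j + 1) / ((j + 1).choose 2 : ℝ) * t.esymm (j + 1) ^ 2 =
      t.esymm (j - 1) / ((j + 1).choose 2 : ℝ) * t.esymm (j + 1) := by field_simp
  have r2 : (t.esymm j / t.esymm (j + 1) / ((j + 1).choose 1 : ℝ)) ^ 2 * t.esymm (j + 1) ^ 2 =
      (t.esymm j / ((j + 1).choose 1 : ℝ)) ^ 2 := by field_simp
  rw [← r1, ← r2]
  refine ⟨by gcongr, fun heq => ?_⟩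
  have := mul_right_cancel₀ (by positivity) heq
  obtain ⟨c, hc⟩ := hv0.1 this
  -- All entries of `t` agree, so its first Newton inequality, hence that of `s`, is an equality
  have ht' : ∃ c, ∀ r ∈ t, r = c := by
    refine ⟨c⁻¹, fun r hr => ?_⟩
    rw [← hc r⁻¹ (Multiset.mem_map_of_mem _ hr), inv_inv]
  have hvt := (variance_eq_zero_iff t (by omega)).2 ht'
  rw [ht, hts 2 (by omega), hts 1 (by omega)] at hvt
  exact (variance_eq_zero_iff s (by omega)).1 hvt

/-- The Newton-Maclaurin inequality `H_k H_{l-1} ≤ H_{k-1} H_l`, with its equality case: Newton's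
inequalities say that the quotients `H_j / H_{j-1}` decrease. -/
theorem newton_maclaurin (s : Multiset ℝ) (H : ℕ → ℝ)
    (hH : ∀ j, H j = s.esymm j / (Multiset.card s).choose j) {k l : ℕ} (hl : 1 ≤ l) (hlk : l < k)
    (hk : k ≤ Multiset.card s) (h : ∀ i ≤ k, 0 < s.esymm i) :
    H k * H (l - 1) ≤ H (k - 1) * H l ∧
      (H k * H (l - 1) = H (k - 1) * H l → ∃ c, ∀ r ∈ s, r = c) := by
  have hpos : ∀ i ≤ k, 0 < H i := by
    intro i hi
    have c2 : (0 : ℝ) < (Multiset.card s).choose i := by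
      exact_mod_cast Nat.choose_pos (by omega)
    rw [hH]; exact div_pos (h i hi) c2
  induction k, hlk using Nat.le_induction with
  | base =>
    have := newton_inequality s hl (by omega) h
    simp only [← hH] at this
    simp only [Nat.succ_eq_add_one, Nat.add_sub_cancel]
    exact ⟨by nlinarith [this.1], fun he => this.2 (by linarith)⟩
  | succ k hlk ih =>
    have hlk' : l < k := hlk
    obtain ⟨ih1, ih2⟩ := ih (by omega) (fun i hi => h i (by omega)) (fun i hi => hpos i (by omega))
    have hN := (newton_inequality s (j := k) (by omega) hk h).1
    simp only [← hH] at hN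
    rw [Nat.add_sub_cancel]
    have p1 := hpos (k - 1) (by omega)
    have p2 := hpos k (by omega)
    have p3 := hpos (l - 1) (by omega)
    have p4 := hpos l (by omega)
    have p5 := hpos (k + 1) le_rfl
    have e1 : H (k + 1) * H (l - 1) * (H (k - 1) * H k) ≤ H k ^ 2 * (H k * H (l - 1)) := by
      calc _ = (H (k - 1) * H (k + 1)) * (H k * H (l - 1)) := by ring
        _ ≤ _ := by gcongr
    have e2 : H k ^ 2 * (H k * H (l - 1)) ≤ H k ^ 2 * (H (k - 1) * H l) := by gcongr
    constructor
    · refine le_of_mul_le_mul_right ?_ (mul_pos p1 p2)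
      linarith
    · intro heq
      refine ih2 ?_
      have : H k ^ 2 * (H (k - 1) * H l) ≤ H k ^ 2 * (H k * H (l - 1)) := by
        rw [heq] at e1; linarith
      exact le_antisymm ih1 (le_of_mul_le_mul_left this (by positivity))

/-! ### Eigenvalues of a symmetric form relative to a positive definite one -/

open scoped MatrixOrder Matrix.Norms.L2Operator in
/-- A symmetric form relative to a positive definite one is conjugate to a symmetric matrix. -/
theorem exists_conj_symmetric {n : ℕ} {g h : Matrix (Fin n) (Fin n) ℝ} (hg : g.PosDef)
    (hh : h.IsHermitian) :
    ∃ B C : Matrix (Fin n) (Fin n) ℝ, C.IsHermitian ∧ IsUnit B.det ∧ g⁻¹ * h = B⁻¹ * C * B := by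
  obtain ⟨B, hB⟩ : ∃ B, g = B.conjTranspose * B :=
    CStarAlgebra.nonneg_iff_eq_star_mul_self.mp hg.posSemidef.nonneg
  have hgd : g.det ≠ 0 := hg.det_pos.ne'
  have hBd : IsUnit B.det := by
    rw [isUnit_iff_ne_zero]
    intro h0
    rw [hB, Matrix.det_mul, h0, mul_zero] at hgd
    exact hgd rfl
  refine ⟨B, B⁻¹.conjTranspose * h * B⁻¹, ?_, hBd, ?_⟩
  · exact Matrix.isHermitian_conjTranspose_mul_mul _ hh
  · rw [hB, Matrix.mul_inv_rev, Matrix.conjTranspose_nonsing_inv]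
    simp only [Matrix.mul_assoc]
    rw [Matrix.nonsing_inv_mul _ hBd, Matrix.mul_one]

theorem charpoly_conj {n : ℕ} {B : Matrix (Fin n) (Fin n) ℝ} (C : Matrix (Fin n) (Fin n) ℝ)
    (hB : IsUnit B.det) : (B⁻¹ * C * B).charpoly = C.charpoly := by
  rw [Matrix.mul_assoc, Matrix.charpoly_mul_comm, Matrix.mul_assoc, Matrix.mul_nonsing_inv _ hB,
    Matrix.mul_one]

theorem card_roots_relative {n : ℕ} {g h : Matrix (Fin n) (Fin n) ℝ} (hg : g.PosDef)
    (hh : h.IsHermitian) : Multiset.card (g⁻¹ * h).charpoly.roots = n := by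
  obtain ⟨B, C, hC, hB, hW⟩ := exists_conj_symmetric hg hh
  rw [hW, charpoly_conj C hB, Polynomial.splits_iff_card_roots.1 hC.splits_charpoly,
    Matrix.charpoly_natDegree_eq_dim, Fintype.card_fin]

/-- If all relative eigenvalues agree, the two forms are proportional. -/
theorem eq_smul_of_roots_eq {n : ℕ} {g h : Matrix (Fin n) (Fin n) ℝ} (hg : g.PosDef)
    (hh : h.IsHermitian) {c : ℝ} (hc : ∀ r ∈ (g⁻¹ * h).charpoly.roots, r = c) : h = c • g := by
  obtain ⟨B, C, hC, hB, hW⟩ := exists_conj_symmetric hg hh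
  have hgd : IsUnit g.det := isUnit_iff_ne_zero.2 hg.det_pos.ne'
  rw [hW, charpoly_conj C hB, hC.roots_charpoly_eq_eigenvalues] at hc
  have h1 : hC.eigenvalues = fun _ => c := by
    funext i
    have := hc (hC.eigenvalues i) (Multiset.mem_map.2 ⟨i, Finset.mem_univ i, rfl⟩)
    simpa using this
  have h2 : C = c • (1 : Matrix (Fin n) (Fin n) ℝ) := by
    have h3 := hC.spectral_theorem
    have h4 : Matrix.diagonal (RCLike.ofReal ∘ hC.eigenvalues) =
        c • (1 : Matrix (Fin n) (Fin n) ℝ) := by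
      rw [h1, ← Matrix.diagonal_one, ← Matrix.diagonal_smul]
      congr 1
      ext
      simp
    rw [h4, map_smul, map_one] at h3
    exact h3
  have h5 : g⁻¹ * h = c • 1 := by
    rw [hW, h2, Matrix.mul_smul, Matrix.mul_one, Matrix.smul_mul, Matrix.nonsing_inv_mul _ hB]
  calc h = g * (g⁻¹ * h) := by rw [← Matrix.mul_assoc, Matrix.mul_nonsing_inv _ hgd, Matrix.one_mul]
    _ = c • g := by rw [h5, Matrix.mul_smul, Matrix.mul_one]

open Matrix in
/-- The eigenvalues relative to `g` have the sign of the form `h`. -/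
theorem roots_sign {n : ℕ} {g h : Matrix (Fin n) (Fin n) ℝ} (hg : g.PosDef) {κ : ℝ}
    (hκ : ∀ v : Fin n → ℝ, v ≠ 0 → 0 < κ * (v ⬝ᵥ h *ᵥ v)) :
    ∀ r ∈ (g⁻¹ * h).charpoly.roots, 0 < κ * r := by
  intro r hr
  have hgd : IsUnit g.det := isUnit_iff_ne_zero.2 hg.det_pos.ne'
  have h1 : (g⁻¹ * h).charpoly.eval r = 0 := (Polynomial.mem_roots'.1 hr).2
  rw [Matrix.eval_charpoly] at h1
  obtain ⟨v, hv0, hv⟩ := Matrix.exists_mulVec_eq_zero_iff.2 h1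
  have h2 : (g⁻¹ * h) *ᵥ v = r • v := by
    rw [Matrix.sub_mulVec, sub_eq_zero] at hv
    rw [← hv]
    simp [Matrix.scalar_apply, ← Matrix.smul_one_eq_diagonal, Matrix.smul_mulVec]
  have h3 : h *ᵥ v = r • (g *ᵥ v) := by
    rw [← Matrix.mulVec_smul, ← h2, Matrix.mulVec_mulVec, ← Matrix.mul_assoc,
      Matrix.mul_nonsing_inv _ hgd, Matrix.one_mul]
  have h4 := hκ v hv0
  have h5 : 0 < v ⬝ᵥ (g *ᵥ v) := by simpa using hg.dotProduct_mulVec_pos hv0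
  rw [h3, dotProduct_smul, smul_eq_mul, ← mul_assoc] at h4
  exact (pos_iff_pos_of_mul_pos h4).2 h5

open Polynomial in
/-- The elementary symmetric functions of the eigenvalues are the coefficients of the homogenized
characteristic polynomial. -/
theorem det_add_smul_eq_sum {n : ℕ} (W : Matrix (Fin n) (Fin n) ℝ)
    (hW : Multiset.card W.charpoly.roots = n) (s t : ℝ) :
    (s • (1 : Matrix (Fin n) (Fin n) ℝ) + t • W).det =
      ∑ j ∈ Finset.range (n + 1), W.charpoly.roots.esymm j * t ^ j * s ^ (n - j) := by
  rcases eq_or_ne t 0 with rfl | ht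
  · rw [Finset.sum_eq_single 0]
    · simp [Multiset.esymm]
    · intro j _ hj; simp [hj]
    · simp
  have hsp : W.charpoly = (W.charpoly.roots.map fun a => X - C a).prod := by
    have := C_leadingCoeff_mul_prod_multiset_X_sub_C (p := W.charpoly)
      (by rw [hW, Matrix.charpoly_natDegree_eq_dim, Fintype.card_fin])
    rw [(Matrix.charpoly_monic W).leadingCoeff, C_1, one_mul] at this
    exact this.symm
  have h1 : s • (1 : Matrix (Fin n) (Fin n) ℝ) + t • W =
      (-t) • (Matrix.scalar (Fin n) (-s / t) - W) := by
    have : Matrix.scalar (Fin n) (-s / t) = (-s / t) • (1 : Matrix (Fin n) (Fin n) ℝ) := by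
      rw [Matrix.smul_one_eq_diagonal]; rfl
    rw [this, smul_sub, smul_smul, show -t * (-s / t) = s by field_simp, neg_smul, sub_neg_eq_add]
  rw [h1, Matrix.det_smul, ← Matrix.eval_charpoly, Fintype.card_fin]
  conv_lhs => rw [hsp, Multiset.prod_X_sub_X_eq_sum_esymm]
  rw [hW, eval_finsetSum, Finset.mul_sum]
  refine Finset.sum_congr rfl fun j hj => ?_
  have hj' : j ≤ n := by simpa [Nat.lt_succ_iff] using hj
  simp only [eval_mul, eval_pow, eval_neg, eval_one, eval_C, eval_X]
  have h2 : (-t) ^ n = (-t) ^ j * (-t) ^ (n - j) := by rw [← pow_add]; congr 1; omega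
  have h3 : (-t) ^ (n - j) * (-s / t) ^ (n - j) = s ^ (n - j) := by
    rw [← mul_pow]; congr 1; field_simp
  have h4 : (-t) ^ j * (-1) ^ j = t ^ j := by rw [← mul_pow]; congr 1; ring
  rw [h2, ← h3, ← h4]
  ring

/-! ### Determinants of vectors in `ℝⁿ⁺¹` -/

/-- The model space of the hypersurface. -/
abbrev Mod (n : ℕ) : Type := EuclideanSpace ℝ (Fin n)

/-- The standard basis vectors of `ℝⁿ`. -/
def stdVec {n : ℕ} (i : Fin n) : Mod n := EuclideanSpace.single i (1 : ℝ)

/-- The determinant of `n + 1` vectors of `ℝⁿ⁺¹`, as an alternating map. -/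
def volAlt (n : ℕ) : Amb n [⋀^Fin (n + 1)]→ₗ[ℝ] ℝ :=
  (Matrix.detRowAlternating (n := Fin (n + 1)) (R := ℝ)).compLinearMap
    (WithLp.linearEquiv 2 ℝ (Fin (n + 1) → ℝ)).toLinearMap

theorem volAlt_apply {n : ℕ} (v : Fin (n + 1) → Amb n) :
    volAlt n v = (Matrix.of fun i j => v i j).det := rfl

/-- The determinant of `n + 1` vectors of `ℝⁿ⁺¹`, as a continuous multilinear map. -/
def volMul (n : ℕ) : ContinuousMultilinearMap ℝ (fun _ : Fin (n + 1) => Amb n) ℝ :=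
  { (volAlt n).toMultilinearMap with
    cont := by
      change Continuous fun v : Fin (n + 1) → Amb n => (Matrix.of fun i j => v i j).det
      refine Continuous.matrix_det ?_
      refine continuous_matrix fun i j => ?_
      simp only [Matrix.of_apply]
      fun_prop }

theorem volMul_apply {n : ℕ} (v : Fin (n + 1) → Amb n) : volMul n v = volAlt n v := rfl

theorem continuous_volAlt (n : ℕ) : Continuous (volAlt n) := (volMul n).cont

/-- The determinant with its first vector separated from the others. -/
def wedge {n : ℕ} (w : Amb n) (v : Fin n → Amb n) : ℝ := volAlt n (Fin.cons w v)

/-- `wedge w`, pulled back along a linear map, as an alternating map. -/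
def wedgeComp {n : ℕ} (w : Amb n) (L : Mod n →ₗ[ℝ] Amb n) : Mod n [⋀^Fin n]→ₗ[ℝ] ℝ :=
  ((volAlt n).curryLeft w).compLinearMap L

theorem wedgeComp_apply {n : ℕ} (w : Amb n) (L : Mod n →ₗ[ℝ] Amb n) (v : Fin n → Mod n) :
    wedgeComp w L v = wedge w fun i => L (v i) := rfl

/-- The change of variables formula for determinants of coordinate vectors. -/
theorem wedge_comp_det {n : ℕ} (w : Amb n) (L : Mod n →ₗ[ℝ] Amb n) (B : Mod n →ₗ[ℝ] Mod n) :
    wedge w (fun i => L (B (stdVec i))) = LinearMap.det B * wedge w fun i => L (stdVec i) := by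
  set b := (EuclideanSpace.basisFun (Fin n) ℝ).toBasis with hb
  have h0 : ∀ i, b i = stdVec i := fun i => by simp [hb, stdVec]
  have h1 := congrArg (fun f => f fun i => B (stdVec i)) ((wedgeComp w L).eq_smul_basis_det b)
  simp only [AlternatingMap.smul_apply, wedgeComp_apply, smul_eq_mul] at h1
  rw [h1, mul_comm]
  congr 1
  · rw [← LinearMap.det_toMatrix b, Module.Basis.det_apply]
    congr 1
  · simp [h0]

theorem volAlt_eq_zero_of_orthogonal {n : ℕ} {η : Amb n} (hη : η ≠ 0) {v : Fin (n + 1) → Amb n}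
    (h : ∀ i, ⟪η, v i⟫ = 0) : volAlt n v = 0 := by
  rw [volAlt_apply, ← Matrix.exists_mulVec_eq_zero_iff]
  refine ⟨η.ofLp, fun h0 => hη (by ext i; simpa using congrFun h0 i), ?_⟩
  funext i
  have := h i
  simpa [Matrix.mulVec, dotProduct, PiLp.inner_apply, mul_comm] using this

theorem wedge_eq_zero_of_orthogonal {n : ℕ} {η w : Amb n} (hη : η ≠ 0) {v : Fin n → Amb n}
    (hw : ⟪η, w⟫ = 0) (h : ∀ i, ⟪η, v i⟫ = 0) : wedge w v = 0 :=
  volAlt_eq_zero_of_orthogonal hη fun i => by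
    refine Fin.cases ?_ (fun j => ?_) i
    · simpa using hw
    · simpa using h j

theorem wedge_add {n : ℕ} (w w' : Amb n) (v : Fin n → Amb n) :
    wedge (w + w') v = wedge w v + wedge w' v := (volAlt n).map_vecCons_add _ _ _

theorem wedge_smul {n : ℕ} (c : ℝ) (w : Amb n) (v : Fin n → Amb n) :
    wedge (c • w) v = c * wedge w v := (volAlt n).map_vecCons_smul _ _ _

/-- The determinant of `w` and `n` vectors orthogonal to `η` depends on `w` only through its
component along `η`. -/
theorem wedge_eq_ratio {n : ℕ} {η G w : Amb n} (hG : ⟪η, G⟫ ≠ 0) {v : Fin n → Amb n}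
    (h : ∀ i, ⟪η, v i⟫ = 0) : wedge w v = ⟪η, w⟫ / ⟪η, G⟫ * wedge G v := by
  have hη : η ≠ 0 := by rintro rfl; simp at hG
  have h1 : w = (⟪η, w⟫ / ⟪η, G⟫) • G + (w - (⟪η, w⟫ / ⟪η, G⟫) • G) := by abel
  conv_lhs => rw [h1]
  have h2 : ⟪η, w - (⟪η, w⟫ / ⟪η, G⟫) • G⟫ = 0 := by
    rw [inner_sub_right, inner_smul_right]
    field_simp
    ring
  rw [wedge_add, wedge_smul, wedge_eq_zero_of_orthogonal hη h2 h, add_zero]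

theorem wedge_ne_zero {n : ℕ} {η G : Amb n} (hG : ⟪η, G⟫ ≠ 0) {L : Mod n →ₗ[ℝ] Amb n}
    (hL : Function.Injective L) (h : ∀ v, ⟪η, L v⟫ = 0) :
    wedge G (fun i => L (stdVec i)) ≠ 0 := by
  intro h0
  rw [wedge, volAlt_apply] at h0
  obtain ⟨c, hc0, hc⟩ := Matrix.exists_vecMul_eq_zero_iff.2 h0
  have h1 : c 0 • G + L (∑ i, c i.succ • stdVec i) = 0 := by
    ext j
    have := congrFun hc j
    simp only [Matrix.vecMul, dotProduct, Fin.sum_univ_succ, Matrix.of_apply, Fin.cons_zero,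
      Fin.cons_succ] at this
    simpa [map_sum] using this
  have h2 : c 0 = 0 := by
    have := congrArg (fun z => ⟪η, z⟫) h1
    simp only [inner_add_right, inner_smul_right, h, inner_zero_right, add_zero] at this
    exact (mul_eq_zero.1 this).resolve_right hG
  rw [h2, zero_smul, zero_add] at h1
  have h3 : (∑ i, c i.succ • stdVec i : Mod n) = 0 := hL (by rw [h1, map_zero])
  apply hc0
  funext i
  refine Fin.cases h2 (fun j => ?_) i
  have := congrArg (fun z : Mod n => z j) h3
  simpa [stdVec, Finset.sum_apply, Pi.single_apply] using this

/-- Exchanging the first vector with another one. -/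
theorem wedge_update_swap {n : ℕ} (a b : Amb n) (v : Fin n → Amb n) (i : Fin n) :
    wedge a (Function.update v i b) = -wedge b (Function.update v i a) := by
  have h := (volAlt n).map_swap (Fin.cons b (Function.update v i a)) (Fin.succ_ne_zero i).symm
  rw [wedge, wedge, ← h]
  congr 1
  funext m
  refine Fin.cases ?_ (fun j => ?_) m
  · simp only [Function.comp_apply, Equiv.swap_apply_left, Fin.cons_succ, Fin.cons_zero,
      Function.update_self]
  · by_cases hj : j = i
    · subst hj
      rw [Function.comp_apply, Equiv.swap_apply_right, Fin.cons_succ, Fin.cons_zero,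
        Function.update_self]
    · have : Fin.succ j ≠ Fin.succ i := fun h => hj (Fin.succ_injective _ h)
      simp [hj, Equiv.swap_apply_of_ne_of_ne (Fin.succ_ne_zero j) this]

theorem wedge_update_update {n : ℕ} (f a b : Amb n) (v : Fin n → Amb n) {i j : Fin n}
    (hij : i ≠ j) :
    wedge f (Function.update (Function.update v i a) j b) =
      -wedge f (Function.update (Function.update v j a) i b) := by
  have h := ((volAlt n).curryLeft f).map_swap
    (Function.update (Function.update v j a) i b) hij
  change _ = - wedge f _ at h
  rw [← h]
  change wedge f _ = wedge f _
  congr 1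
  funext m
  by_cases h1 : m = i
  · subst h1
    rw [Function.comp_apply, Equiv.swap_apply_left, Function.update_of_ne (Ne.symm hij),
      Function.update_self, Function.update_of_ne hij, Function.update_self]
  · by_cases h2 : m = j
    · subst h2; simp
    · simp [h1, h2, Equiv.swap_apply_of_ne_of_ne h1 h2]

theorem wedge_cons_update_succ {n : ℕ} (f : Amb n) (v : Fin n → Amb n) (j : Fin n) (b : Amb n) :
    volAlt n (Function.update (Fin.cons f v) j.succ b) = wedge f (Function.update v j b) := by
  rw [wedge, Fin.cons_update]

theorem wedge_cons_update_zero {n : ℕ} (f : Amb n) (v : Fin n → Amb n) (b : Amb n) :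
    volAlt n (Function.update (Fin.cons f v) 0 b) = wedge b v := by
  rw [wedge, Fin.update_cons_zero]

/-- Derivative of the determinant of a pencil of linear maps. -/
theorem hasDerivAt_wedge_pencil {n : ℕ} (w : Amb n) (P Q : Fin n → Amb n) :
    HasDerivAt (fun s : ℝ => wedge w fun i => P i + s • Q i)
      (∑ i, wedge w (Function.update P i (Q i))) 0 := by
  have hg : ∀ m : Fin (n + 1), HasFDerivAt
      (fun s : ℝ => (Fin.cons w (fun i => P i + s • Q i) : Fin (n + 1) → Amb n) m)
      (ContinuousLinearMap.toSpanSingleton ℝ ((Fin.cons 0 Q : Fin (n + 1) → Amb n) m)) 0 := by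
    intro m
    refine Fin.cases ?_ (fun j => ?_) m
    · have : ContinuousLinearMap.toSpanSingleton ℝ (0 : Amb n) = 0 := by ext; simp
      simpa [this] using hasFDerivAt_const w (0 : ℝ)
    · simpa using (((hasDerivAt_id (0 : ℝ)).smul_const (Q j)).const_add (P j)).hasFDerivAt
  have h := (HasFDerivAt.multilinear_comp (f := volMul n) hg).hasDerivAt
  refine h.congr_deriv ?_
  rw [_root_.sum_apply, Fin.sum_univ_succ]
  have e1 : ∀ m : Fin (n + 1), (((volMul n).toContinuousLinearMap (fun j => (Fin.cons w
      (fun i => P i + (0 : ℝ) • Q i) : Fin (n + 1) → Amb n) j) m).comp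
      (ContinuousLinearMap.toSpanSingleton ℝ ((Fin.cons 0 Q : Fin (n + 1) → Amb n) m))) 1 =
      volAlt n (Function.update (Fin.cons w P) m ((Fin.cons 0 Q : Fin (n + 1) → Amb n) m)) := by
    intro m
    simp [volMul_apply]
  rw [e1, Finset.sum_congr rfl fun j _ => e1 (Fin.succ j)]
  simp only [Fin.cons_zero, Fin.cons_succ, wedge_cons_update_succ, wedge_cons_update_zero]
  rw [add_eq_right]
  exact (volAlt n).map_coord_zero 0 (by simp)

/-! ### The divergence of a determinantal vector field -/

/-- The vector density with components `det (f, ∂₁Φ, …, w, …, ∂ₙΦ)`, the vector `w` standing in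
the place of `∂ᵢΦ`. It represents the `(n - 1)`-form `det (f, w, dΦ, …, dΦ)`. -/
def detField {n : ℕ} (f w : Mod n → Amb n) (DΦ : Mod n → Mod n →L[ℝ] Amb n) (i : Fin n)
    (y : Mod n) : ℝ :=
  wedge (f y) (Function.update (fun j => DΦ y (stdVec j)) i (w y))

/-- The derivative of the `i`-th component of `detField`. -/
theorem hasFDerivAt_detField {n : ℕ} {f w : Mod n → Amb n} {DΦ : Mod n → Mod n →L[ℝ] Amb n}
    {f' w' : Mod n →L[ℝ] Amb n} {D2 : Mod n →L[ℝ] Mod n →L[ℝ] Amb n} {y : Mod n}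
    (hf : HasFDerivAt f f' y) (hw : HasFDerivAt w w' y) (hΦ : HasFDerivAt DΦ D2 y) (i : Fin n) :
    ∃ Y' : Mod n →L[ℝ] ℝ, HasFDerivAt (detField f w DΦ i) Y' y ∧
      ∀ v, Y' v = wedge (f' v) (Function.update (fun j => DΦ y (stdVec j)) i (w y)) +
        ∑ j, wedge (f y) (Function.update (Function.update (fun j => DΦ y (stdVec j)) i (w y)) j
          (if j = i then w' v else D2 v (stdVec j))) := by
  have hg : ∀ m : Fin (n + 1), HasFDerivAt
      (fun z => (Fin.cons (f z) (Function.update (fun j => DΦ z (stdVec j)) i (w z)) :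
        Fin (n + 1) → Amb n) m)
      ((Fin.cons f' (fun j => if j = i then w' else
        (ContinuousLinearMap.apply ℝ (Amb n) (stdVec j)).comp D2) :
          Fin (n + 1) → (Mod n →L[ℝ] Amb n)) m) y := by
    intro m
    refine Fin.cases ?_ (fun j => ?_) m
    · simpa using hf
    · by_cases hj : j = i
      · subst hj; simpa using hw
      · simp only [Fin.cons_succ, Function.update_of_ne hj, hj, if_false]
        exact (ContinuousLinearMap.apply ℝ (Amb n) (stdVec j)).hasFDerivAt.comp y hΦ
  refine ⟨_, HasFDerivAt.multilinear_comp (f := volMul n) hg, fun v => ?_⟩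
  rw [_root_.sum_apply, Fin.sum_univ_succ]
  congr 1
  · exact wedge_cons_update_zero _ _ _
  · refine Finset.sum_congr rfl fun j _ => ?_
    rw [← wedge_cons_update_succ]
    simp only [Fin.cons_succ, ContinuousLinearMap.comp_apply,
      ContinuousMultilinearMap.toContinuousLinearMap_apply, volMul_apply]
    congr 2
    split_ifs <;> simp

/-- In the divergence of `detField` the second derivatives of `Φ` cancel. -/
theorem divergence_detField {n : ℕ} {f w : Amb n} {f' w' : Mod n → Amb n} {v : Fin n → Amb n}
    {D2 : Mod n →L[ℝ] Mod n →L[ℝ] Amb n} (hsymm : ∀ a b, D2 a b = D2 b a) :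
    (∑ i, (wedge (f' (stdVec i)) (Function.update v i w) +
      ∑ j, wedge f (Function.update (Function.update v i w) j
          (if j = i then w' (stdVec i) else D2 (stdVec i) (stdVec j))))) =
    -(∑ i, wedge w (Function.update v i (f' (stdVec i)))) +
      ∑ i, wedge f (Function.update v i (w' (stdVec i))) := by
  rw [Finset.sum_add_distrib, ← Finset.sum_neg_distrib]
  congr 1
  · exact Finset.sum_congr rfl fun i _ => wedge_update_swap _ _ _ _
  set A : Fin n → Fin n → ℝ := fun i j => if j = i then 0 else
    wedge f (Function.update (Function.update v i w) j (D2 (stdVec i) (stdVec j))) with hA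
  have h1 : ∀ i, (∑ j, wedge f (Function.update (Function.update v i w) j
          (if j = i then w' (stdVec i) else D2 (stdVec i) (stdVec j)))) =
      wedge f (Function.update v i (w' (stdVec i))) + ∑ j, A i j := by
    intro i
    rw [← Finset.add_sum_erase _ _ (Finset.mem_univ i),
      ← Finset.add_sum_erase _ (A i) (Finset.mem_univ i)]
    simp only [hA, if_true, zero_add, Function.update_idem]
    congr 1
    refine Finset.sum_congr rfl fun j hj => ?_
    rw [if_neg (Finset.ne_of_mem_erase hj), if_neg (Finset.ne_of_mem_erase hj)]
  have hanti : ∀ i j, A i j = -A j i := by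
    intro i j
    simp only [hA]
    by_cases hij : j = i
    · simp [hij]
    · rw [if_neg hij, if_neg (Ne.symm hij), hsymm, wedge_update_update _ _ _ _ (Ne.symm hij)]
  have h2 : ∑ i, ∑ j, A i j = 0 := by
    have : ∑ i, ∑ j, A i j = -∑ i, ∑ j, A i j := by
      conv_lhs => rw [Finset.sum_comm]
      rw [← Finset.sum_neg_distrib]
      refine Finset.sum_congr rfl fun i _ => ?_
      rw [← Finset.sum_neg_distrib]
      exact Finset.sum_congr rfl fun j _ => hanti j i
    linarith
  rw [Finset.sum_congr rfl fun i _ => h1 i, Finset.sum_add_distrib, h2, add_zero]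

/-! ### Charts of a manifold with boundary -/

section Charts

open Set Filter Topology

variable {n : ℕ} [NeZero n] {M : Type*} [TopologicalSpace M] [ChartedSpace (EuclideanHalfSpace n) M]
  {W : Type*} [NormedAddCommGroup W] [NormedSpace ℝ W]

/-- The image of the chart at `a`, a relatively open subset of the closed half space. -/
def chartTarget (n : ℕ) [NeZero n] {M : Type*} [TopologicalSpace M]
    [ChartedSpace (EuclideanHalfSpace n) M] (a : M) : Set (Mod n) := (extChartAt (𝓡∂ n) a).target

/-- A function on the hypersurface, read in the chart at `a`. -/
def loc (f : M → W) (a : M) : Mod n → W := fun y => f ((extChartAt (𝓡∂ n) a).symm y)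

/-- The derivative in the chart at `a`. -/
def locDeriv (f : M → W) (a : M) (y : Mod n) : Mod n →L[ℝ] W :=
  fderivWithin ℝ (loc f a) (chartTarget n a) y

/-- The coordinate change from the chart at `a` to the chart at `b`. -/
def transition (a b : M) : Mod n → Mod n := loc (extChartAt (𝓡∂ n) b) a

/-- The Jacobian of the coordinate change. -/
def transitionDeriv (a b : M) (y : Mod n) : Mod n →L[ℝ] Mod n :=
  locDeriv (extChartAt (𝓡∂ n) b) a y

theorem uniqueDiffOn_chartTarget (a : M) : UniqueDiffOn ℝ (chartTarget n a) :=
  uniqueDiffOn_extChartAt_target a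

theorem nonneg_of_mem_chartTarget {a : M} {y : Mod n} (hy : y ∈ chartTarget n a) : 0 ≤ y 0 := by
  have := extChartAt_target_subset_range (I := 𝓡∂ n) a hy
  rwa [range_modelWithCornersEuclideanHalfSpace] at this

theorem chartTarget_mem_nhds {a : M} {y : Mod n} (hy : y ∈ chartTarget n a) (h0 : 0 < y 0) :
    chartTarget n a ∈ 𝓝 y := by
  have h1 : range (𝓡∂ n) ∈ 𝓝 y := by
    rw [mem_nhds_iff]
    refine ⟨_, interior_subset, isOpen_interior, ?_⟩
    rw [interior_range_modelWithCornersEuclideanHalfSpace]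
    exact h0
  rw [← nhdsWithin_eq_nhds.2 h1]
  exact extChartAt_target_mem_nhdsWithin_of_mem hy

theorem mem_interior_chartTarget {a : M} {y : Mod n} :
    y ∈ interior (chartTarget n a) ↔ y ∈ chartTarget n a ∧ 0 < y 0 := by
  constructor
  · intro h
    refine ⟨interior_subset h, ?_⟩
    have := interior_mono (extChartAt_target_subset_range (I := 𝓡∂ n) a) h
    rwa [interior_range_modelWithCornersEuclideanHalfSpace] at this
  · rintro ⟨h1, h2⟩
    exact mem_interior_iff_mem_nhds.2 (chartTarget_mem_nhds h1 h2)

theorem chartTarget_eq_inter (a : M) :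
    ∃ U : Set (Mod n), IsOpen U ∧ chartTarget n a = U ∩ {y | 0 ≤ y 0} := by
  refine ⟨(𝓡∂ n).symm ⁻¹' (chartAt (EuclideanHalfSpace n) a).target,
    (chartAt _ a).open_target.preimage (𝓡∂ n).continuous_symm, ?_⟩
  rw [chartTarget, extChartAt_target, range_modelWithCornersEuclideanHalfSpace]

theorem measurableSet_chartTarget (a : M) : MeasurableSet (chartTarget n a) := by
  obtain ⟨U, hU, h⟩ := chartTarget_eq_inter (n := n) a
  rw [h]
  refine hU.measurableSet.inter (IsClosed.measurableSet ?_)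
  exact isClosed_le continuous_const (by fun_prop)

theorem chartTarget_subset_closure_interior (a : M) :
    (chartTarget n a) ⊆ closure (interior (chartTarget n a)) := by
  obtain ⟨U, hU, h⟩ := chartTarget_eq_inter (n := n) a
  intro y hy
  rw [h] at hy
  have h1 : y ∈ closure {y : Mod n | 0 < y 0} := by
    rw [closure_open_halfSpace]; exact hy.2
  have h2 := hU.inter_closure ⟨hy.1, h1⟩
  refine closure_mono ?_ h2
  rintro z ⟨hz1, hz2⟩
  rw [mem_interior_chartTarget, h]
  have hz : 0 < z 0 := hz2
  exact ⟨⟨hz1, hz.le⟩, hz⟩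

theorem chart_symm_mem_source {a : M} {y : Mod n} (hy : y ∈ chartTarget n a) :
    (extChartAt (𝓡∂ n) a).symm y ∈ (extChartAt (𝓡∂ n) a).source :=
  (extChartAt (𝓡∂ n) a).map_target hy

theorem continuousOn_chart_symm (a : M) :
    ContinuousOn (extChartAt (𝓡∂ n) a).symm (chartTarget n a) :=
  continuousOn_extChartAt_symm a

theorem continuousOn_loc {W : Type*} [TopologicalSpace W] {f : M → W} (hf : Continuous f) (a : M) :
    ContinuousOn (fun y => f ((extChartAt (𝓡∂ n) a).symm y)) (chartTarget n a) :=
  hf.comp_continuousOn (continuousOn_chart_symm a)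

theorem transition_mem {a b : M} {y : Mod n}
    (hb : (extChartAt (𝓡∂ n) a).symm y ∈ (extChartAt (𝓡∂ n) b).source) :
    transition a b y ∈ chartTarget n b := (extChartAt (𝓡∂ n) b).map_source hb

theorem chart_symm_transition {a b : M} {y : Mod n}
    (hb : (extChartAt (𝓡∂ n) a).symm y ∈ (extChartAt (𝓡∂ n) b).source) :
    (extChartAt (𝓡∂ n) b).symm (transition a b y) = (extChartAt (𝓡∂ n) a).symm y :=
  (extChartAt (𝓡∂ n) b).left_inv hb

theorem eventually_mem_source {a b : M} {y : Mod n} (hy : y ∈ chartTarget n a)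
    (hb : (extChartAt (𝓡∂ n) a).symm y ∈ (extChartAt (𝓡∂ n) b).source) :
    ∀ᶠ z in 𝓝[chartTarget n a] y,
      (extChartAt (𝓡∂ n) a).symm z ∈ (extChartAt (𝓡∂ n) b).source :=
  (continuousOn_chart_symm a y hy).eventually ((isOpen_extChartAt_source b).mem_nhds hb)

theorem transition_transition {a b : M} {y : Mod n} (hy : y ∈ chartTarget n a)
    (hb : (extChartAt (𝓡∂ n) a).symm y ∈ (extChartAt (𝓡∂ n) b).source) :
    transition b a (transition a b y) = y := by
  change extChartAt (𝓡∂ n) a ((extChartAt (𝓡∂ n) b).symm (transition a b y)) = y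
  rw [chart_symm_transition hb]
  exact (extChartAt (𝓡∂ n) a).right_inv hy

/-- The differential at a point is the derivative in the chart around that point. -/
theorem mfderiv_eq_locDeriv {f : M → W} (hf : ContMDiff (𝓡∂ n) 𝓘(ℝ, W) ∞ f) (p : M) :
    mfderiv (𝓡∂ n) 𝓘(ℝ, W) f p = locDeriv f p (extChartAt (𝓡∂ n) p p) := by
  have h := (hf p).mdifferentiableAt (by simp)
  have h1 : chartTarget n p =ᶠ[𝓝 (extChartAt (𝓡∂ n) p p)] range (𝓡∂ n) :=
    extChartAt_target_eventuallyEq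
  exact h.mfderiv.trans (fderivWithin_congr_set h1).symm

variable [IsManifold (𝓡∂ n) ∞ M]

theorem isInteriorPoint_chart_symm {a : M} {y : Mod n} (hy : y ∈ chartTarget n a) :
    (𝓡∂ n).IsInteriorPoint ((extChartAt (𝓡∂ n) a).symm y) ↔ 0 < y 0 := by
  have h1 := (𝓡∂ n).isInteriorPoint_iff_of_mem_atlas (n := ∞) (by simp)
    (chart_mem_atlas (EuclideanHalfSpace n) a) (x := (extChartAt (𝓡∂ n) a).symm y)
    (by simpa using chart_symm_mem_source hy)
  rw [h1]
  have h2 : (chartAt (EuclideanHalfSpace n) a).extend (𝓡∂ n)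
      ((extChartAt (𝓡∂ n) a).symm y) = y := (extChartAt (𝓡∂ n) a).right_inv hy
  rw [h2]
  change y ∈ interior (chartTarget n a) ↔ _
  rw [mem_interior_chartTarget]
  exact ⟨fun h => h.2, fun h => ⟨hy, h⟩⟩

theorem isBoundaryPoint_chart_symm {a : M} {y : Mod n} (hy : y ∈ chartTarget n a) (h0 : y 0 = 0) :
    (𝓡∂ n).IsBoundaryPoint ((extChartAt (𝓡∂ n) a).symm y) := by
  rw [(𝓡∂ n).isBoundaryPoint_iff_not_isInteriorPoint, isInteriorPoint_chart_symm hy, h0]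
  exact lt_irrefl _

theorem contDiffOn_loc {f : M → W} (hf : ContMDiff (𝓡∂ n) 𝓘(ℝ, W) ∞ f) (a : M) :
    ContDiffOn ℝ ∞ (loc f a) (chartTarget n a) := by
  have h := hf.comp_contMDiffOn (contMDiffOn_extChartAt_symm (I := 𝓡∂ n) (n := ∞) a)
  exact contMDiffOn_iff_contDiffOn.1 h

theorem differentiableWithinAt_loc {f : M → W} (hf : ContMDiff (𝓡∂ n) 𝓘(ℝ, W) ∞ f) {a : M}
    {y : Mod n} (hy : y ∈ chartTarget n a) :
    DifferentiableWithinAt ℝ (loc f a) (chartTarget n a) y :=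
  (contDiffOn_loc hf a).differentiableOn (by simp) y hy

theorem hasFDerivWithinAt_loc {f : M → W} (hf : ContMDiff (𝓡∂ n) 𝓘(ℝ, W) ∞ f) {a : M}
    {y : Mod n} (hy : y ∈ chartTarget n a) :
    HasFDerivWithinAt (loc f a) (locDeriv f a y) (chartTarget n a) y :=
  (differentiableWithinAt_loc hf hy).hasFDerivWithinAt

theorem contDiffOn_locDeriv {f : M → W} (hf : ContMDiff (𝓡∂ n) 𝓘(ℝ, W) ∞ f) (a : M) :
    ContDiffOn ℝ ∞ (locDeriv f a) (chartTarget n a) :=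
  (contDiffOn_loc hf a).fderivWithin (uniqueDiffOn_chartTarget a) (by simp)

theorem hasFDerivWithinAt_transition {a b : M} {y : Mod n} (hy : y ∈ chartTarget n a)
    (hb : (extChartAt (𝓡∂ n) a).symm y ∈ (extChartAt (𝓡∂ n) b).source) :
    HasFDerivWithinAt (transition a b) (transitionDeriv a b y) (chartTarget n a) y := by
  have h := contDiffWithinAt_ext_coord_change (I := 𝓡∂ n) (n := ∞) b a (y := y) ⟨hy, hb⟩
  exact ((h.mono (extChartAt_target_subset_range a)).differentiableWithinAt
    (by simp)).hasFDerivWithinAt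

/-- The chain rule for a change of charts. -/
theorem locDeriv_eq_comp {f : M → W} {a b : M} {y : Mod n} (hy : y ∈ chartTarget n a)
    (hb : (extChartAt (𝓡∂ n) a).symm y ∈ (extChartAt (𝓡∂ n) b).source)
    (hf : DifferentiableWithinAt ℝ (loc f b) (chartTarget n b) (transition a b y)) :
    locDeriv f a y = (locDeriv f b (transition a b y)).comp (transitionDeriv a b y) := by
  set s := chartTarget n a ∩ {z | (extChartAt (𝓡∂ n) a).symm z ∈ (extChartAt (𝓡∂ n) b).source}
    with hs
  have hmem : {z | (extChartAt (𝓡∂ n) a).symm z ∈ (extChartAt (𝓡∂ n) b).source}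
      ∈ 𝓝[chartTarget n a] y := eventually_mem_source hy hb
  have h1 : HasFDerivWithinAt (loc f b ∘ transition a b)
      ((locDeriv f b (transition a b y)).comp (transitionDeriv a b y)) s y :=
    hf.hasFDerivWithinAt.comp y ((hasFDerivWithinAt_transition hy hb).mono inter_subset_left)
      fun z hz => transition_mem hz.2
  have h2 : HasFDerivWithinAt (loc f a)
      ((locDeriv f b (transition a b y)).comp (transitionDeriv a b y)) s y :=
    h1.congr (fun z hz => by
      simp only [Function.comp_apply, loc]
      rw [chart_symm_transition hz.2])
      (by simp only [Function.comp_apply, loc]; rw [chart_symm_transition hb])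
  have h3 : HasFDerivWithinAt (loc f a)
      ((locDeriv f b (transition a b y)).comp (transitionDeriv a b y)) (chartTarget n a) y :=
    h2.mono_of_mem_nhdsWithin (inter_mem self_mem_nhdsWithin hmem)
  exact h3.fderivWithin (uniqueDiffOn_chartTarget a y hy)

theorem transitionDeriv_comp {a b : M} {y : Mod n} (hy : y ∈ chartTarget n a)
    (hb : (extChartAt (𝓡∂ n) a).symm y ∈ (extChartAt (𝓡∂ n) b).source) :
    (transitionDeriv b a (transition a b y)).comp (transitionDeriv a b y) =
      ContinuousLinearMap.id ℝ (Mod n) := by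
  have hsrc : (extChartAt (𝓡∂ n) b).symm (transition a b y) ∈ (extChartAt (𝓡∂ n) a).source := by
    rw [chart_symm_transition hb]; exact chart_symm_mem_source hy
  have h1 := locDeriv_eq_comp (f := extChartAt (𝓡∂ n) a) hy hb
    (hasFDerivWithinAt_transition (transition_mem hb) hsrc).differentiableWithinAt
  refine h1.symm.trans ?_
  refine (fderivWithin_congr (f := fun z : Mod n => z)
    (fun z hz => (extChartAt (𝓡∂ n) a).right_inv hz)
    ((extChartAt (𝓡∂ n) a).right_inv hy)).trans ?_
  exact fderivWithin_id (uniqueDiffOn_chartTarget a y hy)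

end Charts

/-! ### The hyperboloid model -/

/-- The conformal factor `2 / (1 - |x|²)` of the Poincare metric. -/
def conf {n : ℕ} (x : Amb n) : ℝ := 2 / (1 - ‖x‖ ^ 2)

/-- The spatial part of the point of the hyperboloid `{|Z|² - Z₀² = -1}` that corresponds to the
point `x` of the Poincare ball. -/
def hypPos {n : ℕ} (x : Amb n) : Amb n := conf x • x

/-- The differential of `hypPos` at `x`: the spatial part of the tangent vector of the hyperboloid
that corresponds to the tangent vector `v` of the ball. -/
def hypVec {n : ℕ} (x : Amb n) : Amb n →L[ℝ] Amb n :=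
  conf x • ContinuousLinearMap.id ℝ (Amb n) + (conf x ^ 2) • (innerSL ℝ x).smulRight x

theorem hypVec_apply {n : ℕ} (x v : Amb n) :
    hypVec x v = conf x • v + (conf x ^ 2 * ⟪x, v⟫) • x := by
  simp [hypVec, smul_smul]

theorem one_sub_norm_sq_pos {n : ℕ} {x : Amb n} (hx : x ∈ poincareBall n) : 0 < 1 - ‖x‖ ^ 2 := by
  have : ‖x‖ < 1 := by simpa [poincareBall] using hx
  nlinarith [norm_nonneg x]

theorem conf_pos {n : ℕ} {x : Amb n} (hx : x ∈ poincareBall n) : 0 < conf x :=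
  div_pos two_pos (one_sub_norm_sq_pos hx)

theorem hypMetric_eq {n : ℕ} (x v w : Amb n) : hypMetric x v w = conf x ^ 2 * ⟪v, w⟫ := by
  rw [hypMetric, conf, div_pow]; norm_num

theorem norm_sq_eq_conf {n : ℕ} {x : Amb n} (hx : x ∈ poincareBall n) :
    ‖x‖ ^ 2 = 1 - 2 / conf x := by
  have := one_sub_norm_sq_pos hx
  rw [conf]; field_simp; ring

section Calculus

variable {n : ℕ} {V : Type*} [NormedAddCommGroup V] [NormedSpace ℝ V] {s : Set V} {y : V}
  {x ν : V → Amb n} {x' ν' : V →L[ℝ] Amb n}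

theorem hasFDerivWithinAt_conf (hx : x y ∈ poincareBall n) (hd : HasFDerivWithinAt x x' s y) :
    HasFDerivWithinAt (fun z => conf (x z))
      ((conf (x y) ^ 2) • (innerSL ℝ (x y)).comp x') s y := by
  have h1 := (hd.norm_sq.const_sub 1)
  have h2 : (1 - ‖x y‖ ^ 2) ≠ 0 := (one_sub_norm_sq_pos hx).ne'
  have h3 := ((hasDerivAt_inv h2).comp_hasFDerivWithinAt y h1).const_mul 2
  refine (h3.congr_fderiv ?_)
  ext v
  simp [conf]
  field_simp

theorem hasFDerivWithinAt_hypPos (hx : x y ∈ poincareBall n) (hd : HasFDerivWithinAt x x' s y) :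
    HasFDerivWithinAt (fun z => hypPos (x z)) ((hypVec (x y)).comp x') s y := by
  refine ((hasFDerivWithinAt_conf hx hd).smul hd).congr_fderiv ?_
  ext1 v
  simp [hypVec_apply]

/-- The derivative of a vector field along a hypersurface, read in the hyperboloid model, is its
covariant derivative, up to the second fundamental form of the hyperboloid. -/
theorem hasFDerivWithinAt_hypVec (hx : x y ∈ poincareBall n) (hd : HasFDerivWithinAt x x' s y)
    (hν : HasFDerivWithinAt ν ν' s y) :
    ∃ G' : V →L[ℝ] Amb n, HasFDerivWithinAt (fun z => hypVec (x z) (ν z)) G' s y ∧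
      ∀ v, G' v = hypVec (x y) (ν' v + christoffel (x y) (x' v) (ν y)) +
        hypMetric (x y) (x' v) (ν y) • hypPos (x y) := by
  have h1 := hasFDerivWithinAt_conf hx hd
  have h2 := (h1.smul hν).add (((h1.pow 2).mul (hd.inner ℝ hν)).smul hd)
  refine ⟨_, h2.congr (fun z _ => hypVec_apply _ _) (hypVec_apply _ _), fun v => ?_⟩
  have hc := conf_pos hx
  have hn := norm_sq_eq_conf hx
  have hs : conf (x y) = 2 / (1 - ‖x y‖ ^ 2) := rfl
  simp only [hypVec_apply, christoffel, hypMetric_eq, hypPos, ← hs]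
  simp [inner_add_right, inner_sub_right, inner_smul_right, hn]
  match_scalars
  all_goals field_simp
  ring

end Calculus

/-- A vector which is orthogonal to the spatial part of the tangent vectors that are orthogonal to
`v`. -/
def hypConormal {n : ℕ} (x v : Amb n) : Amb n := v - (2 / (1 + ‖x‖ ^ 2) * ⟪x, v⟫) • x

theorem inner_hypConormal {n : ℕ} {x : Amb n} (hx : x ∈ poincareBall n) (v w : Amb n) :
    ⟪hypConormal x v, hypVec x w⟫ = conf x * ⟪v, w⟫ := by
  have h1 := one_sub_norm_sq_pos hx
  have h2 : 0 < 1 + ‖x‖ ^ 2 := by positivity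
  rw [hypConormal, hypVec_apply, conf]
  simp only [inner_add_right, inner_sub_left, inner_smul_right, inner_smul_left,
    real_inner_self_eq_norm_sq, real_inner_comm x v]
  simp
  field_simp
  ring

theorem abs_inner_hypConormal_le {n : ℕ} (x v e : Amb n) (he : ‖e‖ = 1) :
    |⟪hypConormal x v, e⟫| ≤ ‖v‖ := by
  have h2 : 0 < 1 + ‖x‖ ^ 2 := by positivity
  have h1 : ⟪hypConormal x v, e⟫ = ⟪v, e - (2 / (1 + ‖x‖ ^ 2) * ⟪x, e⟫) • x⟫ := by
    rw [hypConormal, inner_sub_left, inner_sub_right, inner_smul_left, inner_smul_right,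
      real_inner_comm v x]
    simp
    ring
  have h3 : ‖e - (2 / (1 + ‖x‖ ^ 2) * ⟪x, e⟫) • x‖ ^ 2 ≤ 1 := by
    rw [norm_sub_sq_real, he, norm_smul, mul_pow, inner_smul_right, real_inner_comm x e,
      Real.norm_eq_abs, sq_abs]
    have : 1 ^ 2 - 2 * (2 / (1 + ‖x‖ ^ 2) * ⟪x, e⟫ * ⟪x, e⟫) +
        (2 / (1 + ‖x‖ ^ 2) * ⟪x, e⟫) ^ 2 * ‖x‖ ^ 2 =
        1 - (2 / (1 + ‖x‖ ^ 2) * ⟪x, e⟫) ^ 2 := by field_simp; ring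
    rw [this]
    nlinarith [sq_nonneg (2 / (1 + ‖x‖ ^ 2) * ⟪x, e⟫)]
  have h4 : ‖e - (2 / (1 + ‖x‖ ^ 2) * ⟪x, e⟫) • x‖ ≤ 1 := by
    have := abs_le_of_sq_le_sq (a := ‖e - (2 / (1 + ‖x‖ ^ 2) * ⟪x, e⟫) • x‖) (b := 1)
      (by simpa using h3) zero_le_one
    exact (le_abs_self _).trans this
  rw [h1]
  calc _ ≤ ‖v‖ * ‖e - (2 / (1 + ‖x‖ ^ 2) * ⟪x, e⟫) • x‖ := abs_real_inner_le_norm _ _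
    _ ≤ ‖v‖ * 1 := by gcongr
    _ = ‖v‖ := mul_one _

theorem hypVec_injective {n : ℕ} {x : Amb n} (hx : x ∈ poincareBall n) :
    Function.Injective (hypVec x) := by
  rw [injective_iff_map_eq_zero]
  intro w hw
  have h1 := inner_hypConormal hx w w
  rw [hw, inner_zero_right, real_inner_self_eq_norm_sq] at h1
  have h2 := conf_pos hx
  have h3 : ‖w‖ ^ 2 = 0 := (mul_eq_zero.1 h1.symm).resolve_left h2.ne'
  simpa using h3

theorem norm_lastVec (n : ℕ) : ‖lastVec n‖ = 1 := by simp [lastVec]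

/-- A hyperplane is determined by its normal: vectors orthogonal to the normal of the range of an
injective linear map lie in the range. -/
theorem mem_range_of_orthogonal {n : ℕ} {L : Mod n →ₗ[ℝ] Amb n} (hL : Function.Injective L)
    {ν : Amb n} (hν : ν ≠ 0) (h : ∀ v, ⟪ν, L v⟫ = 0) {w : Amb n} (hw : ⟪ν, w⟫ = 0) :
    w ∈ LinearMap.range L := by
  have h1 : LinearMap.range L ≤ (ℝ ∙ ν)ᗮ := by
    rintro _ ⟨v, rfl⟩
    rw [Submodule.mem_orthogonal_singleton_iff_inner_right]
    exact h v
  have h2 : Module.finrank ℝ (ℝ ∙ ν)ᗮ = n := by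
    have : Fact (Module.finrank ℝ (Amb n) = n + 1) := ⟨by simp⟩
    exact Submodule.finrank_orthogonal_span_singleton hν
  have h3 : Module.finrank ℝ (LinearMap.range L) = n := by
    rw [LinearMap.finrank_range_of_inj hL]; simp
  have h4 := Submodule.eq_of_le_of_finrank_eq h1 (by rw [h2, h3])
  rw [h4, Submodule.mem_orthogonal_singleton_iff_inner_right]
  exact hw

/-! ### Local geometry of a hypersurface of hyperbolic space -/

section Geometry

set_option linter.unusedSectionVars false

open Set Filter Topology

variable {n : ℕ} [NeZero n] {M : Type*} [TopologicalSpace M] [ChartedSpace (EuclideanHalfSpace n) M]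

/-- The hypersurface in the hyperboloid model (spatial part). -/
def hypX (X : M → Amb n) (p : M) : Amb n := hypPos (X p)

/-- The unit normal in the hyperboloid model (spatial part). -/
def hypN (X ν : M → Amb n) (p : M) : Amb n := hypVec (X p) (ν p)

/-- The differential at `p`, in the chart around `p`. -/
def baseDeriv {W : Type*} [NormedAddCommGroup W] [NormedSpace ℝ W] (f : M → W) (p : M) :
    Mod n →L[ℝ] W := locDeriv f p (extChartAt (𝓡∂ n) p p)

theorem diff_apply {F : M → Amb n} (hF : ContMDiff (𝓡∂ n) 𝓘(ℝ, Amb n) ∞ F) (p : M)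
    (v : Mod n) : diff F p v = baseDeriv F p v :=
  congrArg (fun L : Mod n →L[ℝ] Amb n => L v) (mfderiv_eq_locDeriv hF p)

variable [IsManifold (𝓡∂ n) ∞ M] {X ν : M → Amb n} {θ : ℝ}

theorem locDeriv_eq_baseDeriv {W : Type*} [NormedAddCommGroup W] [NormedSpace ℝ W] {f : M → W}
    (hf : ContMDiff (𝓡∂ n) 𝓘(ℝ, W) ∞ f) {a : M} {y : Mod n} (hy : y ∈ chartTarget n a) :
    locDeriv f a y = (baseDeriv f ((extChartAt (𝓡∂ n) a).symm y)).comp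
      (transitionDeriv a ((extChartAt (𝓡∂ n) a).symm y) y) :=
  locDeriv_eq_comp hy (mem_extChartAt_source _)
    (differentiableWithinAt_loc hf (mem_extChartAt_target _))

theorem injective_transitionDeriv {a b : M} {y : Mod n} (hy : y ∈ chartTarget n a)
    (hb : (extChartAt (𝓡∂ n) a).symm y ∈ (extChartAt (𝓡∂ n) b).source) :
    Function.Injective (transitionDeriv a b y) := by
  intro v w h
  have h1 := transitionDeriv_comp hy hb
  have h2 := congrArg (fun L : Mod n →L[ℝ] Mod n => L v) h1
  have h3 := congrArg (fun L : Mod n →L[ℝ] Mod n => L w) h1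
  simp only [ContinuousLinearMap.comp_apply, ContinuousLinearMap.id_apply] at h2 h3
  rw [← h2, ← h3, h]

theorem baseDeriv_orth (hX : IsCapillary X ν θ) (p : M) (v : Mod n) :
    ⟪ν p, baseDeriv X p v⟫ = 0 := by
  have h := hX.normal_orth p v
  rw [diff_apply hX.smooth, hypMetric_eq] at h
  exact (mul_eq_zero.1 h).resolve_left (pow_ne_zero 2 (conf_pos (hX.mem_ball p)).ne')

theorem locDeriv_orth (hX : IsCapillary X ν θ) {a : M} {y : Mod n} (hy : y ∈ chartTarget n a)
    (v : Mod n) : ⟪loc ν a y, locDeriv X a y v⟫ = 0 := by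
  rw [locDeriv_eq_baseDeriv hX.smooth hy]
  exact baseDeriv_orth hX _ _

theorem baseDeriv_injective (hX : IsCapillary X ν θ) (p : M) :
    Function.Injective (baseDeriv (n := n) X p) := by
  intro v w h
  rw [← diff_apply hX.smooth, ← diff_apply hX.smooth] at h
  exact hX.immersion p h

theorem norm_normal (hX : IsCapillary X ν θ) (p : M) : conf (X p) * ‖ν p‖ = 1 := by
  have h := hX.normal_unit p
  rw [hypMetric_eq, real_inner_self_eq_norm_sq, ← mul_pow] at h
  have h1 : 0 ≤ conf (X p) * ‖ν p‖ := mul_nonneg (conf_pos (hX.mem_ball p)).le (norm_nonneg _)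
  nlinarith

theorem normal_ne_zero (hX : IsCapillary X ν θ) (p : M) : ν p ≠ 0 := by
  intro h
  have := norm_normal hX p
  rw [h, norm_zero, mul_zero] at this
  exact zero_ne_one this

/-- Symmetry of the second fundamental form in a chart: both sides are `-⟨ν, ∂²X⟩`. -/
theorem locDeriv_symm (hX : IsCapillary X ν θ) {a : M} {y : Mod n} (hy : y ∈ chartTarget n a)
    (v w : Mod n) :
    ⟪locDeriv ν a y v, locDeriv X a y w⟫ = ⟪locDeriv ν a y w, locDeriv X a y v⟫ := by
  have hu := uniqueDiffOn_chartTarget a y hy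
  set D2 := fderivWithin ℝ (locDeriv X a) (chartTarget n a) y with hD2
  have h1 : HasFDerivWithinAt (locDeriv X a) D2 (chartTarget n a) y :=
    ((contDiffOn_locDeriv hX.smooth a).differentiableOn (by simp) y hy).hasFDerivWithinAt
  have key : ∀ v w : Mod n, ⟪locDeriv ν a y v, locDeriv X a y w⟫ = -⟪loc ν a y, D2 v w⟫ := by
    intro v w
    have h2 : HasFDerivWithinAt (fun z => locDeriv X a z w)
        ((ContinuousLinearMap.apply ℝ (Amb n) w).comp D2) (chartTarget n a) y :=
      (ContinuousLinearMap.apply ℝ (Amb n) w).hasFDerivAt.comp_hasFDerivWithinAt y h1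
    have h3 := (hasFDerivWithinAt_loc hX.normal_smooth hy).inner ℝ h2
    have h4 : HasFDerivWithinAt (fun z => ⟪loc ν a z, locDeriv X a z w⟫)
        (0 : Mod n →L[ℝ] ℝ) (chartTarget n a) y :=
      (hasFDerivWithinAt_const (0 : ℝ) y _).congr (fun z hz => locDeriv_orth hX hz w)
        (locDeriv_orth hX hy w)
    have h5 := congrArg (fun L : Mod n →L[ℝ] ℝ => L v) (hu.eq h3 h4)
    simp at h5
    linarith
  have hsymm : IsSymmSndFDerivWithinAt ℝ (loc X a) (chartTarget n a) y :=
    (contDiffOn_loc hX.smooth a y hy).isSymmSndFDerivWithinAt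
      (by
        simp only [minSmoothness_of_isRCLikeNormedField]
        exact WithTop.coe_le_coe.2 (le_top : (2 : ℕ∞) ≤ ⊤))
      (uniqueDiffOn_chartTarget a) (chartTarget_subset_closure_interior a hy) hy
  rw [key, key]
  congr 2
  exact hsymm v w

theorem inner_locDeriv_normal (hX : IsCapillary X ν θ) {a : M} {y : Mod n}
    (hy : y ∈ chartTarget n a) (v : Mod n) :
    conf (loc X a y) * ⟪locDeriv (n := n) ν a y v, loc (n := n) ν a y⟫ =
      -⟪loc (n := n) X a y, locDeriv (n := n) X a y v⟫ := by
  have hu := uniqueDiffOn_chartTarget a y hy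
  have hb := hX.mem_ball ((extChartAt (𝓡∂ n) a).symm y)
  have h1 := (hasFDerivWithinAt_loc hX.normal_smooth hy).norm_sq
  have h2 := (((hasFDerivWithinAt_loc hX.smooth hy).norm_sq.const_sub 1).const_mul (1 / 2)).pow 2
  have h3 : ∀ z : Mod n, ‖loc ν a z‖ ^ 2 = (1 / 2 * (1 - ‖loc X a z‖ ^ 2)) ^ 2 := by
    intro z
    have h4 := norm_normal hX ((extChartAt (𝓡∂ n) a).symm z)
    have h5 := one_sub_norm_sq_pos (hX.mem_ball ((extChartAt (𝓡∂ n) a).symm z))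
    have : ‖loc ν a z‖ = 1 / 2 * (1 - ‖loc X a z‖ ^ 2) := by
      simp only [conf] at h4
      simp only [loc]
      field_simp at h4
      linarith
    rw [this]
  have h6 := h2.congr (fun z _ => h3 z) (h3 y)
  have h7 := congrArg (fun L : Mod n →L[ℝ] ℝ => L v) (hu.eq h1 h6)
  simp at h7
  rw [real_inner_comm (loc ν a y)]
  have h8 := one_sub_norm_sq_pos hb
  change 0 < 1 - ‖loc X a y‖ ^ 2 at h8
  rw [conf]
  field_simp
  linear_combination h7

theorem loc_mem_ball (hX : IsCapillary X ν θ) (a : M) (y : Mod n) :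
    loc X a y ∈ poincareBall n := hX.mem_ball _

theorem contDiffAt_conf {x : Amb n} (hx : x ∈ poincareBall n) : ContDiffAt ℝ ∞ conf x := by
  unfold conf
  refine contDiffAt_const.div ?_ (one_sub_norm_sq_pos hx).ne'
  exact contDiffAt_const.sub (contDiff_norm_sq ℝ).contDiffAt

theorem contMDiff_hypX (hX : IsCapillary X ν θ) : ContMDiff (𝓡∂ n) 𝓘(ℝ, Amb n) ∞ (hypX X) := by
  intro p
  have h : ContDiffAt ℝ ∞ (hypPos : Amb n → Amb n) (X p) :=
    (contDiffAt_conf (hX.mem_ball p)).smul contDiffAt_id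
  exact h.contMDiffAt.comp p (hX.smooth p)

theorem contMDiff_hypN (hX : IsCapillary X ν θ) :
    ContMDiff (𝓡∂ n) 𝓘(ℝ, Amb n) ∞ (hypN X ν) := by
  intro p
  have hf : ContDiffAt ℝ ∞ (fun q : Amb n × Amb n => q.1) (X p, ν p) := contDiffAt_fst
  have hs : ContDiffAt ℝ ∞ (fun q : Amb n × Amb n => q.2) (X p, ν p) := contDiffAt_snd
  have hc : ContDiffAt ℝ ∞ (fun q : Amb n × Amb n => conf q.1) (X p, ν p) :=
    ContDiffAt.comp (g := conf) (X p, ν p) (contDiffAt_conf (hX.mem_ball p)) contDiffAt_fst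
  have hi : ContDiffAt ℝ ∞ (fun q : Amb n × Amb n => ⟪q.1, q.2⟫) (X p, ν p) := hf.inner ℝ hs
  have h : ContDiffAt ℝ ∞ (fun q : Amb n × Amb n =>
      conf q.1 • q.2 + (conf q.1 ^ 2 * ⟪q.1, q.2⟫) • q.1) (X p, ν p) :=
    (hc.smul hs).add (((hc.pow 2).mul hi).smul hf)
  have h2 := ContMDiffAt.comp p (g := fun q : Amb n × Amb n =>
      conf q.1 • q.2 + (conf q.1 ^ 2 * ⟪q.1, q.2⟫) • q.1) h.contMDiffAt
    ((hX.smooth p).prodMk_space (hX.normal_smooth p))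
  refine h2.congr_of_eventuallyEq (Filter.Eventually.of_forall fun q => ?_)
  rw [hypN, hypVec_apply]
  rfl

theorem locDeriv_hypX (hX : IsCapillary X ν θ) {a : M} {y : Mod n} (hy : y ∈ chartTarget n a) :
    locDeriv (hypX X) a y = (hypVec (loc X a y)).comp (locDeriv X a y) :=
  (hasFDerivWithinAt_hypPos (loc_mem_ball hX a y)
    (hasFDerivWithinAt_loc hX.smooth hy)).fderivWithin (uniqueDiffOn_chartTarget a y hy)

theorem locDeriv_hypN (hX : IsCapillary X ν θ) {a : M} {y : Mod n} (hy : y ∈ chartTarget n a)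
    (v : Mod n) :
    locDeriv (hypN X ν) a y v = hypVec (loc X a y)
      (locDeriv ν a y v + christoffel (loc X a y) (locDeriv X a y v) (loc ν a y)) := by
  obtain ⟨G', h1, h2⟩ := hasFDerivWithinAt_hypVec (loc_mem_ball hX a y)
    (hasFDerivWithinAt_loc hX.smooth hy) (hasFDerivWithinAt_loc hX.normal_smooth hy)
  have h3 : locDeriv (hypN X ν) a y = G' := h1.fderivWithin (uniqueDiffOn_chartTarget a y hy)
  rw [h3, h2, hypMetric_eq, real_inner_comm, locDeriv_orth hX hy, mul_zero, zero_smul, add_zero]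

theorem loc_self (f : M → Amb n) (p : M) : loc f p (extChartAt (𝓡∂ n) p p) = f p := by
  rw [loc, extChartAt_to_inv]

theorem baseDeriv_hypX (hX : IsCapillary X ν θ) (p : M) :
    baseDeriv (n := n) (hypX X) p = (hypVec (X p)).comp (baseDeriv (n := n) X p) := by
  have := locDeriv_hypX hX (mem_extChartAt_target (I := 𝓡∂ n) p)
  rwa [loc_self] at this

theorem covDeriv_eq (hX : IsCapillary X ν θ) (p : M) (v : Mod n) :
    covDeriv X ν p v = baseDeriv ν p v + christoffel (X p) (baseDeriv X p v) (ν p) := by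
  have h1 := diff_apply hX.normal_smooth p v
  have h2 := diff_apply hX.smooth p v
  calc covDeriv X ν p v = diff ν p v + christoffel (X p) (diff X p v) (ν p) := rfl
    _ = _ := by rw [h1, h2]

theorem baseDeriv_hypN (hX : IsCapillary X ν θ) (p : M) (v : Mod n) :
    baseDeriv (hypN X ν) p v = hypVec (X p) (covDeriv X ν p v) := by
  have := locDeriv_hypN hX (mem_extChartAt_target (I := 𝓡∂ n) p) v
  rw [loc_self, loc_self] at this
  rw [covDeriv_eq hX]
  exact this

theorem firstForm_eq (hX : IsCapillary X ν θ) (p : M) (v w : Mod n) :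
    firstForm X p v w = conf (X p) ^ 2 * ⟪baseDeriv X p v, baseDeriv X p w⟫ := by
  have h1 := diff_apply hX.smooth p v
  have h2 := diff_apply hX.smooth p w
  calc firstForm X p v w = hypMetric (X p) (diff X p v) (diff X p w) := rfl
    _ = _ := by rw [h1, h2, hypMetric_eq]

theorem inner_covDeriv (hX : IsCapillary X ν θ) (p : M) (v w : Mod n) :
    ⟪covDeriv X ν p v, baseDeriv X p w⟫ = ⟪baseDeriv ν p v, baseDeriv X p w⟫ +
      conf (X p) * ⟪X p, ν p⟫ * ⟪baseDeriv X p v, baseDeriv X p w⟫ := by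
  have h1 := baseDeriv_orth hX p
  rw [covDeriv_eq hX, christoffel, ← conf]
  simp only [inner_add_left, inner_sub_left, inner_smul_left, h1, real_inner_comm (ν p)]
  simp
  ring

theorem secondForm_eq (hX : IsCapillary X ν θ) (p : M) (v w : Mod n) :
    secondForm X ν p v w = conf (X p) ^ 2 * (⟪baseDeriv ν p v, baseDeriv X p w⟫ +
      conf (X p) * ⟪X p, ν p⟫ * ⟪baseDeriv X p v, baseDeriv X p w⟫) := by
  have h1 := diff_apply hX.smooth p w
  calc secondForm X ν p v w = hypMetric (X p) (covDeriv X ν p v) (diff X p w) := rfl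
    _ = _ := by rw [h1, hypMetric_eq, inner_covDeriv hX]

theorem secondForm_symm (hX : IsCapillary X ν θ) (p : M) (v w : Mod n) :
    secondForm X ν p v w = secondForm X ν p w v := by
  have h := locDeriv_symm hX (mem_extChartAt_target (I := 𝓡∂ n) p) v w
  change ⟪baseDeriv ν p v, baseDeriv X p w⟫ = ⟪baseDeriv ν p w, baseDeriv X p v⟫ at h
  rw [secondForm_eq hX, secondForm_eq hX, h, real_inner_comm (baseDeriv X p w) (baseDeriv X p v)]

theorem covDeriv_orth (hX : IsCapillary X ν θ) (p : M) (v : Mod n) :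
    ⟪ν p, covDeriv X ν p v⟫ = 0 := by
  have h1 := inner_locDeriv_normal hX (mem_extChartAt_target (I := 𝓡∂ n) p) v
  rw [loc_self, loc_self] at h1
  change conf (X p) * ⟪baseDeriv ν p v, ν p⟫ = -⟪X p, baseDeriv X p v⟫ at h1
  have h2 := norm_normal hX p
  have h3 := baseDeriv_orth hX p v
  have h4 := conf_pos (hX.mem_ball p)
  rw [covDeriv_eq hX, christoffel, ← conf]
  simp only [inner_add_right, inner_sub_right, inner_smul_right, real_inner_self_eq_norm_sq,
    real_inner_comm (ν p) (baseDeriv X p v), real_inner_comm (ν p) (X p),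
    real_inner_comm (ν p) (baseDeriv ν p v)] at *
  rw [h3]
  apply mul_left_cancel₀ h4.ne'
  linear_combination h1 + (⟪X p, baseDeriv X p v⟫) * (conf (X p) * ‖ν p‖ + 1) * h2

end Geometry

/-! ### The shape operator and the elementary symmetric functions of its eigenvalues -/

section Shape

open Set Filter Topology Matrix

set_option linter.unusedSectionVars false

variable {n : ℕ} [NeZero n] {M : Type*} [TopologicalSpace M] [ChartedSpace (EuclideanHalfSpace n) M]
  [IsManifold (𝓡∂ n) ∞ M] {X ν : M → Amb n} {θ : ℝ}

theorem toLp_eq_sum (v : Fin n → ℝ) : (WithLp.toLp 2 v : Mod n) = ∑ i, v i • stdVec i := by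
  ext j
  simp [stdVec, Finset.sum_apply, Pi.single_apply]

theorem inner_eq_dotProduct (L L' : Mod n →L[ℝ] Amb n) (v w : Fin n → ℝ) :
    ⟪L (WithLp.toLp 2 v), L' (WithLp.toLp 2 w)⟫ =
      v ⬝ᵥ (Matrix.of fun i j => ⟪L (stdVec i), L' (stdVec j)⟫) *ᵥ w := by
  rw [toLp_eq_sum, toLp_eq_sum, map_sum, map_sum, sum_inner]
  simp only [inner_sum, map_smul, inner_smul_left, inner_smul_right, dotProduct, mulVec,
    Matrix.of_apply, Finset.mul_sum]
  refine Finset.sum_congr rfl fun i _ => Finset.sum_congr rfl fun j _ => ?_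
  simp
  ring

theorem firstForm_toLp (hX : IsCapillary X ν θ) (p : M) (v w : Fin n → ℝ) :
    firstForm X p (WithLp.toLp 2 v : Mod n) (WithLp.toLp 2 w : Mod n) =
      v ⬝ᵥ firstMatrix X p *ᵥ w := by
  have h : firstMatrix X p = conf (X p) ^ 2 •
      (Matrix.of fun i j => ⟪baseDeriv X p (stdVec i), baseDeriv X p (stdVec j)⟫) := by
    ext i j
    exact firstForm_eq hX p (stdVec i) (stdVec j)
  rw [firstForm_eq hX, h, smul_mulVec, dotProduct_smul, inner_eq_dotProduct, smul_eq_mul]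

theorem secondForm_toLp (hX : IsCapillary X ν θ) (p : M) (v w : Fin n → ℝ) :
    secondForm X ν p (WithLp.toLp 2 v : Mod n) (WithLp.toLp 2 w : Mod n) =
      v ⬝ᵥ secondMatrix X ν p *ᵥ w := by
  have h1 : ∀ v w : Mod n, secondForm X ν p v w = conf (X p) ^ 2 *
      ⟪(baseDeriv (n := n) ν p + (conf (X p) * ⟪X p, ν p⟫) • baseDeriv (n := n) X p :
        Mod n →L[ℝ] Amb n) v, baseDeriv X p w⟫ := by
    intro v w
    rw [secondForm_eq hX]
    simp [inner_add_left, inner_smul_left]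
  have h : secondMatrix X ν p = conf (X p) ^ 2 • (Matrix.of fun i j =>
      ⟪(baseDeriv (n := n) ν p + (conf (X p) * ⟪X p, ν p⟫) • baseDeriv (n := n) X p :
        Mod n →L[ℝ] Amb n) (stdVec i),
        baseDeriv X p (stdVec j)⟫) := by
    ext i j
    exact h1 (stdVec i) (stdVec j)
  rw [h1, h, smul_mulVec, dotProduct_smul, inner_eq_dotProduct, smul_eq_mul]

theorem secondMatrix_isHermitian (hX : IsCapillary X ν θ) (p : M) :
    (secondMatrix X ν p).IsHermitian := by
  ext i j
  exact secondForm_symm hX p (stdVec j) (stdVec i)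

theorem firstMatrix_posDef (hX : IsCapillary X ν θ) (p : M) : (firstMatrix X p).PosDef := by
  refine Matrix.PosDef.of_dotProduct_mulVec_pos ?_ fun v hv => ?_
  · ext i j
    have := firstForm_eq hX p (stdVec j) (stdVec i)
    rw [real_inner_comm, ← firstForm_eq hX] at this
    exact this
  · rw [star_trivial, ← firstForm_toLp hX, firstForm_eq hX]
    refine mul_pos (pow_pos (conf_pos (hX.mem_ball p)) 2) (real_inner_self_pos.2 fun h => hv ?_)
    have h1 := baseDeriv_injective hX p (h.trans (map_zero _).symm)
    simpa using congrArg WithLp.ofLp h1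

/-- The Weingarten map, as a linear map. -/
def shape (X ν : M → Amb n) (p : M) : Mod n →ₗ[ℝ] Mod n :=
  Matrix.toEuclideanLin (weingarten X ν p)

theorem firstForm_shape (hX : IsCapillary X ν θ) (p : M) (v w : Mod n) :
    firstForm X p (shape X ν p v) w = secondForm X ν p v w := by
  have hg : IsUnit (firstMatrix X p).det :=
    isUnit_iff_ne_zero.2 (firstMatrix_posDef hX p).det_pos.ne'
  obtain ⟨v, rfl⟩ := (WithLp.equiv 2 (Fin n → ℝ)).symm.surjective v
  obtain ⟨w, rfl⟩ := (WithLp.equiv 2 (Fin n → ℝ)).symm.surjective w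
  change firstForm X p (WithLp.toLp 2 (weingarten X ν p *ᵥ v) : Mod n) (WithLp.toLp 2 w : Mod n) =
    secondForm X ν p (WithLp.toLp 2 v : Mod n) (WithLp.toLp 2 w : Mod n)
  rw [secondForm_symm hX, secondForm_toLp hX]
  rw [firstForm_eq hX, real_inner_comm, ← firstForm_eq hX, firstForm_toLp hX, weingarten,
    mulVec_mulVec, ← Matrix.mul_assoc, mul_nonsing_inv _ hg, Matrix.one_mul]

/-- The normal field in the hyperboloid model satisfies `dN = dX ∘ S`. -/
theorem baseDeriv_hypN_eq (hX : IsCapillary X ν θ) (p : M) (v : Mod n) :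
    baseDeriv (hypN X ν) p v = baseDeriv (hypX X) p (shape X ν p v) := by
  obtain ⟨u, hu⟩ := mem_range_of_orthogonal (L := (baseDeriv X p).toLinearMap)
    (baseDeriv_injective hX p) (normal_ne_zero hX p) (baseDeriv_orth hX p)
    (covDeriv_orth hX p v)
  change baseDeriv X p u = covDeriv X ν p v at hu
  have h1 : ∀ w : Mod n, ⟪baseDeriv X p (shape X ν p v - u), baseDeriv X p w⟫ = 0 := by
    intro w
    have h2 := firstForm_shape hX p v w
    rw [firstForm_eq hX, secondForm_eq hX, ← inner_covDeriv hX, ← hu] at h2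
    have h3 := mul_left_cancel₀ (pow_ne_zero 2 (conf_pos (hX.mem_ball p)).ne') h2
    rw [map_sub, inner_sub_left, h3, sub_self]
  have h2 : baseDeriv X p (shape X ν p v - u) = 0 := inner_self_eq_zero.1 (h1 _)
  rw [map_sub, sub_eq_zero] at h2
  rw [baseDeriv_hypN hX, baseDeriv_hypX hX, ContinuousLinearMap.comp_apply, h2, hu]

/-- The `j`-th elementary symmetric function of the principal curvatures. -/
def sigma (X ν : M → Amb n) (j : ℕ) (p : M) : ℝ := (principalCurvatures X ν p).esymm j

theorem card_principalCurvatures (hX : IsCapillary X ν θ) (p : M) :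
    Multiset.card (principalCurvatures X ν p) = n :=
  card_roots_relative (firstMatrix_posDef hX p) (secondMatrix_isHermitian hX p)

theorem det_shape (hX : IsCapillary X ν θ) (p : M) (s t : ℝ) :
    LinearMap.det (s • LinearMap.id + t • shape X ν p : Mod n →ₗ[ℝ] Mod n) =
      ∑ j ∈ Finset.range (n + 1), sigma X ν j p * t ^ j * s ^ (n - j) := by
  have h0 := det_add_smul_eq_sum (weingarten X ν p) (card_principalCurvatures hX p) s t
  have h : (s • LinearMap.id + t • shape X ν p : Mod n →ₗ[ℝ] Mod n) =
      Matrix.toEuclideanLin (s • (1 : Matrix (Fin n) (Fin n) ℝ) + t • weingarten X ν p) := by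
    rw [map_add, map_smul, map_smul, shape]
    congr 2
    ext v
    simp
  rw [h, Matrix.toEuclideanLin, Matrix.toLpLin_eq_toLin, LinearMap.det_toLin]
  exact h0

/-- A pencil of differentials: every determinant with one free vector is multiplied by the
characteristic determinant of the shape operator. -/
theorem wedge_pencil (hX : IsCapillary X ν θ) {a : M} {y : Mod n} (hy : y ∈ chartTarget n a)
    (w : Amb n) (s t : ℝ) :
    wedge w (fun i => s • locDeriv (hypX X) a y (stdVec i) +
        t • locDeriv (hypN X ν) a y (stdVec i)) =
      (∑ j ∈ Finset.range (n + 1),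
        sigma X ν j ((extChartAt (𝓡∂ n) a).symm y) * t ^ j * s ^ (n - j)) *
        wedge w fun i => locDeriv (hypX X) a y (stdVec i) := by
  set p := (extChartAt (𝓡∂ n) a).symm y with hp
  have h1 := locDeriv_eq_baseDeriv (contMDiff_hypX hX) hy
  have h2 := locDeriv_eq_baseDeriv (contMDiff_hypN hX) hy
  rw [← hp] at h1 h2
  set J := transitionDeriv a p y
  set L := baseDeriv (n := n) (hypX X) p
  have h3 : ∀ i : Fin n, s • locDeriv (hypX X) a y (stdVec i) +
      t • locDeriv (hypN X ν) a y (stdVec i) =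
      L.toLinearMap (((s • LinearMap.id + t • shape X ν p) ∘ₗ J.toLinearMap) (stdVec i)) := by
    intro i
    rw [h1, h2]
    simp only [ContinuousLinearMap.comp_apply, baseDeriv_hypN_eq hX]
    simp [L]
  have h4 : ∀ i : Fin n, locDeriv (hypX X) a y (stdVec i) =
      L.toLinearMap (J.toLinearMap (stdVec i)) := by
    intro i
    rw [h1]
    rfl
  rw [funext h3, funext h4]
  rw [wedge_comp_det, wedge_comp_det, LinearMap.det_comp, det_shape hX]
  ring

/-! ### The area density -/

/-- The determinant of the normal and the coordinate vectors in the hyperboloid model, in the chart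
at `a`. As only spatial parts are used, its absolute value is the area density multiplied by the
time component of the position, which is positive and does not depend on the chart. -/
def density (X ν : M → Amb n) (a : M) (y : Mod n) : ℝ :=
  wedge (loc (hypN X ν) a y) fun i => locDeriv (hypX X) a y (stdVec i)

/-- The conormal of the hypersurface in the hyperboloid model (spatial part). -/
def conormal (X ν : M → Amb n) (p : M) : Amb n := hypConormal (X p) (ν p)

theorem inner_conormal_hypN (hX : IsCapillary X ν θ) (p : M) :
    ⟪conormal X ν p, hypN X ν p⟫ = ‖ν p‖ := by
  rw [conormal, hypN, inner_hypConormal (hX.mem_ball p), real_inner_self_eq_norm_sq, sq,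
    ← mul_assoc, norm_normal hX, one_mul]

theorem inner_conormal_locDeriv (hX : IsCapillary X ν θ) {a : M} {y : Mod n}
    (hy : y ∈ chartTarget n a) (v : Mod n) :
    ⟪conormal X ν ((extChartAt (𝓡∂ n) a).symm y), locDeriv (hypX X) a y v⟫ = 0 := by
  rw [conormal, locDeriv_hypX hX hy, ContinuousLinearMap.comp_apply]
  refine (inner_hypConormal (hX.mem_ball _) _ _).trans ?_
  exact mul_eq_zero_of_right _ (locDeriv_orth hX hy v)

theorem locDeriv_hypX_injective (hX : IsCapillary X ν θ) {a : M} {y : Mod n}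
    (hy : y ∈ chartTarget n a) : Function.Injective (locDeriv (n := n) (hypX X) a y) := by
  rw [locDeriv_hypX hX hy, locDeriv_eq_baseDeriv hX.smooth hy]
  exact (hypVec_injective (loc_mem_ball hX a y)).comp
    ((baseDeriv_injective hX _).comp (injective_transitionDeriv hy (mem_extChartAt_source _)))

theorem norm_normal_pos (hX : IsCapillary X ν θ) (p : M) : 0 < ‖ν p‖ :=
  norm_pos_iff.2 (normal_ne_zero hX p)

theorem density_ne_zero (hX : IsCapillary X ν θ) {a : M} {y : Mod n}
    (hy : y ∈ chartTarget n a) : density X ν a y ≠ 0 := by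
  refine wedge_ne_zero (η := conormal X ν ((extChartAt (𝓡∂ n) a).symm y))
    (L := (locDeriv (hypX X) a y).toLinearMap) ?_ (locDeriv_hypX_injective hX hy)
    (inner_conormal_locDeriv hX hy)
  rw [loc, inner_conormal_hypN hX]
  exact (norm_normal_pos hX _).ne'

theorem wedge_eq_density (hX : IsCapillary X ν θ) {a : M} {y : Mod n}
    (hy : y ∈ chartTarget n a) (w : Amb n) :
    wedge w (fun i => locDeriv (hypX X) a y (stdVec i)) =
      ⟪conormal X ν ((extChartAt (𝓡∂ n) a).symm y), w⟫ / ‖ν ((extChartAt (𝓡∂ n) a).symm y)‖ *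
        density X ν a y := by
  rw [← inner_conormal_hypN hX]
  exact wedge_eq_ratio (by rw [inner_conormal_hypN hX]; exact (norm_normal_pos hX _).ne')
    fun i => inner_conormal_locDeriv hX hy _

theorem continuousOn_wedge {f : Mod n → Amb n} {v : Fin n → Mod n → Amb n} {s : Set (Mod n)}
    (hf : ContinuousOn f s) (hv : ∀ i, ContinuousOn (v i) s) :
    ContinuousOn (fun y => wedge (f y) fun i => v i y) s := by
  refine (continuous_volAlt n).comp_continuousOn (continuousOn_pi.2 fun m => ?_)
  refine Fin.cases ?_ (fun j => ?_) m
  · simpa using hf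
  · simpa using hv j

theorem continuousOn_locDeriv {W : Type*} [NormedAddCommGroup W] [NormedSpace ℝ W] {f : M → W}
    (hf : ContMDiff (𝓡∂ n) 𝓘(ℝ, W) ∞ f) (a : M) (v : Mod n) :
    ContinuousOn (fun y => locDeriv f a y v) (chartTarget n a) :=
  (contDiffOn_locDeriv hf a).continuousOn.clm_apply continuousOn_const

theorem continuousOn_density (hX : IsCapillary X ν θ) (a : M) :
    ContinuousOn (density X ν a) (chartTarget n a) :=
  continuousOn_wedge (contDiffOn_loc (contMDiff_hypN hX) a).continuousOn
    fun i => continuousOn_locDeriv (contMDiff_hypX hX) a (stdVec i)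

theorem continuous_of_continuousOn_chart {W : Type*} [TopologicalSpace W] {f : M → W}
    (h : ∀ a : M, ContinuousOn (fun y => f ((extChartAt (𝓡∂ n) a).symm y)) (chartTarget n a)) :
    Continuous f := by
  rw [continuous_iff_continuousAt]
  intro p
  have h1 := h p _ (mem_extChartAt_target p)
  have h2 : ContinuousWithinAt (extChartAt (𝓡∂ n) p) (extChartAt (𝓡∂ n) p).source p :=
    (continuousAt_extChartAt p).continuousWithinAt
  have h3 := (h1.comp h2 (extChartAt (𝓡∂ n) p).mapsTo).continuousAt
    (extChartAt_source_mem_nhds p)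
  refine h3.congr ?_
  filter_upwards [extChartAt_source_mem_nhds (I := 𝓡∂ n) p] with q hq
  simp only [Function.comp_apply]
  rw [(extChartAt (𝓡∂ n) p).left_inv hq]

/-- This sum is a quotient of two determinants in each chart. -/
theorem continuous_sum_sigma (hX : IsCapillary X ν θ) (t : ℝ) :
    Continuous fun p => ∑ j ∈ Finset.range (n + 1), sigma X ν j p * t ^ j := by
  refine continuous_of_continuousOn_chart (n := n) fun a => ?_
  have h1 : ContinuousOn (fun y => wedge (loc (hypN X ν) a y)
      (fun i => (1 : ℝ) • locDeriv (hypX X) a y (stdVec i) +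
        t • locDeriv (hypN X ν) a y (stdVec i)) / density X ν a y) (chartTarget n a) := by
    refine ContinuousOn.div ?_ (continuousOn_density hX a) fun y hy => density_ne_zero hX hy
    refine continuousOn_wedge (contDiffOn_loc (contMDiff_hypN hX) a).continuousOn fun i => ?_
    exact ((continuousOn_locDeriv (contMDiff_hypX hX) a (stdVec i)).const_smul (1 : ℝ)).add
      ((continuousOn_locDeriv (contMDiff_hypN hX) a (stdVec i)).const_smul t)
  refine h1.congr fun y hy => ?_
  rw [eq_div_iff (density_ne_zero hX hy), wedge_pencil hX hy, density]
  simp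

/-- By interpolation at `n + 1` values of the parameter. -/
theorem continuous_sigma (hX : IsCapillary X ν θ) {j : ℕ} (hj : j ≤ n) :
    Continuous (sigma X ν j) := by
  set V : Matrix (Fin (n + 1)) (Fin (n + 1)) ℝ := Matrix.vandermonde fun i => (i : ℝ) with hV
  have hdet : IsUnit V.det := by
    rw [isUnit_iff_ne_zero, hV, Matrix.det_vandermonde_ne_zero_iff]
    intro i j h
    exact Fin.ext (by simpa using h)
  have h1 : Continuous fun p => V *ᵥ (fun i : Fin (n + 1) => sigma X ν i p) := by
    refine continuous_pi fun i => ?_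
    refine (continuous_sum_sigma hX (i : ℝ)).congr fun p => ?_
    rw [Finset.sum_range]
    simp [mulVec, dotProduct, hV, Matrix.vandermonde_apply, mul_comm]
  have h2 : Continuous fun p => V⁻¹ *ᵥ (V *ᵥ (fun i : Fin (n + 1) => sigma X ν i p)) :=
    Continuous.matrix_mulVec continuous_const h1
  simp only [mulVec_mulVec, Matrix.nonsing_inv_mul _ hdet, one_mulVec] at h2
  exact (continuous_pi_iff.1 h2) ⟨j, by omega⟩

end Shape

/-! ### The divergence theorem in a chart -/

section Divergence

open Set Filter Topology MeasureTheory

set_option linter.unusedSectionVars false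

variable {n : ℕ} [NeZero n]

theorem abs_coord_le_norm (y : Mod n) (i : Fin n) : |y i| ≤ ‖y‖ := by
  simpa using PiLp.norm_apply_le y i

/-- The divergence theorem for compactly supported vector fields on the half space whose normal
component vanishes along the boundary. -/
theorem integral_divergence_halfSpace {K : Set (Mod n)} (hK : IsCompact K)
    {Y : Fin n → Mod n → ℝ} {Y' : Fin n → Mod n → Mod n →L[ℝ] ℝ} {D : Mod n → ℝ}
    (hYc : ∀ i, ContinuousOn (Y i) {y | 0 ≤ y 0}) (hY0 : ∀ i, ∀ y ∉ K, Y i y = 0)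
    (hb : ∀ y : Mod n, y 0 = 0 → Y 0 y = 0)
    (hd : ∀ y : Mod n, 0 < y 0 → ∀ i, HasFDerivAt (Y i) (Y' i y) y)
    (hD : ∀ y : Mod n, 0 < y 0 → ∑ i, Y' i y (stdVec i) = D y)
    (hDc : ContinuousOn D {y | 0 ≤ y 0}) (hD0 : ∀ y ∉ K, D y = 0) :
    ∫ y in {y : Mod n | 0 ≤ y 0}, D y = 0 := by
  obtain ⟨m, rfl⟩ : ∃ m, n = m + 1 := Nat.exists_eq_succ_of_ne_zero (NeZero.ne n)
  obtain ⟨R, hR0, hR⟩ : ∃ R : ℝ, 0 < R ∧ ∀ y ∈ K, ‖y‖ < R := by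
    obtain ⟨R, hR0, hR⟩ := hK.isBounded.subset_ball_lt 0 (0 : Mod (m + 1))
    exact ⟨R, hR0, fun y hy => by simpa using hR hy⟩
  set e := PiLp.continuousLinearEquiv 2 ℝ (fun _ : Fin (m + 1) => ℝ) with he
  set a : Fin (m + 1) → ℝ := fun i => if i = 0 then 0 else -R with ha
  set b : Fin (m + 1) → ℝ := fun _ => R with hb'
  have hale : ∀ i, a i ≤ 0 := fun i => by
    simp only [ha]; split_ifs <;> linarith
  have hab : a ≤ b := fun i => (hale i).trans hR0.le
  have ha0 : a 0 = 0 := by simp [ha]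
  have hnotK : ∀ x : Fin (m + 1) → ℝ, ∀ i, R ≤ |x i| → e.symm x ∉ K := by
    intro x i hi hx
    have h1 := hR _ hx
    have h2 := abs_coord_le_norm (e.symm x) i
    have h3 : (e.symm x) i = x i := rfl
    rw [h3] at h2
    linarith
  have hmaps : MapsTo e.symm (Icc a b) {y : Mod (m + 1) | 0 ≤ y 0} := by
    intro x hx
    have := hx.1 0
    rw [ha0] at this
    exact this
  have hcont : ∀ {f : Mod (m + 1) → ℝ}, ContinuousOn f {y | 0 ≤ y 0} →
      ContinuousOn (fun x => f (e.symm x)) (Icc a b) := fun hf =>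
    hf.comp e.symm.continuous.continuousOn hmaps
  have hint : IntegrableOn (fun x => D (e.symm x)) (Icc a b) :=
    (hcont hDc).integrableOn_compact isCompact_Icc
  have hpos : ∀ x ∈ pi univ fun i => Ioo (a i) (b i), 0 < (e.symm x) 0 := by
    intro x hx
    have := (hx 0 (mem_univ _)).1
    rw [ha0] at this
    exact this
  have hdiv : ∀ x ∈ pi univ fun i => Ioo (a i) (b i),
      ∑ i, ((Y' i (e.symm x)).comp (e.symm : (Fin (m + 1) → ℝ) →L[ℝ] Mod (m + 1)))
        (Pi.single i 1) = D (e.symm x) := by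
    intro x hx
    rw [← hD _ (hpos x hx)]
    rfl
  have hae : (pi univ fun i => Ioo (a i) (b i)) =ᵐ[volume] Icc a b :=
    Measure.univ_pi_Ioo_ae_eq_Icc
  have hmeas : MeasurableSet (pi univ fun i => Ioo (a i) (b i)) :=
    MeasurableSet.univ_pi fun i => measurableSet_Ioo
  have hint' : IntegrableOn (fun x => ∑ i, ((Y' i (e.symm x)).comp
      (e.symm : (Fin (m + 1) → ℝ) →L[ℝ] Mod (m + 1))) (Pi.single i 1)) (Icc a b) := by
    refine IntegrableOn.congr_set_ae ?_ hae.symm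
    exact (hint.congr_set_ae hae).congr_fun (fun x hx => (hdiv x hx).symm) hmeas
  have key := integral_divergence_of_hasFDerivAt_off_countable' a b hab
    (fun i x => Y i (e.symm x))
    (fun i x => (Y' i (e.symm x)).comp (e.symm : (Fin (m + 1) → ℝ) →L[ℝ] Mod (m + 1)))
    ∅ countable_empty (fun i => hcont (hYc i))
    (fun x hx i => (hd _ (hpos x hx.1) i).comp x e.symm.hasFDerivAt) hint'
  have hfaces : ∀ i : Fin (m + 1), ∀ x : Fin m → ℝ,
      Y i (e.symm (i.insertNth (b i) x)) = 0 ∧ Y i (e.symm (i.insertNth (a i) x)) = 0 := by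
    intro i x
    refine ⟨hY0 i _ (hnotK _ i ?_), ?_⟩
    · simp [hb', abs_of_pos hR0]
    · by_cases hi : i = 0
      · subst hi
        refine hb _ ?_
        change Fin.insertNth (α := fun _ => ℝ) 0 (a 0) x 0 = 0
        rw [Fin.insertNth_apply_same, ha0]
      · refine hY0 i _ (hnotK _ i ?_)
        simp [ha, hi, abs_of_pos hR0]
  rw [Finset.sum_eq_zero fun i _ => by simp [hfaces i]] at key
  have h1 : ∫ x in Icc a b, D (e.symm x) = 0 := by
    rw [← key, ← setIntegral_congr_set hae, ← setIntegral_congr_set hae]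
    exact setIntegral_congr_fun hmeas fun x hx => (hdiv x hx).symm
  have h2 : ∫ x in e.symm ⁻¹' {y : Mod (m + 1) | 0 ≤ y 0}, D (e.symm x) = 0 := by
    refine Eq.trans ?_ h1
    refine setIntegral_eq_of_subset_of_forall_sdiff_eq_zero ?_ hmaps ?_
    · exact e.symm.continuous.measurable
        (isClosed_le continuous_const (by fun_prop)).measurableSet
    · rintro x ⟨hx1, hx2⟩
      have hx1 : 0 ≤ x 0 := hx1
      refine hD0 _ ?_
      have : ∃ i, R ≤ |x i| := by
        by_contra! hcon
        refine hx2 ⟨fun i => ?_, fun i => (le_abs_self _).trans (hcon i).le⟩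
        by_cases hi : i = 0
        · subst hi; rw [ha0]; exact hx1
        · simp only [ha, hi, if_false]
          linarith [neg_abs_le (x i), hcon i]
      obtain ⟨i, hi⟩ := this
      exact hnotK x i hi
  have hmp : MeasurePreserving e.symm volume volume := PiLp.volume_preserving_toLp _
  exact (hmp.setIntegral_preimage_emb e.symm.toHomeomorph.measurableEmbedding D _).symm.trans h2

variable {M : Type*} [TopologicalSpace M] [ChartedSpace (EuclideanHalfSpace n) M]

/-- Extension by zero of a function on a chart domain which vanishes off a compact subset. -/
theorem continuousOn_indicator_chartTarget {a : M} {K : Set (Mod n)} (hK : IsCompact K)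
    {f : Mod n → ℝ} (hf : ContinuousOn f (chartTarget n a))
    (h0 : ∀ y ∈ chartTarget n a, y ∉ K → f y = 0) (hKa : K ⊆ chartTarget n a) :
    ContinuousOn ((chartTarget n a).indicator f) {y | 0 ≤ y 0} := by
  intro y hy
  by_cases hya : y ∈ chartTarget n a
  · obtain ⟨U, hU, hUa⟩ := chartTarget_eq_inter (n := n) a
    have h1 : chartTarget n a ∈ 𝓝[{y : Mod n | 0 ≤ y 0}] y := by
      rw [hUa, inter_comm]
      refine inter_mem_nhdsWithin _ (hU.mem_nhds ?_)
      rw [hUa] at hya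
      exact hya.1
    have h2 : ContinuousWithinAt ((chartTarget n a).indicator f) (chartTarget n a) y :=
      (hf y hya).congr (fun z hz => indicator_of_mem hz f) (indicator_of_mem hya f)
    exact h2.mono_of_mem_nhdsWithin h1
  · have h1 : Kᶜ ∈ 𝓝 y := hK.isClosed.isOpen_compl.mem_nhds fun h => hya (hKa h)
    have h2 : (chartTarget n a).indicator f =ᶠ[𝓝 y] fun _ => 0 := by
      filter_upwards [h1] with z hz
      by_cases hza : z ∈ chartTarget n a
      · rw [indicator_of_mem hza, h0 z hza hz]
      · exact indicator_of_notMem hza f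
    exact (continuousAt_const.congr h2.symm).continuousWithinAt

/-- The divergence theorem in a chart of a manifold with boundary. -/
theorem integral_divergence_chart {a : M} {K : Set (Mod n)} (hK : IsCompact K)
    (hKa : K ⊆ chartTarget n a)
    {Y : Fin n → Mod n → ℝ} {D : Mod n → ℝ}
    (hYc : ∀ i, ContinuousOn (Y i) (chartTarget n a))
    (hY0 : ∀ i, ∀ y ∈ chartTarget n a, y ∉ K → Y i y = 0)
    (hb : ∀ y ∈ chartTarget n a, y 0 = 0 → Y 0 y = 0)
    (hd : ∀ y ∈ chartTarget n a, 0 < y 0 → ∃ Y' : Fin n → Mod n →L[ℝ] ℝ,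
      (∀ i, HasFDerivAt (Y i) (Y' i) y) ∧ ∑ i, Y' i (stdVec i) = D y)
    (hDc : ContinuousOn D (chartTarget n a)) (hD0 : ∀ y ∈ chartTarget n a, y ∉ K → D y = 0) :
    ∫ y in chartTarget n a, D y = 0 := by
  set T := chartTarget n a with hT
  have hex : ∀ y : Mod n, ∃ Y' : Fin n → Mod n →L[ℝ] ℝ, 0 < y 0 →
      (∀ i, HasFDerivAt (T.indicator (Y i)) (Y' i) y) ∧
        ∑ i, Y' i (stdVec i) = T.indicator D y := by
    intro y
    by_cases hy0 : 0 < y 0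
    swap
    · exact ⟨0, fun h => absurd h hy0⟩
    by_cases hy : y ∈ T
    · obtain ⟨Y', h1, h2⟩ := hd y hy hy0
      refine ⟨Y', fun _ => ⟨fun i => (h1 i).congr_of_eventuallyEq ?_, ?_⟩⟩
      · filter_upwards [chartTarget_mem_nhds hy hy0] with z hz using indicator_of_mem hz _
      · rw [h2, indicator_of_mem hy]
    · refine ⟨0, fun _ => ⟨fun i => ?_, ?_⟩⟩
      · have h1 : Kᶜ ∈ 𝓝 y := hK.isClosed.isOpen_compl.mem_nhds fun h => hy (hKa h)
        refine (hasFDerivAt_const (0 : ℝ) y).congr_of_eventuallyEq ?_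
        filter_upwards [h1] with z hz
        by_cases hza : z ∈ T
        · rw [indicator_of_mem hza, hY0 i z hza hz]
        · exact indicator_of_notMem hza _
      · rw [indicator_of_notMem hy]; simp
  choose Y' hY' using hex
  have h1 := integral_divergence_halfSpace (D := T.indicator D) hK
    (fun i => continuousOn_indicator_chartTarget hK (hYc i) (hY0 i) hKa)
    (fun i y hy => by
      by_cases h : y ∈ T
      · rw [indicator_of_mem h, hY0 i y h hy]
      · exact indicator_of_notMem h _)
    (fun y hy => by
      by_cases h : y ∈ T
      · rw [indicator_of_mem h, hb y h hy]
      · exact indicator_of_notMem h _)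
    (Y' := fun i y => Y' y i)
    (fun y hy i => (hY' y hy).1 i) (fun y hy => (hY' y hy).2)
    (continuousOn_indicator_chartTarget hK hDc hD0 hKa)
    (fun y hy => by
      by_cases h : y ∈ T
      · rw [indicator_of_mem h, hD0 y h hy]
      · exact indicator_of_notMem h _)
  rw [setIntegral_indicator (measurableSet_chartTarget a)] at h1
  have h2 : {y : Mod n | 0 ≤ y 0} ∩ chartTarget n a = T :=
    inter_eq_self_of_subset_right fun y hy => nonneg_of_mem_chartTarget hy
  rwa [h2] at h1

end Divergence

/-! ### Integration over the hypersurface -/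

section Integration

open Set Filter Topology MeasureTheory

set_option linter.unusedSectionVars false

variable {n : ℕ} [NeZero n] {M : Type*} [TopologicalSpace M] [ChartedSpace (EuclideanHalfSpace n) M]
  [IsManifold (𝓡∂ n) ∞ M] {X ν : M → Amb n} {θ : ℝ}

/-- The density transforms by the Jacobian determinant of the coordinate change. -/
theorem density_transition (hX : IsCapillary X ν θ) {a b : M} {y : Mod n}
    (hy : y ∈ chartTarget n a)
    (hb : (extChartAt (𝓡∂ n) a).symm y ∈ (extChartAt (𝓡∂ n) b).source) :
    density X ν a y = (transitionDeriv a b y).det * density X ν b (transition a b y) := by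
  have h1 := locDeriv_eq_comp hy hb (differentiableWithinAt_loc (contMDiff_hypX hX)
    (transition_mem hb))
  have h2 : loc (hypN X ν) b (transition a b y) = loc (hypN X ν) a y := by
    simp only [loc]
    rw [chart_symm_transition hb]
  rw [density, density, h1, h2]
  exact wedge_comp_det _ (locDeriv (hypX X) b (transition a b y)).toLinearMap
    (transitionDeriv a b y).toLinearMap

/-- The integral over the chart domain at `a` with respect to the measure with density
`|density|`. -/
def chartIntegral (X ν : M → Amb n) (a : M) (f : M → ℝ) : ℝ :=
  ∫ y in chartTarget n a, f ((extChartAt (𝓡∂ n) a).symm y) * |density X ν a y|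

/-- The part of the chart domain at `a` which is covered by the chart at `b`. -/
def overlap (a b : M) : Set (Mod n) :=
  {y ∈ chartTarget n a | (extChartAt (𝓡∂ n) a).symm y ∈ (extChartAt (𝓡∂ n) b).source}

theorem measurableSet_overlap (a b : M) : MeasurableSet (overlap (n := n) a b) := by
  obtain ⟨U, hU, h⟩ := continuousOn_iff'.1 (continuousOn_chart_symm (n := n) a) _
    (isOpen_extChartAt_source (I := 𝓡∂ n) b)
  have h1 : overlap a b = U ∩ chartTarget n a := by
    rw [← h, inter_comm]; rfl
  rw [h1]
  exact hU.measurableSet.inter (measurableSet_chartTarget a)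

theorem transition_image_overlap (a b : M) :
    transition a b '' overlap (n := n) a b = overlap b a := by
  ext z
  constructor
  · rintro ⟨y, ⟨hy, hb⟩, rfl⟩
    refine ⟨transition_mem hb, ?_⟩
    rw [chart_symm_transition hb]
    exact chart_symm_mem_source hy
  · rintro ⟨hz, ha⟩
    refine ⟨transition b a z, ⟨transition_mem ha, ?_⟩, transition_transition hz ha⟩
    rw [chart_symm_transition ha]
    exact chart_symm_mem_source hz

theorem chartIntegral_eq_overlap {a b : M} {f : M → ℝ}
    (hb : ∀ p ∉ (extChartAt (𝓡∂ n) b).source, f p = 0) :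
    chartIntegral X ν a f =
      ∫ y in overlap a b, f ((extChartAt (𝓡∂ n) a).symm y) * |density X ν a y| := by
  refine setIntegral_eq_of_subset_of_forall_sdiff_eq_zero (measurableSet_chartTarget a)
    (fun y hy => hy.1) ?_
  rintro y ⟨hy1, hy2⟩
  rw [hb _ fun h => hy2 ⟨hy1, h⟩, zero_mul]

/-- The integral of a function supported in two charts does not depend on the chart. -/
theorem chartIntegral_eq (hX : IsCapillary X ν θ) {a b : M} {f : M → ℝ}
    (ha : ∀ p ∉ (extChartAt (𝓡∂ n) a).source, f p = 0)
    (hb : ∀ p ∉ (extChartAt (𝓡∂ n) b).source, f p = 0) :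
    chartIntegral X ν a f = chartIntegral X ν b f := by
  rw [chartIntegral_eq_overlap hb, chartIntegral_eq_overlap ha, ← transition_image_overlap a b,
    integral_image_eq_integral_abs_det_fderiv_smul volume (measurableSet_overlap a b)
      (f' := transitionDeriv a b)
      (fun y hy => (hasFDerivWithinAt_transition hy.1 hy.2).mono fun z hz => hz.1)]
  · refine setIntegral_congr_fun (measurableSet_overlap a b) fun y hy => ?_
    simp only [smul_eq_mul]
    rw [chart_symm_transition hy.2, density_transition hX hy.1 hy.2, abs_mul]
    ring
  · intro y hy z hz h
    rw [← transition_transition hy.1 hy.2, h, transition_transition hz.1 hz.2]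

theorem chart_image_tsupport [CompactSpace M] {a : M} {ρ : M → ℝ}
    (hρ : tsupport ρ ⊆ (extChartAt (𝓡∂ n) a).source) :
    IsCompact (extChartAt (𝓡∂ n) a '' tsupport ρ) ∧
      extChartAt (𝓡∂ n) a '' tsupport ρ ⊆ chartTarget n a := by
  refine ⟨(isClosed_tsupport ρ).isCompact.image_of_continuousOn
    ((continuousOn_extChartAt a).mono hρ), ?_⟩
  rintro _ ⟨p, hp, rfl⟩
  exact (extChartAt (𝓡∂ n) a).map_source (hρ hp)

theorem notMem_tsupport_of_chart {a : M} {ρ : M → ℝ} {y : Mod n} (hy : y ∈ chartTarget n a)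
    (h : y ∉ extChartAt (𝓡∂ n) a '' tsupport ρ) :
    (extChartAt (𝓡∂ n) a).symm y ∉ tsupport ρ := fun h1 =>
  h ⟨_, h1, (extChartAt (𝓡∂ n) a).right_inv hy⟩

theorem continuousOn_chart_integrand (hX : IsCapillary X ν θ) {f : M → ℝ} (hf : Continuous f)
    (a : M) : ContinuousOn (fun y => f ((extChartAt (𝓡∂ n) a).symm y) * |density X ν a y|)
      (chartTarget n a) :=
  (continuousOn_loc hf a).mul (continuousOn_density hX a).abs

theorem integrableOn_chart [CompactSpace M] (hX : IsCapillary X ν θ) {a : M} {ρ : M → ℝ}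
    (hρ : tsupport ρ ⊆ (extChartAt (𝓡∂ n) a).source) {f : M → ℝ} (hf : Continuous f)
    (h0 : ∀ p ∉ tsupport ρ, f p = 0) :
    IntegrableOn (fun y => f ((extChartAt (𝓡∂ n) a).symm y) * |density X ν a y|)
      (chartTarget n a) := by
  obtain ⟨hK, hKa⟩ := chart_image_tsupport hρ
  refine IntegrableOn.of_forall_sdiff_eq_zero
    (((continuousOn_chart_integrand hX hf a).mono hKa).integrableOn_compact hK)
    (measurableSet_chartTarget a) ?_
  rintro y ⟨hy1, hy2⟩
  rw [h0 _ (notMem_tsupport_of_chart hy1 hy2), zero_mul]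

/-- A finite smooth partition of unity on a compact manifold, subordinate to chart domains. The
index of a function is the centre of its chart. -/
structure ChartPartition (n : ℕ) [NeZero n] (M : Type*) [TopologicalSpace M]
    [ChartedSpace (EuclideanHalfSpace n) M] where
  /-- The centres of the charts. -/
  centers : Finset M
  /-- The functions of the partition. -/
  fn : M → M → ℝ
  smooth : ∀ a, ContMDiff (𝓡∂ n) 𝓘(ℝ) ∞ (fn a)
  nonneg : ∀ a p, 0 ≤ fn a p
  subordinate : ∀ a, tsupport (fn a) ⊆ (extChartAt (𝓡∂ n) a).source
  sum_eq_one : ∀ p, ∑ a ∈ centers, fn a p = 1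

theorem exists_chartPartition [CompactSpace M] [T2Space M] : Nonempty (ChartPartition n M) := by
  obtain ⟨f, hf⟩ := SmoothPartitionOfUnity.exists_isSubordinate_chartAt_source (𝓡∂ n) M
  have hfin := f.locallyFinite.finite_nonempty_of_compact
  refine ⟨⟨hfin.toFinset, fun a => f a, fun a => (f a).contMDiff, fun a p => f.nonneg a p,
    fun a => ?_, fun p => ?_⟩⟩
  · rw [extChartAt_source]
    exact hf a
  · rw [← f.sum_eq_one (mem_univ p), finsum_eq_sum_of_support_subset]
    intro a ha
    simp only [Finite.coe_toFinset, mem_ofPred_eq]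
    exact ⟨p, ha⟩

/-- The integral over the hypersurface with respect to the measure with density `|density|` in each
chart. -/
def ChartPartition.integral (P : ChartPartition n M) (X ν : M → Amb n) (f : M → ℝ) : ℝ :=
  ∑ a ∈ P.centers, chartIntegral X ν a fun p => P.fn a p * f p

theorem ChartPartition.fn_eq_zero (P : ChartPartition n M) {a p : M}
    (h : p ∉ (extChartAt (𝓡∂ n) a).source) : P.fn a p = 0 :=
  image_eq_zero_of_notMem_tsupport fun h1 => h (P.subordinate a h1)

theorem ChartPartition.integrableOn [CompactSpace M] (P : ChartPartition n M)
    (hX : IsCapillary X ν θ) (a : M) {f : M → ℝ} (hf : Continuous f) :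
    IntegrableOn (fun y => P.fn a ((extChartAt (𝓡∂ n) a).symm y) *
      f ((extChartAt (𝓡∂ n) a).symm y) * |density X ν a y|) (chartTarget n a) :=
  integrableOn_chart hX (P.subordinate a) (f := fun p => P.fn a p * f p)
    ((P.smooth a).continuous.mul hf)
    fun p hp => by rw [image_eq_zero_of_notMem_tsupport hp, zero_mul]

theorem ChartPartition.integral_add [CompactSpace M] (P : ChartPartition n M)
    (hX : IsCapillary X ν θ) {f g : M → ℝ} (hf : Continuous f) (hg : Continuous g) :
    P.integral X ν (fun p => f p + g p) = P.integral X ν f + P.integral X ν g := by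
  simp only [ChartPartition.integral, ← Finset.sum_add_distrib, chartIntegral]
  refine Finset.sum_congr rfl fun a _ => ?_
  rw [← MeasureTheory.integral_add (P.integrableOn hX a hf) (P.integrableOn hX a hg)]
  congr 1
  funext y
  ring

theorem ChartPartition.integral_const_mul (P : ChartPartition n M) (c : ℝ) (f : M → ℝ) :
    P.integral X ν (fun p => c * f p) = c * P.integral X ν f := by
  simp only [ChartPartition.integral, Finset.mul_sum, chartIntegral]
  refine Finset.sum_congr rfl fun a _ => ?_
  rw [← MeasureTheory.integral_const_mul]
  congr 1
  funext y
  ring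

theorem ChartPartition.integral_sum [CompactSpace M] (P : ChartPartition n M)
    (hX : IsCapillary X ν θ) {ι : Type*} (s : Finset ι) {f : ι → M → ℝ}
    (hf : ∀ i ∈ s, Continuous (f i)) :
    P.integral X ν (fun p => ∑ i ∈ s, f i p) = ∑ i ∈ s, P.integral X ν (f i) := by
  classical
  induction s using Finset.induction_on with
  | empty => simp [ChartPartition.integral, chartIntegral]
  | insert i s hi ih =>
    simp only [Finset.sum_insert hi]
    rw [P.integral_add hX (hf i (Finset.mem_insert_self i s)),
      ih fun j hj => hf j (Finset.mem_insert_of_mem hj)]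
    exact continuous_finsetSum s fun j hj => hf j (Finset.mem_insert_of_mem hj)

/-- A function supported in a chart domain is integrated in that chart. -/
theorem ChartPartition.integral_eq_chartIntegral [CompactSpace M] (P : ChartPartition n M)
    (hX : IsCapillary X ν θ) {a : M} {ρ f : M → ℝ}
    (hρ : tsupport ρ ⊆ (extChartAt (𝓡∂ n) a).source) (hf : Continuous f)
    (h0 : ∀ p ∉ tsupport ρ, f p = 0) : P.integral X ν f = chartIntegral X ν a f := by
  have h1 : ∀ b ∈ P.centers, chartIntegral X ν b (fun p => P.fn b p * f p) =
      chartIntegral X ν a (fun p => P.fn b p * f p) := fun b _ =>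
    chartIntegral_eq hX (fun p hp => by rw [P.fn_eq_zero hp, zero_mul])
      fun p hp => by rw [h0 p fun h => hp (hρ h), mul_zero]
  rw [ChartPartition.integral, Finset.sum_congr rfl h1]
  simp only [chartIntegral]
  rw [← MeasureTheory.integral_finsetSum]
  · congr 1
    funext y
    rw [← Finset.sum_mul, ← Finset.sum_mul, P.sum_eq_one, one_mul]
  · exact fun b _ => integrableOn_chart hX hρ (f := fun p => P.fn b p * f p)
      ((P.smooth b).continuous.mul hf) fun p hp => by rw [h0 p hp, mul_zero]

/-- A nonnegative continuous function with vanishing integral vanishes. -/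
theorem ChartPartition.eq_zero_of_integral_eq_zero [CompactSpace M] (P : ChartPartition n M)
    (hX : IsCapillary X ν θ) {f : M → ℝ} (hf : Continuous f) (h0 : ∀ p, 0 ≤ f p)
    (hint : P.integral X ν f = 0) (p : M) : f p = 0 := by
  have hnn : ∀ a y, 0 ≤ P.fn a ((extChartAt (𝓡∂ n) a).symm y) *
      f ((extChartAt (𝓡∂ n) a).symm y) * |density X ν a y| := fun a y =>
    mul_nonneg (mul_nonneg (P.nonneg a _) (h0 _)) (abs_nonneg _)
  have h1 : ∀ a ∈ P.centers, chartIntegral X ν a (fun p => P.fn a p * f p) = 0 :=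
    (Finset.sum_eq_zero_iff_of_nonneg fun a _ => integral_nonneg (hnn a)).1 hint
  have h2 : ∀ a ∈ P.centers, P.fn a p * f p = 0 := by
    intro a ha
    by_cases hp : p ∈ (extChartAt (𝓡∂ n) a).source
    swap
    · rw [P.fn_eq_zero hp, zero_mul]
    have h3 := (integral_eq_zero_iff_of_nonneg (hnn a) (P.integrableOn hX a hf)).1 (h1 a ha)
    have h4 := Measure.eqOn_of_ae_eq h3
      (continuousOn_chart_integrand hX (f := fun p => P.fn a p * f p)
        ((P.smooth a).continuous.mul hf) a) continuousOn_const
      (chartTarget_subset_closure_interior a)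
    have h5 := h4 ((extChartAt (𝓡∂ n) a).map_source hp)
    simp only [(extChartAt (𝓡∂ n) a).left_inv hp] at h5
    refine (mul_eq_zero.1 h5).resolve_right ?_
    exact abs_ne_zero.2 (density_ne_zero hX ((extChartAt (𝓡∂ n) a).map_source hp))
  have h3 := Finset.sum_eq_zero h2
  rwa [← Finset.sum_mul, P.sum_eq_one, one_mul] at h3

end Integration

/-! ### Minkowski formulae -/

section Minkowski

open Set Filter Topology MeasureTheory

set_option linter.unusedSectionVars false

variable {n : ℕ} [NeZero n] {M : Type*} [TopologicalSpace M] [ChartedSpace (EuclideanHalfSpace n) M]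
  [IsManifold (𝓡∂ n) ∞ M] {X ν : M → Amb n} {θ : ℝ}

theorem wedge_update_smul (f : Amb n) (v : Fin n → Amb n) (i : Fin n) (c : ℝ) (b : Amb n) :
    wedge f (Function.update v i (c • b)) = c * wedge f (Function.update v i b) :=
  ((volAlt n).curryLeft f).map_update_smul v i c b

/-- The gradient of `ρ` paired with the vector field `detField`. -/
def gradSum (F w Φ : M → Amb n) (ρ : M → ℝ) (a : M) (y : Mod n) : ℝ :=
  ∑ i, locDeriv ρ a y (stdVec i) * detField (loc F a) (loc w a) (locDeriv Φ a) i y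

theorem hasDerivAt_gradSum (F w Φ : M → Amb n) (ρ : M → ℝ) (a : M) (y : Mod n) :
    HasDerivAt (fun s : ℝ => wedge (loc F a y) fun i =>
      (locDeriv Φ a y + s • (locDeriv ρ a y).smulRight (loc w a y) : Mod n →L[ℝ] Amb n)
        (stdVec i)) (gradSum F w Φ ρ a y) 0 := by
  refine (hasDerivAt_wedge_pencil (loc F a y) (fun i => locDeriv Φ a y (stdVec i))
    (fun i => locDeriv ρ a y (stdVec i) • loc w a y)).congr_deriv ?_
  simp only [wedge_update_smul]
  rfl

/-- As a derivative of determinants of coordinate vectors, `gradSum` transforms like `density`. -/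
theorem gradSum_transition {F w Φ : M → Amb n} {ρ : M → ℝ}
    (hΦ : ContMDiff (𝓡∂ n) 𝓘(ℝ, Amb n) ∞ Φ) (hρ : ContMDiff (𝓡∂ n) 𝓘(ℝ) ∞ ρ)
    {a b : M} {y : Mod n} (hy : y ∈ chartTarget n a)
    (hb : (extChartAt (𝓡∂ n) a).symm y ∈ (extChartAt (𝓡∂ n) b).source) :
    gradSum F w Φ ρ a y = (transitionDeriv a b y).det * gradSum F w Φ ρ b (transition a b y) := by
  have h1 := locDeriv_eq_comp hy hb (differentiableWithinAt_loc hΦ (transition_mem hb))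
  have h2 := locDeriv_eq_comp hy hb (differentiableWithinAt_loc hρ (transition_mem hb))
  have h3 : ∀ f : M → Amb n, loc f b (transition a b y) = loc f a y := fun f => by
    simp only [loc]
    rw [chart_symm_transition hb]
  refine (hasDerivAt_gradSum F w Φ ρ a y).unique ?_
  refine ((hasDerivAt_gradSum F w Φ ρ b (transition a b y)).const_mul
    (transitionDeriv a b y).det).congr_of_eventuallyEq (Eventually.of_forall fun s => ?_)
  simp only [h3, h1, h2]
  exact wedge_comp_det _ (locDeriv Φ b (transition a b y) +
    s • (locDeriv ρ b (transition a b y)).smulRight (loc w a y) :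
      Mod n →L[ℝ] Amb n).toLinearMap (transitionDeriv a b y).toLinearMap

/-- The quotient of `gradSum` by `density`. Both transform by the Jacobian determinant, so that this
is a function on the hypersurface. -/
def gradRatio (X ν F w Φ : M → Amb n) (ρ : M → ℝ) (p : M) : ℝ :=
  gradSum F w Φ ρ p (extChartAt (𝓡∂ n) p p) / density X ν p (extChartAt (𝓡∂ n) p p)

theorem gradSum_eq (hX : IsCapillary X ν θ) {F w Φ : M → Amb n} {ρ : M → ℝ}
    (hΦ : ContMDiff (𝓡∂ n) 𝓘(ℝ, Amb n) ∞ Φ) (hρ : ContMDiff (𝓡∂ n) 𝓘(ℝ) ∞ ρ)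
    {a : M} {y : Mod n} (hy : y ∈ chartTarget n a) :
    gradSum F w Φ ρ a y =
      gradRatio X ν F w Φ ρ ((extChartAt (𝓡∂ n) a).symm y) * density X ν a y := by
  set p := (extChartAt (𝓡∂ n) a).symm y with hp
  have hb : (extChartAt (𝓡∂ n) a).symm y ∈ (extChartAt (𝓡∂ n) p).source :=
    mem_extChartAt_source p
  rw [gradSum_transition hΦ hρ hy hb, density_transition hX hy hb]
  have h1 : transition a p y = extChartAt (𝓡∂ n) p p := rfl
  have h2 := density_ne_zero hX (transition_mem hb)
  rw [h1] at h2 ⊢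
  rw [gradRatio]
  field_simp

theorem continuousOn_gradSum {F w Φ : M → Amb n} {ρ : M → ℝ}
    (hF : ContMDiff (𝓡∂ n) 𝓘(ℝ, Amb n) ∞ F) (hw : ContMDiff (𝓡∂ n) 𝓘(ℝ, Amb n) ∞ w)
    (hΦ : ContMDiff (𝓡∂ n) 𝓘(ℝ, Amb n) ∞ Φ) (hρ : ContMDiff (𝓡∂ n) 𝓘(ℝ) ∞ ρ) (a : M) :
    ContinuousOn (gradSum F w Φ ρ a) (chartTarget n a) ∧
      ∀ i, ContinuousOn (detField (loc F a) (loc w a) (locDeriv Φ a) i) (chartTarget n a) := by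
  have h1 : ∀ i, ContinuousOn (detField (loc F a) (loc w a) (locDeriv Φ a) i)
      (chartTarget n a) := by
    intro i
    have h2 := continuousOn_wedge (f := loc F a) (s := chartTarget n a)
      (v := fun j y => Function.update (fun j => locDeriv Φ a y (stdVec j)) i (loc w a y) j)
      (contDiffOn_loc hF a).continuousOn (fun j => by
        by_cases hj : j = i
        · subst hj
          simpa using (contDiffOn_loc hw a).continuousOn
        · simpa [Function.update_of_ne hj] using continuousOn_locDeriv hΦ a (stdVec j))
    exact h2
  exact ⟨continuousOn_finsetSum _ fun i _ => (continuousOn_locDeriv hρ a _).mul (h1 i), h1⟩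

theorem continuous_gradRatio (hX : IsCapillary X ν θ) {F w Φ : M → Amb n} {ρ : M → ℝ}
    (hF : ContMDiff (𝓡∂ n) 𝓘(ℝ, Amb n) ∞ F) (hw : ContMDiff (𝓡∂ n) 𝓘(ℝ, Amb n) ∞ w)
    (hΦ : ContMDiff (𝓡∂ n) 𝓘(ℝ, Amb n) ∞ Φ) (hρ : ContMDiff (𝓡∂ n) 𝓘(ℝ) ∞ ρ) :
    Continuous (gradRatio X ν F w Φ ρ) := by
  refine continuous_of_continuousOn_chart (n := n) fun a => ?_
  refine ((continuousOn_gradSum hF hw hΦ hρ a).1.div (continuousOn_density hX a)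
    fun y hy => density_ne_zero hX hy).congr fun y hy => ?_
  rw [Pi.div_apply, gradSum_eq hX hΦ hρ hy, mul_div_assoc,
    div_self (density_ne_zero hX hy), mul_one]

theorem gradRatio_eq_zero {F w Φ : M → Amb n} {ρ : M → ℝ} {p : M} (hp : p ∉ tsupport ρ) :
    gradRatio X ν F w Φ ρ p = 0 := by
  have h1 : ∀ᶠ q in 𝓝 p, ρ q = 0 := by
    filter_upwards [(isClosed_tsupport ρ).isOpen_compl.mem_nhds hp] with q hq
      using image_eq_zero_of_notMem_tsupport hq
  have hy : extChartAt (𝓡∂ n) p p ∈ chartTarget n p := mem_extChartAt_target p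
  have h2 : ContinuousWithinAt (extChartAt (𝓡∂ n) p).symm (chartTarget n p)
      (extChartAt (𝓡∂ n) p p) := continuousOn_chart_symm p _ hy
  have h3 : (extChartAt (𝓡∂ n) p).symm (extChartAt (𝓡∂ n) p p) = p := extChartAt_to_inv p
  have h4 : loc ρ p =ᶠ[𝓝[chartTarget n p] (extChartAt (𝓡∂ n) p p)] fun _ => 0 := by
    refine h2.eventually (p := fun q => ρ q = 0) ?_
    rwa [h3]
  have h5 : locDeriv ρ p (extChartAt (𝓡∂ n) p p) = 0 := by
    rw [locDeriv, h4.fderivWithin_eq (by simp only [loc]; rw [h3]; exact h1.self_of_nhds)]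
    simp
  simp only [gradRatio, gradSum, h5, zero_apply, zero_mul,
    Finset.sum_const_zero, zero_div]

theorem sum_gradRatio {F w Φ : M → Amb n} (P : ChartPartition n M) (p : M) :
    ∑ a ∈ P.centers, gradRatio X ν F w Φ (P.fn a) p = 0 := by
  have hy : extChartAt (𝓡∂ n) p p ∈ chartTarget n p := mem_extChartAt_target p
  have h1 : HasFDerivWithinAt (fun z => ∑ a ∈ P.centers, loc (P.fn a) p z)
      (∑ a ∈ P.centers, locDeriv (P.fn a) p (extChartAt (𝓡∂ n) p p)) (chartTarget n p)
      (extChartAt (𝓡∂ n) p p) :=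
    HasFDerivWithinAt.fun_sum fun a _ => hasFDerivWithinAt_loc (P.smooth a) hy
  have h2 : (fun z : Mod n => ∑ a ∈ P.centers, loc (P.fn a) p z) = fun _ => 1 := by
    funext z
    exact P.sum_eq_one _
  rw [h2] at h1
  have h3 := (uniqueDiffOn_chartTarget p _ hy).eq h1
    (hasFDerivWithinAt_const (1 : ℝ) (extChartAt (𝓡∂ n) p p) (chartTarget n p))
  simp only [gradRatio, gradSum]
  rw [← Finset.sum_div, Finset.sum_comm]
  simp only [← Finset.sum_mul]
  refine div_eq_zero_iff.2 (Or.inl (Finset.sum_eq_zero fun i _ => ?_))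
  have h4 := congrArg (fun L : Mod n →L[ℝ] ℝ => L (stdVec i)) h3
  simp only [FunLike.coe_sum, Finset.sum_apply] at h4
  rw [h4]
  simp

/-- The coefficient of `N` when `w` is written as a multiple of `N` plus a tangent vector, all in
terms of spatial parts in the hyperboloid model. -/
def normalPart (X ν w : M → Amb n) (p : M) : ℝ := ⟪conormal X ν p, w p⟫ / ‖ν p‖

theorem continuous_normalPart (hX : IsCapillary X ν θ) {w : M → Amb n} (hw : Continuous w) :
    Continuous (normalPart X ν w) := by
  refine continuous_of_continuousOn_chart (n := n) fun a => ?_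
  have h1 : ContinuousOn (fun y => wedge (loc w a y)
      (fun i => locDeriv (hypX X) a y (stdVec i)) / density X ν a y) (chartTarget n a) :=
    (continuousOn_wedge (continuousOn_loc hw a)
      fun i => continuousOn_locDeriv (contMDiff_hypX hX) a (stdVec i)).div
      (continuousOn_density hX a) fun y hy => density_ne_zero hX hy
  refine h1.congr fun y hy => ?_
  beta_reduce
  rw [wedge_eq_density hX hy, mul_div_assoc, div_self (density_ne_zero hX hy), mul_one]
  rfl

/-- The parallel hypersurface at (signed) parameter `t`, up to scaling, in the hyperboloid model. -/
def parallel (X ν : M → Amb n) (t : ℝ) (p : M) : Amb n := hypX X p + t • hypN X ν p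

/-- The vector field `N - cos θ E`. -/
def supportField (X ν : M → Amb n) (θ : ℝ) (p : M) : Amb n :=
  hypN X ν p - Real.cos θ • lastVec n

theorem contMDiff_parallel (hX : IsCapillary X ν θ) (t : ℝ) :
    ContMDiff (𝓡∂ n) 𝓘(ℝ, Amb n) ∞ (parallel X ν t) :=
  (contMDiff_hypX hX).add
    ((contMDiff_const (c := t) : ContMDiff (𝓡∂ n) 𝓘(ℝ) ∞ fun _ : M => t).smul
      (contMDiff_hypN hX))

theorem contMDiff_supportField (hX : IsCapillary X ν θ) :
    ContMDiff (𝓡∂ n) 𝓘(ℝ, Amb n) ∞ (supportField X ν θ) :=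
  (contMDiff_hypN hX).sub contMDiff_const

theorem locDeriv_parallel (hX : IsCapillary X ν θ) (t : ℝ) {a : M} {y : Mod n}
    (hy : y ∈ chartTarget n a) :
    locDeriv (parallel X ν t) a y = locDeriv (hypX X) a y + t • locDeriv (hypN X ν) a y :=
  ((hasFDerivWithinAt_loc (contMDiff_hypX hX) hy).add
    ((hasFDerivWithinAt_loc (contMDiff_hypN hX) hy).const_smul t)).fderivWithin
    (uniqueDiffOn_chartTarget a y hy)

theorem locDeriv_supportField (hX : IsCapillary X ν θ) {a : M} {y : Mod n}
    (hy : y ∈ chartTarget n a) :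
    locDeriv (supportField X ν θ) a y = locDeriv (hypN X ν) a y :=
  ((hasFDerivWithinAt_loc (contMDiff_hypN hX) hy).sub_const _).fderivWithin
    (uniqueDiffOn_chartTarget a y hy)

/-- The integrand of the Minkowski formulae, as a polynomial in the parameter `t` of the parallel
hypersurface. -/
def minkowski (X ν : M → Amb n) (θ t : ℝ) (p : M) : ℝ :=
  -((∑ j ∈ Finset.range (n + 1), sigma X ν j p * t ^ j * ((n - j : ℕ) : ℝ)) *
      normalPart X ν (supportField X ν θ) p) +
    (∑ j ∈ Finset.range (n + 1), sigma X ν j p * (j * t ^ (j - 1))) * normalPart X ν (hypX X) p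

theorem hasFDerivAt_loc {W : Type*} [NormedAddCommGroup W] [NormedSpace ℝ W] {f : M → W}
    (hf : ContMDiff (𝓡∂ n) 𝓘(ℝ, W) ∞ f) {a : M} {y : Mod n} (hy : y ∈ chartTarget n a)
    (h0 : 0 < y 0) : HasFDerivAt (loc f a) (locDeriv f a y) y :=
  (hasFDerivWithinAt_loc hf hy).hasFDerivAt (chartTarget_mem_nhds hy h0)

/-- The divergence of the determinant field built from the parallel hypersurfaces. It consists of
two derivatives of determinants of pencils `s dX + t dN`, one in `s` and one in `t`. -/
theorem divergence_parallel (hX : IsCapillary X ν θ) (t : ℝ) {a : M} {y : Mod n}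
    (hy : y ∈ chartTarget n a) (h0 : 0 < y 0) :
    ∃ Y' : Fin n → Mod n →L[ℝ] ℝ,
      (∀ i, HasFDerivAt (detField (loc (hypX X) a) (loc (supportField X ν θ) a)
        (locDeriv (parallel X ν t) a) i) (Y' i) y) ∧
      ∑ i, Y' i (stdVec i) =
        minkowski X ν θ t ((extChartAt (𝓡∂ n) a).symm y) * density X ν a y := by
  have hF := hasFDerivAt_loc (contMDiff_hypX hX) hy h0
  have hw := hasFDerivAt_loc (contMDiff_supportField hX) hy h0
  have hΦ := hasFDerivAt_loc (contMDiff_parallel hX t) hy h0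
  have hD : HasFDerivAt (locDeriv (parallel X ν t) a)
      (fderivWithin ℝ (locDeriv (parallel X ν t) a) (chartTarget n a) y) y :=
    ((contDiffOn_locDeriv (contMDiff_parallel hX t) a).differentiableOn (by simp) y
      hy).hasFDerivWithinAt.hasFDerivAt (chartTarget_mem_nhds hy h0)
  have hsymm : IsSymmSndFDerivWithinAt ℝ (loc (parallel X ν t) a) (chartTarget n a) y :=
    (contDiffOn_loc (contMDiff_parallel hX t) a y hy).isSymmSndFDerivWithinAt
      (by
        simp only [minSmoothness_of_isRCLikeNormedField]
        exact WithTop.coe_le_coe.2 (le_top : (2 : ℕ∞) ≤ ⊤))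
      (uniqueDiffOn_chartTarget a) (chartTarget_subset_closure_interior a hy) hy
  have hsymm' : ∀ v w : Mod n,
      fderivWithin ℝ (locDeriv (parallel X ν t) a) (chartTarget n a) y v w =
        fderivWithin ℝ (locDeriv (parallel X ν t) a) (chartTarget n a) y w v :=
    fun v w => hsymm v w
  choose Y' hY1 hY2 using fun i => hasFDerivAt_detField hF hw hD i
  refine ⟨Y', hY1, ?_⟩
  simp only [hY2]
  rw [divergence_detField (f' := fun v => locDeriv (hypX X) a y v)
    (w' := fun v => locDeriv (supportField X ν θ) a y v) hsymm']
  set p := (extChartAt (𝓡∂ n) a).symm y with hp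
  have hP : ∀ i : Fin n, locDeriv (parallel X ν t) a y (stdVec i) =
      locDeriv (hypX X) a y (stdVec i) + t • locDeriv (hypN X ν) a y (stdVec i) := fun i => by
    rw [locDeriv_parallel hX t hy]; rfl
  have h1 : ∑ i, wedge (loc (supportField X ν θ) a y) (Function.update
      (fun j => locDeriv (parallel X ν t) a y (stdVec j)) i (locDeriv (hypX X) a y (stdVec i))) =
      (∑ j ∈ Finset.range (n + 1), sigma X ν j p * t ^ j * ((n - j : ℕ) : ℝ)) *
        wedge (loc (supportField X ν θ) a y) fun i => locDeriv (hypX X) a y (stdVec i) := by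
    refine (hasDerivAt_wedge_pencil _ _ fun i => locDeriv (hypX X) a y (stdVec i)).unique ?_
    have h2 : HasDerivAt (fun s : ℝ => ∑ j ∈ Finset.range (n + 1),
        sigma X ν j p * t ^ j * (1 + s) ^ (n - j))
        (∑ j ∈ Finset.range (n + 1), sigma X ν j p * t ^ j * ((n - j : ℕ) : ℝ)) 0 := by
      refine HasDerivAt.fun_sum fun j _ => HasDerivAt.const_mul _ ?_
      simpa using (((hasDerivAt_id (0 : ℝ)).const_add 1).fun_pow (n - j))
    refine (h2.mul_const _).congr_of_eventuallyEq (Eventually.of_forall fun s => ?_)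
    simp only
    rw [← wedge_pencil hX hy]
    congr 1
    funext i
    rw [hP, add_smul, one_smul]
    abel
  have h2 : ∑ i, wedge (loc (hypX X) a y) (Function.update
      (fun j => locDeriv (parallel X ν t) a y (stdVec j)) i
        (locDeriv (supportField X ν θ) a y (stdVec i))) =
      (∑ j ∈ Finset.range (n + 1), sigma X ν j p * (j * t ^ (j - 1))) *
        wedge (loc (hypX X) a y) fun i => locDeriv (hypX X) a y (stdVec i) := by
    rw [locDeriv_supportField hX hy]
    refine (hasDerivAt_wedge_pencil _ _ fun i => locDeriv (hypN X ν) a y (stdVec i)).unique ?_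
    have h2 : HasDerivAt (fun s : ℝ => ∑ j ∈ Finset.range (n + 1),
        sigma X ν j p * (t + s) ^ j * 1 ^ (n - j))
        (∑ j ∈ Finset.range (n + 1), sigma X ν j p * (j * t ^ (j - 1))) 0 := by
      refine HasDerivAt.fun_sum fun j _ => ?_
      simp only [one_pow, mul_one]
      refine HasDerivAt.const_mul _ ?_
      simpa using (((hasDerivAt_id (0 : ℝ)).const_add t).fun_pow j)
    refine (h2.mul_const _).congr_of_eventuallyEq (Eventually.of_forall fun s => ?_)
    simp only
    rw [← wedge_pencil hX hy]
    congr 1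
    funext i
    rw [hP, add_smul, one_smul]
    abel
  rw [h1, h2, wedge_eq_density hX hy, wedge_eq_density hX hy, minkowski]
  simp only [normalPart, ← hp, loc]
  ring

end Minkowski

/-! ### The weighted integral formula -/

section WeightedIntegral

open Set Filter Topology MeasureTheory

set_option linter.unusedSectionVars false

variable {n : ℕ} [NeZero n] {M : Type*} [TopologicalSpace M] [ChartedSpace (EuclideanHalfSpace n) M]
  [IsManifold (𝓡∂ n) ∞ M] {X ν : M → Amb n} {θ : ℝ}

theorem inner_hypX_lastVec (p : M) :
    ⟪lastVec n, hypX X p⟫ = conf (X p) * ⟪X p, lastVec n⟫ := by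
  rw [hypX, hypPos, inner_smul_right, real_inner_comm]

/-- The contact angle condition in the hyperboloid model. -/
theorem inner_hypN_lastVec (hX : IsCapillary X ν θ) {p : M} (hp : (𝓡∂ n).IsBoundaryPoint p) :
    ⟪lastVec n, hypN X ν p⟫ = Real.cos θ := by
  have h1 := hX.contact p hp
  have h2 := hX.boundary_zero p hp
  have h3 := one_sub_norm_sq_pos (hX.mem_ball p)
  rw [hypMetric_eq, supportNormal, inner_smul_left, inner_neg_right] at h1
  rw [hypN, hypVec_apply, inner_add_right, inner_smul_right, inner_smul_right,
    real_inner_comm (X p), h2, ← h1]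
  simp [conf]
  field_simp

theorem inner_parallel_lastVec (hX : IsCapillary X ν θ) (t : ℝ) {p : M}
    (hp : (𝓡∂ n).IsBoundaryPoint p) : ⟪lastVec n, parallel X ν t p⟫ = t * Real.cos θ := by
  rw [parallel, inner_add_right, inner_smul_right, inner_hypN_lastVec hX hp, inner_hypX_lastVec,
    hX.boundary_zero p hp, mul_zero, zero_add]

/-- Tangential derivatives of the vertical component vanish along the boundary. -/
theorem inner_locDeriv_parallel (hX : IsCapillary X ν θ) (t : ℝ) {a : M} {y : Mod n}
    (hy : y ∈ chartTarget n a) (h0 : y 0 = 0) {j : Fin n} (hj : j ≠ 0) :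
    ⟪lastVec n, locDeriv (parallel X ν t) a y (stdVec j)⟫ = 0 := by
  obtain ⟨U, hU, hUa⟩ := chartTarget_eq_inter (n := n) a
  have hc0 : ∀ s : ℝ, (y + s • stdVec j : Mod n) 0 = 0 := fun s => by
    simp [stdVec, h0, hj.symm]
  have hline : HasDerivAt (fun s : ℝ => y + s • (stdVec j : Mod n)) (stdVec j) 0 := by
    simpa using ((hasDerivAt_id (0 : ℝ)).smul_const (stdVec j : Mod n)).const_add y
  have hS : {s : ℝ | y + s • (stdVec j : Mod n) ∈ chartTarget n a} ∈ 𝓝 (0 : ℝ) := by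
    have h1 : U ∈ 𝓝 (y + (0 : ℝ) • (stdVec j : Mod n)) := by
      rw [zero_smul, add_zero]
      rw [hUa] at hy
      exact hU.mem_nhds hy.1
    filter_upwards [hline.continuousAt.preimage_mem_nhds h1] with s hs
    rw [hUa]
    exact ⟨hs, (hc0 s).ge⟩
  have h1 : HasFDerivWithinAt (loc (parallel X ν t) a) (locDeriv (parallel X ν t) a y)
      (chartTarget n a) (y + (0 : ℝ) • (stdVec j : Mod n)) := by
    rw [zero_smul, add_zero]
    exact hasFDerivWithinAt_loc (contMDiff_parallel hX t) hy
  have h2 : HasDerivAt (fun s : ℝ => loc (parallel X ν t) a (y + s • (stdVec j : Mod n)))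
      (locDeriv (parallel X ν t) a y (stdVec j)) 0 := by
    have hc := h1.comp_hasDerivWithinAt (0 : ℝ)
      (hline.hasDerivWithinAt (s := {s : ℝ | y + s • (stdVec j : Mod n) ∈ chartTarget n a}))
      fun s hs => hs
    exact hc.hasDerivAt hS
  have h3 := (hasDerivAt_const (0 : ℝ) (lastVec n)).inner ℝ h2
  have h4 : HasDerivAt (fun s : ℝ => ⟪lastVec n,
      loc (parallel X ν t) a (y + s • (stdVec j : Mod n))⟫) 0 0 := by
    refine (hasDerivAt_const (0 : ℝ) (t * Real.cos θ)).congr_of_eventuallyEq ?_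
    filter_upwards [hS] with s hs
    exact inner_parallel_lastVec hX t (isBoundaryPoint_chart_symm hs (hc0 s))
  have h5 := h3.unique h4
  simpa using h5

/-- The determinant field is tangent to the boundary: this is where the contact angle enters. -/
theorem detField_boundary (hX : IsCapillary X ν θ) (t : ℝ) {a : M} {y : Mod n}
    (hy : y ∈ chartTarget n a) (h0 : y 0 = 0) :
    detField (loc (hypX X) a) (loc (supportField X ν θ) a) (locDeriv (parallel X ν t) a) 0 y =
      0 := by
  have hp := isBoundaryPoint_chart_symm hy h0
  have hE : lastVec n ≠ 0 := fun h => by simpa [h] using norm_lastVec n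
  refine wedge_eq_zero_of_orthogonal hE ?_ fun j => ?_
  · rw [loc, inner_hypX_lastVec, hX.boundary_zero _ hp, mul_zero]
  · by_cases hj : j = 0
    · subst hj
      rw [Function.update_self, loc, supportField, inner_sub_right, inner_hypN_lastVec hX hp,
        inner_smul_right, real_inner_self_eq_norm_sq, norm_lastVec]
      ring
    · rw [Function.update_of_ne hj]
      exact inner_locDeriv_parallel hX t hy h0 hj

/-- The sign of the determinant of the normal and the coordinate vectors. -/
def orient (X ν : M → Amb n) (a : M) (y : Mod n) : ℝ := |density X ν a y| / density X ν a y

theorem orient_mul_density (hX : IsCapillary X ν θ) {a : M} {y : Mod n}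
    (hy : y ∈ chartTarget n a) : orient X ν a y * density X ν a y = |density X ν a y| :=
  div_mul_cancel₀ _ (density_ne_zero hX hy)

theorem eventually_orient_eq (hX : IsCapillary X ν θ) {a : M} {y : Mod n}
    (hy : y ∈ chartTarget n a) :
    ∀ᶠ z in 𝓝[chartTarget n a] y, orient X ν a z = orient X ν a y := by
  have h1 := continuousOn_density hX a y hy
  rcases lt_or_gt_of_ne (density_ne_zero hX hy) with h | h
  · filter_upwards [h1.eventually_lt_const h] with z hz
    rw [orient, orient, abs_of_neg hz, abs_of_neg h, neg_div, neg_div, div_self hz.ne,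
      div_self h.ne]
  · filter_upwards [h1.eventually_const_lt h] with z hz
    rw [orient, orient, abs_of_pos hz, abs_of_pos h, div_self hz.ne', div_self h.ne']

theorem continuousOn_of_eventually_eq {f : Mod n → ℝ} {s : Set (Mod n)}
    (h : ∀ y ∈ s, ∀ᶠ z in 𝓝[s] y, f z = f y) : ContinuousOn f s := fun y hy =>
  (continuousWithinAt_const (b := f y)).congr_of_eventuallyEq (h y hy) rfl

theorem continuous_minkowski (hX : IsCapillary X ν θ) (t : ℝ) :
    Continuous (minkowski X ν θ t) := by
  have hσ : ∀ j ∈ Finset.range (n + 1), Continuous (sigma X ν j) := fun j hj =>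
    continuous_sigma hX (Nat.lt_succ_iff.1 (Finset.mem_range.1 hj))
  refine Continuous.add (Continuous.neg (Continuous.mul ?_
    (continuous_normalPart hX (contMDiff_supportField hX).continuous)))
    (Continuous.mul ?_ (continuous_normalPart hX (contMDiff_hypX hX).continuous))
  · exact continuous_finsetSum _ fun j hj => ((hσ j hj).mul continuous_const).mul continuous_const
  · exact continuous_finsetSum _ fun j hj => (hσ j hj).mul continuous_const

/-- The divergence theorem for the determinant field, localized by a function supported in a
chart. -/
theorem chartIntegral_minkowski [CompactSpace M] (hX : IsCapillary X ν θ) (t : ℝ) {ζ : M → ℝ}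
    (hζ : ∀ p, ∀ᶠ q in 𝓝 p, ζ q = ζ p) {ρ : M → ℝ} (hρ : ContMDiff (𝓡∂ n) 𝓘(ℝ) ∞ ρ) {a : M}
    (hsub : tsupport ρ ⊆ (extChartAt (𝓡∂ n) a).source) :
    chartIntegral X ν a (fun p => ζ p * (ρ p * minkowski X ν θ t p +
      gradRatio X ν (hypX X) (supportField X ν θ) (parallel X ν t) ρ p)) = 0 := by
  obtain ⟨hK, hKa⟩ := chart_image_tsupport hsub
  set V : Fin n → Mod n → ℝ := detField (loc (hypX X) a) (loc (supportField X ν θ) a)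
    (locDeriv (parallel X ν t) a) with hV
  set ε : Mod n → ℝ := fun y => ζ ((extChartAt (𝓡∂ n) a).symm y) * orient X ν a y with hε
  have hεe : ∀ y ∈ chartTarget n a, ∀ᶠ z in 𝓝[chartTarget n a] y, ε z = ε y := by
    intro y hy
    have h1 := ((continuousOn_chart_symm a y hy).eventually (hζ _))
    filter_upwards [h1, eventually_orient_eq hX hy] with z hz1 hz2
    simp only [hε, hz1, hz2]
  have hεc : ContinuousOn ε (chartTarget n a) := continuousOn_of_eventually_eq hεe
  have hg := continuousOn_gradSum (contMDiff_hypX hX) (contMDiff_supportField hX)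
    (contMDiff_parallel hX t) hρ a
  have hm := continuous_minkowski hX t
  have hgr := continuous_gradRatio hX (contMDiff_hypX hX) (contMDiff_supportField hX)
    (contMDiff_parallel hX t) hρ
  have hζc : Continuous ζ := continuous_iff_continuousAt.2 fun p =>
    continuousAt_const.congr (EventuallyEq.symm (hζ p))
  have hρc : ContinuousOn (loc ρ a) (chartTarget n a) := (contDiffOn_loc hρ a).continuousOn
  have hloc0 : ∀ y ∈ chartTarget n a, y ∉ extChartAt (𝓡∂ n) a '' tsupport ρ → loc ρ a y = 0 :=
    fun y hy h => image_eq_zero_of_notMem_tsupport (f := ρ) (notMem_tsupport_of_chart hy h)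
  refine integral_divergence_chart hK hKa (Y := fun i y => ε y * (loc ρ a y * V i y))
    (fun i => hεc.mul (hρc.mul (hg.2 i))) (fun i y hy h => by rw [hloc0 y hy h]; ring)
    (fun y hy h0 => by rw [hV, detField_boundary hX t hy h0]; ring) ?_
    (continuousOn_chart_integrand hX (hζc.mul ((hρ.continuous.mul hm).add hgr)) a) ?_
  · intro y hy h0
    obtain ⟨Y', h1, h2⟩ := divergence_parallel hX t hy h0
    have h3 := hasFDerivAt_loc hρ hy h0
    refine ⟨fun i => ε y • (loc ρ a y • Y' i + V i y • locDeriv ρ a y), fun i => ?_, ?_⟩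
    · refine ((h3.mul (h1 i)).const_mul (ε y)).congr_of_eventuallyEq ?_
      have h4 := hεe y hy
      rw [nhdsWithin_eq_nhds.2 (chartTarget_mem_nhds hy h0)] at h4
      filter_upwards [h4] with z hz
      rw [hz]
      rfl
    · have h4 := gradSum_eq hX (F := hypX X) (w := supportField X ν θ) (contMDiff_parallel hX t)
        hρ hy
      have h5 : ∑ i, V i y * locDeriv ρ a y (stdVec i) =
          gradSum (hypX X) (supportField X ν θ) (parallel X ν t) ρ a y :=
        Finset.sum_congr rfl fun i _ => mul_comm _ _
      have h6 : ∑ i, (ε y • (loc ρ a y • Y' i + V i y • locDeriv ρ a y)) (stdVec i) =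
          ε y * (loc ρ a y * ∑ i, Y' i (stdVec i) + ∑ i, V i y * locDeriv ρ a y (stdVec i)) := by
        rw [Finset.mul_sum, ← Finset.sum_add_distrib, Finset.mul_sum]
        rfl
      rw [h6, h2, h5, h4, ← orient_mul_density hX hy]
      simp only [hε, loc]
      ring
  · intro y hy h
    have h1 := notMem_tsupport_of_chart hy h
    simp only [gradRatio_eq_zero h1, image_eq_zero_of_notMem_tsupport h1]
    ring

/-- The Minkowski integrand has vanishing integral, also after multiplication by a locally constant
function. The gradient terms of the localized formulae cancel, because the partition of unity sums
to one. -/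
theorem integral_minkowski [CompactSpace M] (hX : IsCapillary X ν θ) (P : ChartPartition n M)
    (t : ℝ) {ζ : M → ℝ} (hζ : ∀ p, ∀ᶠ q in 𝓝 p, ζ q = ζ p) :
    P.integral X ν (fun p => ζ p * minkowski X ν θ t p) = 0 := by
  set g : M → M → ℝ := fun a =>
    gradRatio X ν (hypX X) (supportField X ν θ) (parallel X ν t) (P.fn a) with hg
  have hm := continuous_minkowski hX t
  have hζc : Continuous ζ := continuous_iff_continuousAt.2 fun p =>
    continuousAt_const.congr (EventuallyEq.symm (hζ p))
  have hgc : ∀ a, Continuous (g a) := fun a => continuous_gradRatio hX (contMDiff_hypX hX)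
    (contMDiff_supportField hX) (contMDiff_parallel hX t) (P.smooth a)
  have hfc : ∀ a, Continuous fun p => ζ p * (P.fn a p * minkowski X ν θ t p + g a p) := fun a =>
    hζc.mul (((P.smooth a).continuous.mul hm).add (hgc a))
  have h1 : (fun p => ζ p * minkowski X ν θ t p) = fun p => ∑ a ∈ P.centers,
      ζ p * (P.fn a p * minkowski X ν θ t p + g a p) := by
    funext p
    rw [← Finset.mul_sum, Finset.sum_add_distrib, ← Finset.sum_mul, P.sum_eq_one, hg,
      sum_gradRatio]
    ring
  rw [h1, P.integral_sum hX _ fun a _ => hfc a]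
  refine Finset.sum_eq_zero fun a _ => ?_
  rw [P.integral_eq_chartIntegral hX (P.subordinate a) (hfc a) fun p hp => by
    simp only [hg, gradRatio_eq_zero hp, image_eq_zero_of_notMem_tsupport hp]; ring]
  exact chartIntegral_minkowski hX t hζ (P.smooth a) (P.subordinate a)

theorem eq_zero_of_sum_pow_eq_zero {m : ℕ} {c : ℕ → ℝ}
    (h : ∀ t : ℝ, ∑ j ∈ Finset.range m, c j * t ^ j = 0) {j : ℕ} (hj : j < m) : c j = 0 := by
  set q : Polynomial ℝ := ∑ i ∈ Finset.range m, Polynomial.C (c i) * Polynomial.X ^ i with hq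
  have h1 : q = 0 := Polynomial.funext fun t => by
    simpa [hq, Polynomial.eval_finsetSum] using h t
  have h2 := congrArg (fun r => Polynomial.coeff r j) h1
  simpa [hq, Polynomial.finsetSum_coeff, Polynomial.coeff_C_mul, Polynomial.coeff_X_pow, hj]
    using h2

/-- The Minkowski formula for consecutive mean curvatures, weighted by a locally constant
function. -/
theorem integral_meanCurvature [CompactSpace M] (hX : IsCapillary X ν θ) (P : ChartPartition n M)
    {ζ : M → ℝ} (hζ : ∀ p, ∀ᶠ q in 𝓝 p, ζ q = ζ p) {j : ℕ} (hj : j < n) :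
    P.integral X ν (fun p => ζ p * (meanCurvature X ν j p * normalPart X ν (supportField X ν θ) p))
      = P.integral X ν
        (fun p => ζ p * (meanCurvature X ν (j + 1) p * normalPart X ν (hypX X) p)) := by
  set r := normalPart X ν (supportField X ν θ) with hr
  set q := normalPart X ν (hypX X) with hq
  have hζc : Continuous ζ := continuous_iff_continuousAt.2 fun p =>
    continuousAt_const.congr (EventuallyEq.symm (hζ p))
  have hrc : Continuous r := continuous_normalPart hX (contMDiff_supportField hX).continuous
  have hqc : Continuous q := continuous_normalPart hX (contMDiff_hypX hX).continuous
  have hσ : ∀ i < n + 1, Continuous (sigma X ν i) := fun i hi =>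
    continuous_sigma hX (Nat.lt_succ_iff.1 hi)
  set A : ℕ → ℝ := fun i => P.integral X ν fun p => ζ p * (sigma X ν i p * r p) with hA
  set B : ℕ → ℝ := fun i => P.integral X ν fun p => ζ p * (sigma X ν i p * q p) with hB
  have hpoly : ∀ t : ℝ, ∑ i ∈ Finset.range n,
      (-(((n - i : ℕ) : ℝ) * A i) + ((i + 1 : ℕ) : ℝ) * B (i + 1)) * t ^ i = 0 := by
    intro t
    have h1 : (fun p => ζ p * minkowski X ν θ t p) = fun p => ∑ i ∈ Finset.range n,
        (-(((n - i : ℕ) : ℝ) * t ^ i) * (ζ p * (sigma X ν i p * r p)) +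
          (((i + 1 : ℕ) : ℝ) * t ^ i) * (ζ p * (sigma X ν (i + 1) p * q p))) := by
      funext p
      rw [minkowski, Finset.sum_range_succ, Finset.sum_range_succ', Finset.sum_add_distrib]
      simp only [Nat.sub_self, Nat.cast_zero, zero_mul, mul_zero, add_zero, Nat.add_sub_cancel]
      rw [mul_add, mul_neg, Finset.sum_mul, Finset.sum_mul, Finset.mul_sum, Finset.mul_sum,
        ← Finset.sum_neg_distrib]
      congr 1 <;> exact Finset.sum_congr rfl fun i _ => by ring
    have h2 := integral_minkowski hX P t hζ
    rw [h1, P.integral_sum hX] at h2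
    · rw [← h2]
      refine Finset.sum_congr rfl fun i hi => ?_
      have hi := Finset.mem_range.1 hi
      rw [P.integral_add hX, P.integral_const_mul, P.integral_const_mul]
      · simp only [hA, hB]
        ring
      · exact continuous_const.mul (hζc.mul ((hσ i (by omega)).mul hrc))
      · exact continuous_const.mul (hζc.mul ((hσ (i + 1) (by omega)).mul hqc))
    · intro i hi
      have hi := Finset.mem_range.1 hi
      exact (continuous_const.mul (hζc.mul ((hσ i (by omega)).mul hrc))).add
        (continuous_const.mul (hζc.mul ((hσ (i + 1) (by omega)).mul hqc)))
  have hcoef := eq_zero_of_sum_pow_eq_zero hpoly hj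
  have hH : ∀ i (f : M → ℝ), P.integral X ν (fun p => ζ p * (meanCurvature X ν i p * f p)) =
      (n.choose i : ℝ)⁻¹ * P.integral X ν (fun p => ζ p * (sigma X ν i p * f p)) := by
    intro i f
    rw [← P.integral_const_mul]
    congr 1
    funext p
    rw [meanCurvature, sigma, div_eq_mul_inv]
    ring
  rw [hH, hH]
  change (n.choose j : ℝ)⁻¹ * A j = (n.choose (j + 1) : ℝ)⁻¹ * B (j + 1)
  have hch : (n.choose (j + 1) : ℝ) * ((j + 1 : ℕ) : ℝ) = n.choose j * ((n - j : ℕ) : ℝ) := by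
    exact_mod_cast Nat.choose_succ_right_eq n j
  have hc1 : (n.choose j : ℝ) ≠ 0 := by exact_mod_cast (Nat.choose_pos hj.le).ne'
  have hc2 : (n.choose (j + 1) : ℝ) ≠ 0 := by exact_mod_cast (Nat.choose_pos hj).ne'
  have hc3 : ((j + 1 : ℕ) : ℝ) ≠ 0 := by positivity
  field_simp
  refine mul_left_cancel₀ hc3 ?_
  linear_combination A j * hch - (n.choose j : ℝ) * hcoef

end WeightedIntegral

/-! ### Elliptic points -/

section Elliptic

open Set Filter Topology Matrix

set_option linter.unusedSectionVars false

variable {n : ℕ} [NeZero n] {M : Type*} [TopologicalSpace M] [ChartedSpace (EuclideanHalfSpace n) M]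
  [IsManifold (𝓡∂ n) ∞ M] {X ν : M → Amb n} {θ : ℝ}

theorem second_deriv_nonpos_of_isLocalMax {f g : ℝ → ℝ} {c : ℝ}
    (hf : ∀ᶠ s in 𝓝 0, HasDerivAt f (g s) s) (hg : HasDerivAt g c 0) (hmax : IsLocalMax f 0) :
    c ≤ 0 := by
  by_contra! hc
  have h1 : deriv f =ᶠ[𝓝 0] g := by
    filter_upwards [hf] with s hs using hs.deriv
  have h2 : deriv (deriv f) 0 = c := by rw [h1.deriv_eq, hg.deriv]
  have h3 := isLocalMin_of_deriv_deriv_pos (by rwa [h2]) hmax.deriv_eq_zero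
    hf.self_of_nhds.continuousAt
  have h4 : f =ᶠ[𝓝 0] fun _ => f 0 := by
    filter_upwards [h3, hmax] with s hs1 hs2 using le_antisymm hs2 hs1
  have h5 : deriv (deriv f) 0 = 0 := by
    rw [h4.deriv.deriv_eq]
    simp
  linarith

/-- The height: the hyperbolic sine of the signed hyperbolic distance to the totally geodesic
hyperplane `P`. -/
def height (X : M → Amb n) (p : M) : ℝ := conf (X p) * ⟪X p, lastVec n⟫

theorem continuous_height (hX : IsCapillary X ν θ) : Continuous (height (n := n) X) := by
  have h : Continuous fun p => ⟪lastVec n, hypX X p⟫ :=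
    continuous_const.inner (contMDiff_hypX hX).continuous
  exact h.congr fun p => inner_hypX_lastVec p

/-- First and second order conditions at an interior maximum of the height: there the hypersurface
lies on one side of a level set of the height, a hypersurface equidistant to `P`. -/
theorem exists_comparison (hX : IsCapillary X ν θ) {p : M} (hp : (𝓡∂ n).IsInteriorPoint p)
    (hmax : IsLocalMax (height X) p) :
    ∃ κ : ℝ, lastVec n + height X p • X p = κ • ν p ∧
      ∀ v : Mod n, height X p * ⟪baseDeriv X p v, baseDeriv X p v⟫ ≤
        κ * ⟪baseDeriv ν p v, baseDeriv X p v⟫ := by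
  set u := height (n := n) X p with hu
  set y := extChartAt (𝓡∂ n) p p with hy
  have hyt : y ∈ chartTarget n p := mem_extChartAt_target p
  have hsymm : (extChartAt (𝓡∂ n) p).symm y = p := extChartAt_to_inv p
  have hy0 : 0 < y 0 := by
    rw [← isInteriorPoint_chart_symm hyt, hsymm]
    exact hp
  -- This function of `q` has the sign of `height X q - u`, and involves no quotients.
  have hψ : ∀ᶠ q in 𝓝 p, 2 * ⟪X q, lastVec n⟫ + u * ‖X q‖ ^ 2 - u ≤ 0 := by
    filter_upwards [hmax] with q hq
    have h1 := one_sub_norm_sq_pos (hX.mem_ball q)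
    rw [height, conf, ← hu, div_mul_eq_mul_div, div_le_iff₀ h1] at hq
    linarith
  have hψ0 : 2 * ⟪X p, lastVec n⟫ + u * ‖X p‖ ^ 2 - u = 0 := by
    have h1 := one_sub_norm_sq_pos (hX.mem_ball p)
    have h2 : u * (1 - ‖X p‖ ^ 2) = 2 * ⟪X p, lastVec n⟫ := by
      rw [hu, height, conf]
      field_simp
    linarith
  have hline : ∀ (v : Mod n) (s : ℝ), HasDerivAt (fun s : ℝ => y + s • v) v s := fun v s => by
    simpa using ((hasDerivAt_id s).smul_const v).const_add y
  have hzero : ∀ v : Mod n, y + (0 : ℝ) • v = y := fun v => by simp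
  have hnear : ∀ v : Mod n, ∀ᶠ s : ℝ in 𝓝 0,
      y + s • v ∈ chartTarget n p ∧ 0 < (y + s • v) 0 := by
    intro v
    have h1 : {z : Mod n | z ∈ chartTarget n p ∧ 0 < z 0} ∈ 𝓝 (y + (0 : ℝ) • v) := by
      rw [hzero]
      have := isOpen_interior.mem_nhds (mem_interior_chartTarget.2 ⟨hyt, hy0⟩)
      filter_upwards [this] with z hz using mem_interior_chartTarget.1 hz
    exact (hline v 0).continuousAt.preimage_mem_nhds h1
  have hcurve : ∀ {f : M → Amb n}, ContMDiff (𝓡∂ n) 𝓘(ℝ, Amb n) ∞ f → ∀ v : Mod n,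
      ∀ᶠ s : ℝ in 𝓝 0, HasDerivAt (fun s : ℝ => loc f p (y + s • v))
        (locDeriv f p (y + s • v) v) s := by
    intro f hf v
    filter_upwards [hnear v] with s hs
    exact (hasFDerivAt_loc hf hs.1 hs.2).comp_hasDerivAt s (hline v s)
  set f : Mod n → ℝ → ℝ := fun v s =>
    2 * ⟪loc X p (y + s • v), lastVec n⟫ + u * ‖loc X p (y + s • v)‖ ^ 2 - u with hf
  have hfmax : ∀ v, IsLocalMax (f v) 0 := by
    intro v
    have h1 : ContinuousAt (fun s : ℝ => (extChartAt (𝓡∂ n) p).symm (y + s • v)) 0 := by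
      have h2 : ContinuousAt (extChartAt (𝓡∂ n) p).symm (y + (0 : ℝ) • v) := by
        rw [hzero]
        exact (continuousOn_chart_symm p).continuousAt (chartTarget_mem_nhds hyt hy0)
      exact ContinuousAt.comp (f := fun s : ℝ => y + s • v) h2 (hline v 0).continuousAt
    have h2 : (extChartAt (𝓡∂ n) p).symm (y + (0 : ℝ) • v) = p := by rw [hzero, hsymm]
    have h3 := h1.eventually (p := fun q => 2 * ⟪X q, lastVec n⟫ + u * ‖X q‖ ^ 2 - u ≤ 0)
      (by beta_reduce; rwa [h2])
    filter_upwards [h3] with s hs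
    refine hs.trans (le_of_eq ?_)
    simp only [hf, loc]
    rw [h2, hψ0]
  have hfd : ∀ v, ∀ᶠ s : ℝ in 𝓝 0, HasDerivAt (f v)
      (2 * ⟪locDeriv X p (y + s • v) v, lastVec n + u • loc X p (y + s • v)⟫) s := by
    intro v
    filter_upwards [hcurve hX.smooth v] with s hs
    have h1 := (((hs.inner ℝ (hasDerivAt_const s (lastVec n))).const_mul 2).add
      (hs.norm_sq.const_mul u)).sub_const u
    refine h1.congr_deriv ?_
    rw [inner_add_right, inner_smul_right, inner_zero_right,
      real_inner_comm (loc X p (y + s • v))]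
    ring
  have horth : ∀ v : Mod n, ⟪baseDeriv X p v, lastVec n + u • X p⟫ = 0 := by
    intro v
    have h1 := (hfmax v).hasDerivAt_eq_zero (hfd v).self_of_nhds
    rw [hzero] at h1
    have h2 : loc X p y = X p := loc_self X p
    rw [h2] at h1
    exact (mul_eq_zero.1 h1).resolve_left two_ne_zero
  obtain ⟨κ, hκ⟩ : ∃ κ : ℝ, lastVec n + u • X p = κ • ν p := by
    have hν := normal_ne_zero hX p
    have hνν : ⟪ν p, ν p⟫ ≠ 0 := fun h => hν (inner_self_eq_zero.1 h)
    refine ⟨⟪ν p, lastVec n + u • X p⟫ / ⟪ν p, ν p⟫, ?_⟩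
    set z := lastVec n + u • X p - (⟪ν p, lastVec n + u • X p⟫ / ⟪ν p, ν p⟫) • ν p with hz
    have h1 : ⟪ν p, z⟫ = 0 := by
      rw [hz, inner_sub_right, inner_smul_right]
      field_simp
      ring
    obtain ⟨w, hw⟩ := mem_range_of_orthogonal (L := (baseDeriv X p).toLinearMap)
      (baseDeriv_injective hX p) hν (baseDeriv_orth hX p) h1
    have hw' : baseDeriv X p w = z := hw
    have h2 : ∀ x, ⟪x, z⟫ = ⟪x, lastVec n + u • X p⟫ -
        ⟪ν p, lastVec n + u • X p⟫ / ⟪ν p, ν p⟫ * ⟪x, ν p⟫ := fun x => by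
      rw [hz, inner_sub_right, inner_smul_right]
    have h3 : ⟪z, z⟫ = 0 := by
      have h4 : ⟪z, lastVec n + u • X p⟫ = 0 := hw' ▸ horth w
      rw [h2 z, h4, real_inner_comm (ν p) z, h1]
      ring
    exact sub_eq_zero.1 (inner_self_eq_zero.1 h3)
  refine ⟨κ, hκ, fun v => ?_⟩
  have hg : HasDerivAt (fun s : ℝ => 2 * ⟪locDeriv X p (y + s • v) v,
      lastVec n + u • loc X p (y + s • v)⟫)
      (2 * ⟪baseDeriv X p v, u • baseDeriv X p v - κ • baseDeriv ν p v⟫) 0 := by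
    have h1 := (hcurve hX.smooth v).self_of_nhds
    have h2 := (hcurve hX.normal_smooth v).self_of_nhds
    have h3 : HasDerivAt (fun s : ℝ => locDeriv X p (y + s • v) v)
        (fderivWithin ℝ (locDeriv X p) (chartTarget n p) y v v) 0 := by
      have h4 : HasFDerivAt (locDeriv X p)
          (fderivWithin ℝ (locDeriv X p) (chartTarget n p) y) (y + (0 : ℝ) • v) := by
        rw [hzero]
        exact ((contDiffOn_locDeriv hX.smooth p).differentiableOn (by simp) y
          hyt).hasFDerivWithinAt.hasFDerivAt (chartTarget_mem_nhds hyt hy0)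
      have h5 := h4.comp_hasDerivAt (0 : ℝ) (hline v 0)
      exact (ContinuousLinearMap.apply ℝ (Amb n) v).hasFDerivAt.comp_hasDerivAt (0 : ℝ) h5
    -- Subtracting `κ ν` does not change the inner product, and makes the second factor vanish
    -- at the maximum.
    have h4 := (h3.inner ℝ (((h1.const_smul u).const_add (lastVec n)).sub
      (h2.const_smul κ))).const_mul 2
    refine (h4.congr_deriv ?_).congr_of_eventuallyEq ?_
    · rw [hzero]
      have h5 : loc X p y = X p := loc_self X p
      have h6 : loc ν p y = ν p := loc_self ν p
      have h7 : lastVec n + u • X p - κ • ν p = 0 := sub_eq_zero.2 hκ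
      simp only [Pi.sub_apply, Pi.smul_apply, hzero, h5, h6, h7, inner_zero_right, add_zero]
      rfl
    · filter_upwards [hnear v] with s hs
      have h5 : ⟪locDeriv X p (y + s • v) v, loc ν p (y + s • v)⟫ = 0 := by
        rw [real_inner_comm]
        exact locDeriv_orth hX hs.1 v
      simp only [Pi.sub_apply, Pi.smul_apply]
      rw [inner_sub_right, inner_smul_right, h5]
      ring
  have h1 := second_deriv_nonpos_of_isLocalMax (hfd v) hg (hfmax v)
  rw [inner_sub_right, inner_smul_right, inner_smul_right,
    real_inner_comm (baseDeriv ν p v)] at h1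
  linarith

/-- At an interior maximum of the height all principal curvatures have the same sign. -/
theorem exists_sign_principalCurvatures (hX : IsCapillary X ν θ) {p : M}
    (hp : (𝓡∂ n).IsInteriorPoint p) (hmax : IsLocalMax (height X) p) :
    ∃ κ : ℝ, ∀ r ∈ principalCurvatures X ν p, 0 < κ * r := by
  obtain ⟨κ, h1, h2⟩ := exists_comparison hX hp hmax
  refine ⟨κ, roots_sign (firstMatrix_posDef hX p) fun v hv => ?_⟩
  rw [← secondForm_toLp hX, secondForm_eq hX]
  set w : Mod n := WithLp.toLp 2 v with hw
  have hconf := conf_pos (hX.mem_ball p)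
  have hu : 0 < height X p := mul_pos hconf (hX.interior_pos p hp)
  have h3 : 0 < ⟪baseDeriv X p w, baseDeriv X p w⟫ := by
    refine real_inner_self_pos.2 fun h => hv ?_
    have h4 := baseDeriv_injective hX p (h.trans (map_zero _).symm)
    simpa [hw] using congrArg WithLp.ofLp h4
  have h4 : conf (X p) * (κ * ⟪X p, ν p⟫) =
      height X p + conf (X p) * (height X p * ‖X p‖ ^ 2) := by
    rw [← inner_smul_right, ← h1, inner_add_right, inner_smul_right, real_inner_self_eq_norm_sq,
      height]
    ring
  have h5 : 0 ≤ conf (X p) * (height X p * ‖X p‖ ^ 2) := by positivity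
  have h6 : 0 < κ * (⟪baseDeriv ν p w, baseDeriv X p w⟫ +
      conf (X p) * ⟪X p, ν p⟫ * ⟪baseDeriv X p w, baseDeriv X p w⟫) := by
    have h7 := h2 w
    nlinarith [mul_pos hu h3, mul_nonneg h5 h3.le]
  have h8 := mul_pos (pow_pos hconf 2) h6
  linarith

/-- Every nonempty open and closed part of the hypersurface contains a point at which all principal
curvatures have the same sign. -/
theorem exists_elliptic_point [CompactSpace M] (hX : IsCapillary X ν θ) {A : Set M}
    (hA : IsClopen A) (hne : A.Nonempty) :
    ∃ p ∈ A, ∃ κ : ℝ, ∀ r ∈ principalCurvatures X ν p, 0 < κ * r := by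
  obtain ⟨p, hpA, hmax⟩ := hA.isClosed.isCompact.exists_isMaxOn hne
    (continuous_height hX).continuousOn
  refine ⟨p, hpA, exists_sign_principalCurvatures hX ?_ (hmax.isLocalMax (hA.isOpen.mem_nhds hpA))⟩
  by_contra hint
  have hb : (𝓡∂ n).IsBoundaryPoint p := ((𝓡∂ n).isBoundaryPoint_iff_not_isInteriorPoint p).2 hint
  have h0 : height X p = 0 := by rw [height, hX.boundary_zero p hb, mul_zero]
  -- The interior is dense, and the height is positive there.
  set y := extChartAt (𝓡∂ n) p p with hy
  have hyt : y ∈ chartTarget n p := mem_extChartAt_target p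
  have hsymm : (extChartAt (𝓡∂ n) p).symm y = p := extChartAt_to_inv p
  have h1 : ∀ᶠ z in 𝓝[chartTarget n p] y, (extChartAt (𝓡∂ n) p).symm z ∈ A :=
    (continuousOn_chart_symm p y hyt).eventually
      (by rw [hsymm]; exact hA.isOpen.mem_nhds hpA)
  have h2 : (𝓝[interior (chartTarget n p)] y).NeBot :=
    mem_closure_iff_nhdsWithin_neBot.1 (chartTarget_subset_closure_interior p hyt)
  obtain ⟨z, hzA, hz⟩ := ((h1.filter_mono (nhdsWithin_mono y interior_subset)).and
    self_mem_nhdsWithin).exists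
  have hz' := mem_interior_chartTarget.1 hz
  have h3 := hX.interior_pos _ ((isInteriorPoint_chart_symm hz'.1).2 hz'.2)
  have h4 : height X ((extChartAt (𝓡∂ n) p).symm z) ≤ height X p := hmax hzA
  rw [h0, height] at h4
  exact absurd h4 (not_le.2 (mul_pos (conf_pos (hX.mem_ball _)) h3))

end Elliptic

/-! ### Hypersurfaces with proportional mean curvatures -/

section Conclusion

open Set Filter Topology

set_option linter.unusedSectionVars false

variable {n : ℕ} [NeZero n] {M : Type*} [TopologicalSpace M] [ChartedSpace (EuclideanHalfSpace n) M]
  [IsManifold (𝓡∂ n) ∞ M] {X ν : M → Amb n} {θ : ℝ}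

/-- The component of the conormal along `E` is at most the norm of `ν`, and `|cos θ| < 1`. -/
theorem normalPart_supportField_pos (hX : IsCapillary X ν θ) (p : M) :
    0 < normalPart X ν (supportField X ν θ) p := by
  have hν := norm_normal_pos hX p
  have h1 := abs_inner_hypConormal_le (X p) (ν p) (lastVec n) (norm_lastVec n)
  have h2 : |Real.cos θ| < 1 := by
    rw [abs_lt]
    constructor
    · rw [← Real.cos_pi]
      exact Real.cos_lt_cos_of_nonneg_of_le_pi hX.angle_mem.1.le le_rfl hX.angle_mem.2
    · rw [← Real.cos_zero]
      exact Real.cos_lt_cos_of_nonneg_of_le_pi le_rfl hX.angle_mem.2.le hX.angle_mem.1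
  refine div_pos ?_ hν
  rw [supportField, inner_sub_right, inner_smul_right, inner_conormal_hypN hX, sub_pos]
  calc Real.cos θ * ⟪conormal X ν p, lastVec n⟫
      ≤ |Real.cos θ * ⟪conormal X ν p, lastVec n⟫| := le_abs_self _
    _ = |Real.cos θ| * |⟪conormal X ν p, lastVec n⟫| := abs_mul _ _
    _ ≤ |Real.cos θ| * ‖ν p‖ := mul_le_mul_of_nonneg_left h1 (abs_nonneg _)
    _ < ‖ν p‖ := by nlinarith

theorem esymm_map_mul (s : Multiset ℝ) (e : ℝ) (j : ℕ) :
    (s.map fun r => e * r).esymm j = e ^ j * s.esymm j := by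
  rw [Multiset.esymm, Multiset.esymm, Multiset.powersetCard_map, Multiset.map_map,
    ← Multiset.sum_map_mul_left]
  congr 1
  refine Multiset.map_congr rfl fun u hu => ?_
  rw [Function.comp_apply, Multiset.prod_map_mul, Multiset.map_const', Multiset.prod_replicate,
    (Multiset.mem_powersetCard.1 hu).2, Multiset.map_id']

/-- The set of points at which the principal curvatures, multiplied by `e`, lie in the Gårding
cone of order `k`. -/
def gardingSet (X ν : M → Amb n) (k : ℕ) (e : ℝ) : Set M :=
  {p | ∀ j ≤ k, 0 < e ^ j * sigma X ν j p}

theorem isClopen_gardingSet (hX : IsCapillary X ν θ) {k : ℕ} (hk : k ≤ n)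
    (h0 : ∀ p, sigma X ν k p ≠ 0) {e : ℝ} (he : e ≠ 0) : IsClopen (gardingSet X ν k e) := by
  have hc : ∀ j ≤ k, Continuous fun p => e ^ j * sigma X ν j p := fun j hj =>
    continuous_const.mul (continuous_sigma hX (hj.trans hk))
  have h1 : gardingSet X ν k e = {p | ∀ j ≤ k, 0 ≤ e ^ j * sigma X ν j p} := by
    ext p
    refine ⟨fun h j hj => (h j hj).le, fun h => ?_⟩
    have h2 := esymm_pos_of_nonneg ((principalCurvatures X ν p).map fun r => e * r) (k := k)
      (by rw [Multiset.card_map, card_principalCurvatures hX]; exact hk)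
      (fun j hj => by rw [esymm_map_mul]; exact h j hj)
      (by rw [esymm_map_mul]; exact mul_ne_zero (pow_ne_zero _ he) (h0 p))
    intro j hj
    have h3 := h2 j hj
    rwa [esymm_map_mul] at h3
  constructor
  · rw [h1, ofPred_forall]
    refine isClosed_iInter fun j => ?_
    rw [ofPred_forall]
    exact isClosed_iInter fun hj => isClosed_le continuous_const (hc j hj)
  · have h2 : gardingSet X ν k e = ⋂ j ∈ Finset.range (k + 1), {p | 0 < e ^ j * sigma X ν j p} := by
      ext p
      simp [gardingSet]
    rw [h2]
    exact isOpen_biInter_finset fun j hj =>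
      isOpen_lt continuous_const (hc j (Nat.lt_succ_iff.1 (Finset.mem_range.1 hj)))

/-- A point at which all principal curvatures have the same sign lies in one of the two Gårding
sets. -/
theorem mem_gardingSet_of_sign (hX : IsCapillary X ν θ) {k : ℕ} (hk : k ≤ n) {p : M} {κ : ℝ}
    (h : ∀ r ∈ principalCurvatures X ν p, 0 < κ * r) :
    p ∈ gardingSet X ν k 1 ∨ p ∈ gardingSet X ν k (-1) := by
  have key : ∀ e : ℝ, (∀ r ∈ principalCurvatures X ν p, 0 < e * r) → p ∈ gardingSet X ν k e := by
    intro e he j hj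
    rw [sigma, ← esymm_map_mul]
    refine esymm_pos_of_pos _ (fun r hr => ?_)
      (by rw [Multiset.card_map, card_principalCurvatures hX]; exact hj.trans hk)
    obtain ⟨r', hr', rfl⟩ := Multiset.mem_map.1 hr
    exact he r' hr'
  rcases le_or_gt 0 κ with hκ | hκ
  · exact Or.inl (key 1 fun r hr => by rw [one_mul]; exact pos_of_mul_pos_right (h r hr) hκ)
  · exact Or.inr (key (-1) fun r hr => by nlinarith [h r hr])

/-- The two Gårding sets cover the hypersurface: the complement would contain an elliptic point. -/
theorem gardingSet_union [CompactSpace M] (hX : IsCapillary X ν θ) {k : ℕ} (hk : k ≤ n)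
    (h0 : ∀ p, sigma X ν k p ≠ 0) (p : M) :
    p ∈ gardingSet X ν k 1 ∨ p ∈ gardingSet X ν k (-1) := by
  by_contra hp
  obtain ⟨q, hq, κ, hκ⟩ := exists_elliptic_point hX
    ((isClopen_gardingSet hX hk h0 one_ne_zero).union
      (isClopen_gardingSet hX hk h0 (neg_ne_zero.2 one_ne_zero))).compl ⟨p, hp⟩
  exact hq (mem_gardingSet_of_sign hX hk hκ)

/-- The Newton-Maclaurin inequality in a Gårding set. -/
theorem newton_maclaurin_gardingSet (hX : IsCapillary X ν θ) {k l : ℕ} (hl : 1 ≤ l) (hlk : l < k)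
    (hk : k ≤ n) {e : ℝ} (he : e * e = 1) {p : M} (hp : p ∈ gardingSet X ν k e) :
    e ^ (k + l - 1) * (meanCurvature X ν k p * meanCurvature X ν (l - 1) p) ≤
      e ^ (k + l - 1) * (meanCurvature X ν (k - 1) p * meanCurvature X ν l p) ∧
    (meanCurvature X ν k p * meanCurvature X ν (l - 1) p =
        meanCurvature X ν (k - 1) p * meanCurvature X ν l p →
      ∃ c, ∀ r ∈ principalCurvatures X ν p, r = c) := by
  set s := (principalCurvatures X ν p).map fun r => e * r with hs
  have hcard : Multiset.card s = n := by rw [hs, Multiset.card_map, card_principalCurvatures hX]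
  obtain ⟨h1, h2⟩ := newton_maclaurin s (fun j => e ^ j * meanCurvature X ν j p)
    (fun j => by
      rw [hcard, hs, esymm_map_mul, meanCurvature, mul_div_assoc]) hl hlk (by rwa [hcard])
    (fun i hi => by rw [hs, esymm_map_mul]; exact hp i hi)
  have e1 : e ^ k * e ^ (l - 1) = e ^ (k + l - 1) := by rw [← pow_add]; congr 1; omega
  have e2 : e ^ (k - 1) * e ^ l = e ^ (k + l - 1) := by rw [← pow_add]; congr 1; omega
  have e3 : e ^ k * meanCurvature X ν k p * (e ^ (l - 1) * meanCurvature X ν (l - 1) p) =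
      e ^ (k + l - 1) * (meanCurvature X ν k p * meanCurvature X ν (l - 1) p) := by
    rw [← e1]; ring
  have e4 : e ^ (k - 1) * meanCurvature X ν (k - 1) p * (e ^ l * meanCurvature X ν l p) =
      e ^ (k + l - 1) * (meanCurvature X ν (k - 1) p * meanCurvature X ν l p) := by
    rw [← e2]; ring
  simp only [e3, e4] at h1 h2
  refine ⟨h1, fun h => ?_⟩
  obtain ⟨c, hc⟩ := h2 (by rw [h])
  refine ⟨e * c, fun r hr => ?_⟩
  rw [← hc _ (Multiset.mem_map_of_mem _ hr), ← mul_assoc, he, one_mul]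

/-- A point at which all principal curvatures agree is umbilical. -/
theorem secondForm_eq_of_principalCurvatures_eq (hX : IsCapillary X ν θ) {p : M} {c : ℝ}
    (hc : ∀ r ∈ principalCurvatures X ν p, r = c) (v w : TangentSpace (𝓡∂ n) p) :
    secondForm X ν p v w = c * firstForm X p v w := by
  have h1 := eq_smul_of_roots_eq (firstMatrix_posDef hX p) (secondMatrix_isHermitian hX p) hc
  obtain ⟨v, rfl⟩ := (WithLp.equiv 2 (Fin n → ℝ)).symm.surjective (v : Mod n)
  obtain ⟨w, rfl⟩ := (WithLp.equiv 2 (Fin n → ℝ)).symm.surjective (w : Mod n)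
  change secondForm X ν p (WithLp.toLp 2 v : Mod n) (WithLp.toLp 2 w : Mod n) =
    c * firstForm X p (WithLp.toLp 2 v : Mod n) (WithLp.toLp 2 w : Mod n)
  rw [secondForm_toLp hX, firstForm_toLp hX, h1, Matrix.smul_mulVec, dotProduct_smul, smul_eq_mul]

theorem meanCurvature_eq_zero_of_secondForm_eq_zero {p : M}
    (h : ∀ v w, secondForm X ν p v w = 0) {l : ℕ} (hl : 1 ≤ l) : meanCurvature X ν l p = 0 := by
  have h1 : secondMatrix X ν p = 0 := by
    ext i j
    exact h _ _
  have h2 : principalCurvatures X ν p = (principalCurvatures X ν p).map fun r => 0 * r := by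
    have h3 : principalCurvatures X ν p = Multiset.replicate n 0 := by
      rw [principalCurvatures, weingarten, h1, Matrix.mul_zero, Matrix.charpoly_zero]
      simp [Polynomial.roots_pow, Multiset.nsmul_singleton]
    rw [h3]
    simp
  rw [meanCurvature, h2, esymm_map_mul, zero_pow (by omega), zero_mul, zero_div]

end Conclusion

end Capillary

end

theorem theorem1p5 {n : ℕ} [NeZero n] {M : Type*} [TopologicalSpace M] [T2Space M]
    [CompactSpace M] [Nonempty M] [ChartedSpace (EuclideanHalfSpace n) M]
    [IsManifold (𝓡∂ n) ∞ M] (X ν : M → Capillary.Amb n) (θ : ℝ)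
    (hX : Capillary.IsCapillary X ν θ) (k l : ℕ) (hl : 1 ≤ l) (hlk : l < k) (hkn : k ≤ n)
    (α : ℝ)
    (hquot : ∀ p, Capillary.meanCurvature X ν k p / Capillary.meanCurvature X ν l p = α)
    (hpos : ∀ p, 0 < Capillary.meanCurvature X ν l p) :
    Capillary.IsTotallyUmbilical X ν ∧ ¬ Capillary.IsTotallyGeodesic X ν := by
  open Capillary in
  have hHk : ∀ p, meanCurvature X ν k p = α * meanCurvature X ν l p := fun p =>
    (div_eq_iff (hpos p).ne').1 (hquot p)
  have hgeo : ¬ IsTotallyGeodesic X ν := fun h => by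
    obtain ⟨p⟩ := ‹Nonempty M›
    exact (hpos p).ne' (meanCurvature_eq_zero_of_secondForm_eq_zero (h p) hl)
  refine ⟨?_, hgeo⟩
  have hα : α ≠ 0 := by
    rintro rfl
    obtain ⟨p, -, κ, hκ⟩ := exists_elliptic_point hX isClopen_univ Set.univ_nonempty
    have h1 : sigma X ν k p = 0 := by
      have h2 := hHk p
      rw [zero_mul, meanCurvature, div_eq_zero_iff] at h2
      exact h2.resolve_right (by exact_mod_cast (Nat.choose_pos hkn).ne')
    rcases mem_gardingSet_of_sign hX hkn hκ with h | h <;>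
      · have h2 := h k le_rfl
        rw [h1, mul_zero] at h2
        exact lt_irrefl _ h2
  have hσ : ∀ p, sigma X ν k p ≠ 0 := fun p h => by
    have h1 := hHk p
    rw [meanCurvature, show (principalCurvatures X ν p).esymm k = 0 from h, zero_div] at h1
    exact mul_ne_zero hα (hpos p).ne' h1.symm
  have hclopen := isClopen_gardingSet hX hkn hσ one_ne_zero
  have hunion := gardingSet_union hX hkn hσ
  classical
  -- On each of the two Gårding sets the weight makes the integrand of the Minkowski formula
  -- nonnegative.
  set ζ : M → ℝ := fun p => if p ∈ gardingSet X ν k 1 then 1 else (-1) ^ (k + l - 1) with hζ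
  have hζloc : ∀ p, ∀ᶠ q in nhds p, ζ q = ζ p := by
    intro p
    by_cases hp : p ∈ gardingSet X ν k 1
    · filter_upwards [hclopen.isOpen.mem_nhds hp] with q hq
      simp only [hζ, hp, hq, if_true]
    · filter_upwards [hclopen.compl.isOpen.mem_nhds hp] with q hq
      have hq' : q ∉ gardingSet X ν k 1 := hq
      simp only [hζ, hp, hq', if_false]
  have hζ0 : ∀ p, ζ p ≠ 0 := by
    intro p
    simp only [hζ]
    split_ifs
    · exact one_ne_zero
    · exact pow_ne_zero _ (neg_ne_zero.2 one_ne_zero)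
  have hNM : ∀ p, ζ p * (meanCurvature X ν k p * meanCurvature X ν (l - 1) p) ≤
        ζ p * (meanCurvature X ν (k - 1) p * meanCurvature X ν l p) ∧
      (meanCurvature X ν k p * meanCurvature X ν (l - 1) p =
          meanCurvature X ν (k - 1) p * meanCurvature X ν l p →
        ∃ c, ∀ r ∈ principalCurvatures X ν p, r = c) := by
    intro p
    by_cases hp : p ∈ gardingSet X ν k 1
    · have h1 := newton_maclaurin_gardingSet hX hl hlk hkn (one_mul 1) hp
      rw [one_pow] at h1
      simpa only [hζ, hp, if_true] using h1
    · have h1 := newton_maclaurin_gardingSet hX hl hlk hkn (by norm_num)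
        ((hunion p).resolve_left hp)
      simpa only [hζ, hp, if_false] using h1
  set r := normalPart X ν (supportField X ν θ) with hr
  have hrpos : ∀ p, 0 < r p := normalPart_supportField_pos hX
  set f : M → ℝ := fun p => ζ p * ((meanCurvature X ν (k - 1) p -
    α * meanCurvature X ν (l - 1) p) * r p) with hf
  have hdiff : ∀ p, ζ p * (meanCurvature X ν (k - 1) p * meanCurvature X ν l p) -
      ζ p * (meanCurvature X ν k p * meanCurvature X ν (l - 1) p) =
      ζ p * (meanCurvature X ν (k - 1) p - α * meanCurvature X ν (l - 1) p) *
        meanCurvature X ν l p := fun p => by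
    rw [hHk]
    ring
  have hf0 : ∀ p, 0 ≤ f p := by
    intro p
    have h1 := sub_nonneg.2 (hNM p).1
    rw [hdiff] at h1
    have h2 := nonneg_of_mul_nonneg_left h1 (hpos p)
    have h3 := mul_nonneg h2 (hrpos p).le
    rwa [mul_assoc] at h3
  have hHc : ∀ j ≤ n, Continuous (meanCurvature X ν j) := fun j hj =>
    (continuous_sigma hX hj).div_const _
  have hζc : Continuous ζ := continuous_iff_continuousAt.2 fun p =>
    continuousAt_const.congr (Filter.EventuallyEq.symm (hζloc p))
  have hrc : Continuous r := continuous_normalPart hX (contMDiff_supportField hX).continuous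
  have hc1 : Continuous fun p => ζ p * (meanCurvature X ν (k - 1) p * r p) :=
    hζc.mul ((hHc _ (by omega)).mul hrc)
  have hc2 : Continuous fun p => ζ p * (meanCurvature X ν (l - 1) p * r p) :=
    hζc.mul ((hHc _ (by omega)).mul hrc)
  have hc3 : Continuous fun p => -α * (ζ p * (meanCurvature X ν (l - 1) p * r p)) :=
    continuous_const.mul hc2
  have hfeq : f = fun p => ζ p * (meanCurvature X ν (k - 1) p * r p) +
      -α * (ζ p * (meanCurvature X ν (l - 1) p * r p)) := by
    funext p
    simp only [hf]
    ring
  obtain ⟨P⟩ := exists_chartPartition (n := n) (M := M)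
  have hint : P.integral X ν f = 0 := by
    have h1 := integral_meanCurvature hX P hζloc (j := k - 1) (by omega)
    have h2 := integral_meanCurvature hX P hζloc (j := l - 1) (by omega)
    rw [Nat.sub_add_cancel (by omega)] at h1 h2
    have h3 : (fun p => ζ p * (meanCurvature X ν k p * normalPart X ν (hypX X) p)) =
        fun p => α * (ζ p * (meanCurvature X ν l p * normalPart X ν (hypX X) p)) := by
      funext p
      rw [hHk]
      ring
    rw [hfeq, P.integral_add hX hc1 hc3, P.integral_const_mul, h1, h2, h3,
      P.integral_const_mul]
    ring
  have hfc : Continuous f := by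
    rw [hfeq]
    exact hc1.add hc3
  have hzero := P.eq_zero_of_integral_eq_zero hX hfc hf0 hint
  have humb : ∀ p, ∃ c, ∀ r ∈ principalCurvatures X ν p, r = c := by
    intro p
    refine (hNM p).2 (mul_left_cancel₀ (hζ0 p) (sub_eq_zero.1 ?_).symm)
    have h1 : ζ p * (meanCurvature X ν (k - 1) p - α * meanCurvature X ν (l - 1) p) = 0 := by
      have h2 := hzero p
      simp only [hf] at h2
      rw [← mul_assoc] at h2
      exact (mul_eq_zero.1 h2).resolve_right (hrpos p).ne'
    rw [hdiff, h1, zero_mul]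
  choose c hc using humb
  exact ⟨c, fun p v w => secondForm_eq_of_principalCurvatures_eq hX (hc p) v w⟩
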